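/- Let $n\ge 4$ and $3\le k\le n$ be integers, and write $x=(y,z)\in\mathbb R^k\times\mathbb R^{n-k}=\mathbb R^n$. Let $1<p\le \frac{2n}{n+1}$ (so that $p<n$) and set $p_1^*:=\frac{p(n-1)}{n-p}$ (so that $p<p_1^*\le 2$). Let $D^{1,p}(\mathbb R^n)$ be the closure of $C_c^\infty(\mathbb R^n)$ with respect to the norm $\|u\|_{D^{1,p}}=\bigl(\int_{\mathbb R^n}|Du|^p\,dx\bigr)^{1/p}$, realized as a space of functions in $L^{np/(n-p)}(\mathbb R^n)$. For $a>0$ let $$v(x)=a\bigl[(1+|y|)^2+|z|^2\bigr]^{-\frac{n-p}{2(p-1)}}.$$ Let $\varepsilon_i\in(0,1)$ with $\varepsilon_i\to0$, and let $\{\phi_i\}_{i\in\mathbb N}$ be a sequence in $D^{1,p}(\mathbb R^n)$ such that, for all $i$, $$\int_{\mathbb R^n}\bigl(|Dv|+\varepsilon_i|D\phi_i|\bigr)^{p-2}|D\phi_i|^2\,dx\le 1 .$$ Then, after passing to a subsequence (still denoted $\phi_i$, $\varepsilon_i$), $\phi_i$ converges weakly in $D^{1,p}(\mathbb R^n)$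 to some $\phi\in D^{1,p}(\mathbb R^n)\cap L^2(\mathbb R^n;|y|^{-1}v^{p_1^*-2})$, i.e. $\int_{\mathbb R^n}|y|^{-1}v^{p_1^*-2}|\phi|^2\,dx<\infty$. Moreover, along this subsequence, for every $C_1\ge 0$, as $i\to\infty$, $$\int_{\mathbb R^n}|y|^{-1}\frac{(v+C_1\varepsilon_i|\phi_i|)^{p_1^*}}{v^2+|\varepsilon_i\phi_i|^2}\,|\phi_i|^2\,dx\ \longrightarrow\ \int_{\mathbb R^n}|y|^{-1}v^{p_1^*-2}|\phi|^2\,dx ,$$ and likewise $$\int_{\mathbb R^n}|y|^{-1}\frac{|v+C_1\varepsilon_i\phi_i|^{p_1^*}}{v^2+|\varepsilon_i\phi_i|^2}\,|\phi_i|^2\,dx\ \longrightarrow\ \int_{\mathbb R^n}|y|^{-1}v^{p_1^*-2}|\phi|^2\,dx .$$ -/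

import Mathlib

open MeasureTheory Filter Topology
open scoped ENNReal ContDiff

noncomputable section

namespace HSM

/-- The Euclidean space `ℝⁿ`; a point is written `x = (y, z)` where `y ∈ ℝᵏ` consists of the
first `k` coordinates of `x` and `z ∈ ℝⁿ⁻ᵏ` of the remaining ones. -/
abbrev E (n : ℕ) : Type := EuclideanSpace ℝ (Fin n)

/-- `|y|`, the Euclidean norm of the first `k` coordinates of `x`. -/
def normY {n : ℕ} (k : ℕ) (x : E n) : ℝ := √(∑ i ∈ Finset.univ.filter (fun i : Fin n => (i : ℕ) < k), x i ^ 2)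

/-- `|z|`, the Euclidean norm of the last `n - k` coordinates of `x`. -/
def normZ {n : ℕ} (k : ℕ) (x : E n) : ℝ := √(∑ i ∈ Finset.univ.filter (fun i : Fin n => k ≤ (i : ℕ)), x i ^ 2)

/-- The Sobolev exponent `p* = np / (n - p)`. -/
def sobExp (n : ℕ) (p : ℝ) : ℝ := n * p / (n - p)

/-- The weighted exponent `p₁* = p(n - 1) / (n - p)`. -/
def weightExp (n : ℕ) (p : ℝ) : ℝ := p * (n - 1) / (n - p)

/-- The extremal function `v(x) = a [(1 + |y|)² + |z|²] ^ (-(n - p) / (2(p - 1)))`. -/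
def extremal (n k : ℕ) (p a : ℝ) (x : E n) : ℝ :=
  a * ((1 + normY k x) ^ 2 + normZ k x ^ 2) ^ (-((n - p) / (2 * (p - 1))))

theorem fact_one_le {p : ℝ} (hp : 1 < p) : Fact (1 ≤ ENNReal.ofReal p) :=
  ⟨by simpa using hp.le⟩

theorem fact_one_le_sobExp {n : ℕ} {p : ℝ} (hp : 1 < p) (hpn : p < n) :
    Fact (1 ≤ ENNReal.ofReal (sobExp n p)) := by
  refine ⟨?_⟩
  rw [ENNReal.one_le_ofReal, sobExp, one_le_div (by linarith)]
  nlinarith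

/-- The pairs (function, gradient) in `L^{p*}(ℝⁿ) × Lᵖ(ℝⁿ; ℝⁿ)`. -/
abbrev Pair (n : ℕ) (p : ℝ) : Type :=
  Lp ℝ (ENNReal.ofReal (sobExp n p)) (volume : Measure (E n)) ×
    Lp (E n) (ENNReal.ofReal p) (volume : Measure (E n))

/-- The pairs `(ψ, Dψ)` with `ψ ∈ C_c^∞(ℝⁿ)`. -/
def testPairs (n : ℕ) (p : ℝ) : Submodule ℝ (Pair n p) where
  carrier := {w | ∃ ψ : E n → ℝ, ContDiff ℝ ∞ ψ ∧ HasCompactSupport ψ ∧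
    w.1 =ᵐ[volume] ψ ∧ w.2 =ᵐ[volume] gradient ψ}
  zero_mem' := by
    refine ⟨0, contDiff_const, HasCompactSupport.zero, Lp.coeFn_zero _ _ _, ?_⟩
    have h : gradient (0 : E n → ℝ) = 0 := gradient_const' (F := E n) (0 : ℝ)
    rw [h]
    exact Lp.coeFn_zero _ _ _
  add_mem' := by
    rintro w₁ w₂ ⟨ψ₁, s₁, c₁, e₁, g₁⟩ ⟨ψ₂, s₂, c₂, e₂, g₂⟩
    refine ⟨ψ₁ + ψ₂, s₁.add s₂, c₁.add c₂, (Lp.coeFn_add _ _).trans (e₁.add e₂), ?_⟩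
    have h : gradient (ψ₁ + ψ₂) = gradient ψ₁ + gradient ψ₂ := by
      funext x
      simp only [gradient, Pi.add_apply]
      rw [fderiv_add (s₁.differentiable (by simp) x) (s₂.differentiable (by simp) x), map_add]
    rw [h]
    exact (Lp.coeFn_add _ _).trans (g₁.add g₂)
  smul_mem' := by
    rintro c w ⟨ψ, s, hc, e, g⟩
    refine ⟨c • ψ, s.const_smul c, hc.smul_left (f := fun _ => c),
      (Lp.coeFn_smul _ _).trans (e.const_smul c), ?_⟩
    have h : gradient (c • ψ) = c • gradient ψ := by
      funext x
      simp only [gradient, Pi.smul_apply]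
      rw [fderiv_const_smul (s.differentiable (by simp) x)]
      simp
    rw [h]
    exact (Lp.coeFn_smul _ _).trans (g.const_smul c)

/-- The space `D^{1,p}(ℝⁿ)`, `1 < p < n`: the closure of `C_c^∞(ℝⁿ)` for the norm `‖Du‖_{Lᵖ}`.
By the Sobolev inequality `‖ψ‖_{L^{p*}} ≤ C ‖Dψ‖_{Lᵖ}`, a sequence of test functions that is Cauchy
for this norm also converges in `L^{p*}`; the closure is therefore the closure of the pairs
`(ψ, Dψ)` in `L^{p*} × Lᵖ`. An element is a function `u` together with its weak gradient `Du`
(which is determined by `u`). -/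
def D1p (n : ℕ) (p : ℝ) (hp : 1 < p) (hpn : p < n) : Submodule ℝ (Pair n p) :=
  haveI := fact_one_le hp
  haveI := fact_one_le_sobExp hp hpn
  (testPairs n p).topologicalClosure

section

variable {n : ℕ} {p : ℝ} {hp : 1 < p} {hpn : p < n}

/-- The function `u` underlying an element of `D^{1,p}(ℝⁿ)`. -/
def D1p.fn (u : D1p n p hp hpn) : E n → ℝ := u.1.1

/-- The weak gradient `Du` of an element of `D^{1,p}(ℝⁿ)`. -/
def D1p.grad (u : D1p n p hp hpn) : E n → E n := u.1.2

/-- The norm `‖u‖_{D^{1,p}} = ‖Du‖_{Lᵖ(ℝⁿ)}`. -/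
def D1p.gradNorm (u : D1p n p hp hpn) : ℝ := ‖u.1.2‖

/-- Weak convergence in `D^{1,p}(ℝⁿ)`: `ℓ(uᵢ) → ℓ(u)` for every linear functional `ℓ` on
`D^{1,p}(ℝⁿ)` that is bounded with respect to the norm `‖Du‖_{Lᵖ}`. -/
def D1p.TendstoWeakly (u : ℕ → D1p n p hp hpn) (u₀ : D1p n p hp hpn) : Prop :=
  ∀ l : D1p n p hp hpn →ₗ[ℝ] ℝ, (∃ C : ℝ, ∀ w, |l w| ≤ C * D1p.gradNorm w) →
    Tendsto (fun i => l (u i)) atTop (𝓝 (l u₀))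

end

/-- The measure `|y|⁻¹ v^{p₁* - 2} dx` on `ℝⁿ`. -/
def weightMeasure (n k : ℕ) (p a : ℝ) : Measure (E n) :=
  volume.withDensity fun x =>
    ENNReal.ofReal ((normY k x)⁻¹ * extremal n k p a x ^ (weightExp n p - 2))

end HSM

end

/-!
The proof rests on two inequalities for the Orlicz function `J(s, t) = (s² + t²)^{(p-2)/2} t²`, which
interpolates between `s^{p-2} t²` for `t ≤ s` and `tᵖ` for `t ≥ s`. Put `γ = (n-p)/(p-1)` and
`w = (1 + |x|²)^{-γ/2}`, so that `v` is comparable to `w` and `|Dv| ≤ C m` with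
`m = (1 + |x|²)^{-(γ+1)/2}`. For `u` in `D^{1,p}` one has

* an Orlicz–Hardy inequality `∫ |y|⁻ᵖ J(w, u) ≤ 64 ∫ J(m, |Du|)` (`D1p.lintegral_orlicz_hardy_le`),
  obtained by integrating the divergence of a regularization of `|y|⁻ᵖ J(w, u) y`, where the
  derivative that falls on `w` has the favourable sign because `w` decreases in `|y|`;
* an Orlicz–Sobolev inequality `∫ J(w, u)^{n/(n-p)} ≤ (C ∫ J(m, |Du|))^{n/(n-p)}`
  (`D1p.exists_lintegral_orlicz_sobolev_le`), the Sobolev inequality for `J(w, u)^{1/p}`; here the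
  derivative of `w` produces the weight `(1 + |x|²)^{-p/2} ≤ |y|⁻ᵖ` of the Hardy inequality.

The energy bound says that `∫ J(m, ε_i |Dφ_i|) ≤ B ε_i²` (`exists_orlicz_energy_le`).

*Compactness.* The rescaled gradients `(m² + ε_i²|Dφ_i|²)^{(p-2)/4} Dφ_i` are bounded in `L²`, and
multiplication by `m^{(2-p)/2}` maps `L²` to `Lᵖ`, because `m` is in `Lᵖ`. A weak limit in `L²`
therefore gives a weak limit of `φ_i` in `D^{1,p}` (`D1p.exists_tendstoWeakly_of_energy`). Weak
convergence gives pointwise convergence of ball means, and ball means approximate the functions in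
`Lᵖ` uniformly in `i`; a subsequence converges almost everywhere (`D1p.exists_subseq_tendsto_ae`).

*Convergence of the integrals.* The integrands are bounded by a multiple of
`|y|⁻¹ (w² + ε_i²φ_i²)^{(q-2)/2} φ_i²` with `q = p₁*`. This density is at most
`η |y|⁻ᵖ ε_i⁻² J + A ε_i⁻² J^r + η (ε_i⁻² J)^r + D 1_{ball}` with `J = J(w, ε_i φ_i)`, `r = n/(n-p)`
and `η` as small as desired (`exists_weighted_density_bound`): criticality of `q` makes the weights
scale correctly, and the extra factor `|y|^{p-1} w^{q-p}` is small near `{y = 0}` and at infinity. By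
the two inequalities the first three terms have integrals `O(η) + O(ε_i^{2r-2})`, and dominated
convergence up to small remainders (`tendsto_lintegral_of_dominated_add_small`) concludes, giving
also the finiteness of the limit.
-/

namespace HSM


/-! ### The Orlicz-type density -/

/-- The function `J(s, t) = (s² + t²)^{(p-2)/2} t²`. For `1 < p < 2` it is comparable to `s^{p-2} t²`
when `|t| ≤ s` and to `|t|ᵖ` when `|t| ≥ s`. -/
noncomputable def orlicz (p s t : ℝ) : ℝ := (s ^ 2 + t ^ 2) ^ ((p - 2) / 2) * t ^ 2

theorem rpow_neg_add_mul_rpow_le {s a b e c : ℝ} (hs : 0 < s) (ha : 0 ≤ a) (hab : a ≤ b)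
    (he : 0 ≤ e) (hec : e ≤ c) : (s + a) ^ (-e) * a ^ c ≤ (s + b) ^ (-e) * b ^ c := by
  have hb : 0 ≤ b := ha.trans hab
  have key : ∀ t : ℝ, 0 ≤ t → (s + t) ^ (-e) * t ^ c = (t / (s + t)) ^ e * t ^ (c - e) := by
    intro t ht
    rw [Real.div_rpow ht (by positivity), Real.rpow_neg (by positivity), div_mul_eq_mul_div,
      ← Real.rpow_add_of_nonneg ht he (by linarith)]
    rw [show e + (c - e) = c by ring]
    field_simp
  rw [key a ha, key b hb]
  gcongr ?_ ^ e * ?_ ^ _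
  · rw [div_le_div_iff₀ (by positivity) (by positivity)]
    nlinarith

section

variable {p : ℝ}

theorem orlicz_nonneg (p s t : ℝ) : 0 ≤ orlicz p s t := by
  unfold orlicz; positivity

@[simp] theorem orlicz_zero (p s : ℝ) : orlicz p s 0 = 0 := by simp [orlicz]

@[simp] theorem orlicz_abs (p s t : ℝ) : orlicz p s |t| = orlicz p s t := by simp [orlicz]

theorem orlicz_anti (hp2 : p < 2) {s s' : ℝ} (hs : 0 < s) (hss : s ≤ s') (t : ℝ) :
    orlicz p s' t ≤ orlicz p s t := by
  unfold orlicz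
  refine mul_le_mul_of_nonneg_right ?_ (sq_nonneg t)
  exact Real.rpow_le_rpow_of_nonpos (by positivity) (by gcongr) (by linarith)

theorem orlicz_mono (hp : 1 < p) (hp2 : p < 2) {s t t' : ℝ} (hs : 0 < s) (ht : 0 ≤ t)
    (htt : t ≤ t') : orlicz p s t ≤ orlicz p s t' := by
  have := rpow_neg_add_mul_rpow_le (s := s ^ 2) (a := t ^ 2) (b := t' ^ 2) (e := (2 - p) / 2)
    (c := 1) (by positivity) (by positivity) (by gcongr) (by linarith) (by linarith)
  rw [Real.rpow_one, Real.rpow_one, show -((2 - p) / 2) = (p - 2) / 2 by ring] at this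
  exact this

theorem orlicz_le_rpow (hp2 : p < 2) (s : ℝ) {t : ℝ} (ht : 0 ≤ t) : orlicz p s t ≤ t ^ p := by
  rcases ht.eq_or_lt with rfl | ht
  · simpa using Real.rpow_nonneg le_rfl p
  · have h : (s ^ 2 + t ^ 2) ^ ((p - 2) / 2) ≤ (t ^ 2) ^ ((p - 2) / 2) :=
      Real.rpow_le_rpow_of_nonpos (by positivity) (by nlinarith [sq_nonneg s]) (by linarith)
    calc orlicz p s t ≤ (t ^ 2) ^ ((p - 2) / 2) * t ^ 2 :=
          mul_le_mul_of_nonneg_right h (sq_nonneg t)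
      _ = t ^ p := by
        rw [← Real.rpow_natCast t 2, ← Real.rpow_mul ht.le, ← Real.rpow_add ht]
        congr 1; push_cast; ring

theorem rpow_le_orlicz (hp : 1 < p) (hp2 : p < 2) {s t : ℝ} (hs : 0 ≤ s) (ht : 0 < t)
    (hst : s ≤ t) : t ^ p ≤ 2 * orlicz p s t := by
  have h : (2 * t ^ 2) ^ ((p - 2) / 2) ≤ (s ^ 2 + t ^ 2) ^ ((p - 2) / 2) :=
    Real.rpow_le_rpow_of_nonpos (by positivity) (by nlinarith) (by linarith)
  have h2 : (1 : ℝ) ≤ 2 * 2 ^ ((p - 2) / 2) := by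
    have : (2 : ℝ) ^ (-1 : ℝ) ≤ 2 ^ ((p - 2) / 2) :=
      Real.rpow_le_rpow_of_exponent_le (by norm_num) (by linarith)
    rw [Real.rpow_neg_one] at this
    linarith
  have h3 : t ^ p = (t ^ 2) ^ ((p - 2) / 2) * t ^ 2 := by
    rw [← Real.rpow_natCast t 2, ← Real.rpow_mul ht.le, ← Real.rpow_add ht]
    congr 1; push_cast; ring
  rw [Real.mul_rpow (by norm_num) (by positivity)] at h
  calc t ^ p = 1 * ((t ^ 2) ^ ((p - 2) / 2) * t ^ 2) := by rw [h3, one_mul]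
    _ ≤ (2 * 2 ^ ((p - 2) / 2)) * ((t ^ 2) ^ ((p - 2) / 2) * t ^ 2) := by gcongr
    _ = 2 * (2 ^ ((p - 2) / 2) * (t ^ 2) ^ ((p - 2) / 2) * t ^ 2) := by ring
    _ ≤ 2 * orlicz p s t := by unfold orlicz; gcongr

theorem orlicz_smul (s t : ℝ) {l : ℝ} (hl : 0 < l) :
    orlicz p (l * s) (l * t) = l ^ p * orlicz p s t := by
  unfold orlicz
  rw [show (l * s) ^ 2 + (l * t) ^ 2 = l ^ 2 * (s ^ 2 + t ^ 2) by ring,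
    Real.mul_rpow (by positivity) (by positivity), ← Real.rpow_natCast l 2, ← Real.rpow_mul hl.le,
    mul_pow, ← Real.rpow_natCast l 2]
  have : l ^ p = l ^ (((2 : ℕ) : ℝ) * ((p - 2) / 2)) * l ^ ((2 : ℕ) : ℝ) := by
    rw [← Real.rpow_add hl]; congr 1; push_cast; ring
  rw [this]; ring

theorem orlicz_le_of_le_add (hp : 1 < p) (hp2 : p < 2) {s t a b : ℝ} (hs : 0 < s) (ht : 0 ≤ t)
    (ha : 0 ≤ a) (hb : 0 ≤ b) (h : t ≤ a + b) :
    orlicz p s t ≤ 4 * (orlicz p s a + orlicz p s b) := by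
  have key : ∀ c : ℝ, 0 ≤ c → orlicz p s (2 * c) ≤ 4 * orlicz p s c := by
    intro c hc
    unfold orlicz
    have : (s ^ 2 + (2 * c) ^ 2) ^ ((p - 2) / 2) ≤ (s ^ 2 + c ^ 2) ^ ((p - 2) / 2) :=
      Real.rpow_le_rpow_of_nonpos (by positivity) (by nlinarith) (by linarith)
    nlinarith [mul_le_mul_of_nonneg_right this (sq_nonneg c)]
  rcases le_total a b with hab | hab
  · linarith [orlicz_mono hp hp2 hs ht (show t ≤ 2 * b by linarith), key b hb,
      orlicz_nonneg p s a]
  · linarith [orlicz_mono hp hp2 hs ht (show t ≤ 2 * a by linarith), key a ha,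
      orlicz_nonneg p s b]

/-- A Young inequality for the Orlicz-type density: if `h ≤ δ t` the first term dominates, otherwise
the second one does, because `t ↦ (s² + t²)^{(p-2)/2} t` is increasing. -/
theorem orlicz_young (hp : 1 < p) (hp2 : p < 2) {s t h δ : ℝ} (hs : 0 < s) (ht : 0 ≤ t)
    (hh : 0 ≤ h) (hδ : 0 < δ) (hδ1 : δ ≤ 1) :
    (s ^ 2 + t ^ 2) ^ ((p - 2) / 2) * t * h ≤ δ * orlicz p s t + δ⁻¹ * orlicz p s h := by
  have h1 : 0 ≤ δ * orlicz p s t := mul_nonneg hδ.le (orlicz_nonneg _ _ _)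
  have h2 : 0 ≤ δ⁻¹ * orlicz p s h := mul_nonneg (by positivity) (orlicz_nonneg _ _ _)
  have hA : 0 ≤ (s ^ 2 + t ^ 2) ^ ((p - 2) / 2) := by positivity
  have hδi : 1 ≤ δ⁻¹ := (one_le_inv₀ hδ).2 hδ1
  by_cases hc : h ≤ δ * t
  · have : (s ^ 2 + t ^ 2) ^ ((p - 2) / 2) * t * h ≤ δ * orlicz p s t := by
      unfold orlicz
      calc _ ≤ (s ^ 2 + t ^ 2) ^ ((p - 2) / 2) * t * (δ * t) := by gcongr
        _ = _ := by ring
    linarith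
  push Not at hc
  have hth : t ≤ δ⁻¹ * h := by
    rw [inv_mul_eq_div, le_div_iff₀ hδ]; linarith
  suffices (s ^ 2 + t ^ 2) ^ ((p - 2) / 2) * t * h ≤ δ⁻¹ * orlicz p s h by linarith
  by_cases hc' : h ≤ t
  · have : (s ^ 2 + t ^ 2) ^ ((p - 2) / 2) ≤ (s ^ 2 + h ^ 2) ^ ((p - 2) / 2) :=
      Real.rpow_le_rpow_of_nonpos (by positivity) (by gcongr) (by linarith)
    unfold orlicz
    calc _ ≤ (s ^ 2 + h ^ 2) ^ ((p - 2) / 2) * (δ⁻¹ * h) * h := by gcongr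
      _ = _ := by ring
  · push Not at hc'
    have := rpow_neg_add_mul_rpow_le (s := s ^ 2) (a := t ^ 2) (b := h ^ 2) (e := (2 - p) / 2)
      (c := 1 / 2) (by positivity) (by positivity) (by gcongr) (by linarith) (by linarith)
    rw [← Real.sqrt_eq_rpow, ← Real.sqrt_eq_rpow, Real.sqrt_sq ht, Real.sqrt_sq hh,
      show -((2 - p) / 2) = (p - 2) / 2 by ring] at this
    calc _ ≤ (s ^ 2 + h ^ 2) ^ ((p - 2) / 2) * h * h := by gcongr
      _ = 1 * orlicz p s h := by unfold orlicz; ring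
      _ ≤ _ := by gcongr; exact orlicz_nonneg _ _ _

theorem orlicz_mul_div_rpow_le (hp : 1 < p) (hp2 : p < 2) {s t h : ℝ} (hs : 0 < s) (ht : 0 < t)
    (hh : 0 ≤ h) : orlicz p s t * (h / t) ^ p ≤ orlicz p s t + orlicz p s h := by
  by_cases hc : h ≤ t
  · have : (h / t) ^ p ≤ 1 :=
      Real.rpow_le_one (by positivity) ((div_le_one ht).2 hc) (by linarith)
    nlinarith [orlicz_nonneg p s t, orlicz_nonneg p s h]
  · push Not at hc
    have := rpow_neg_add_mul_rpow_le (s := s ^ 2) (a := t ^ 2) (b := h ^ 2) (e := (2 - p) / 2)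
      (c := (2 - p) / 2) (by positivity) (by positivity) (by gcongr) (by linarith) le_rfl
    have hh' : 0 < h := ht.trans hc
    have e : ∀ u : ℝ, 0 < u → orlicz p s u
        = (s ^ 2 + u ^ 2) ^ (-((2 - p) / 2)) * (u ^ 2) ^ ((2 - p) / 2) * u ^ p := by
      intro u hu
      unfold orlicz
      rw [mul_assoc, ← Real.rpow_natCast u 2, ← Real.rpow_mul hu.le, ← Real.rpow_add hu]
      congr 2 <;> [ring; (push_cast; ring)]
    rw [e t ht, e h hh', Real.div_rpow hh ht.le]
    have htp : (0 : ℝ) < t ^ p := by positivity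
    calc _ = (s ^ 2 + t ^ 2) ^ (-((2 - p) / 2)) * (t ^ 2) ^ ((2 - p) / 2) * h ^ p := by
          field_simp
      _ ≤ (s ^ 2 + h ^ 2) ^ (-((2 - p) / 2)) * (h ^ 2) ^ ((2 - p) / 2) * h ^ p := by gcongr
      _ ≤ _ := by
        have : 0 ≤ (s ^ 2 + t ^ 2) ^ (-((2 - p) / 2)) * (t ^ 2) ^ ((2 - p) / 2) * t ^ p := by
          positivity
        linarith

end


/-! ### Smooth radial weights -/

/-- The radial weight `(1 + |x|²)^{-r/2}`. With `γ = (n - p) / (p - 1)`, the function `v` is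
comparable to `bracket γ` and `|Dv|` is bounded by a multiple of `bracket (γ + 1)`. -/
noncomputable def bracket {n : ℕ} (r : ℝ) (x : E n) : ℝ := (1 + ‖x‖ ^ 2) ^ (-(r / 2))

section

variable {n : ℕ}

theorem bracket_pos (r : ℝ) (x : E n) : 0 < bracket r x := by
  unfold bracket; positivity

theorem contDiff_bracket (r : ℝ) : ContDiff ℝ ∞ (bracket r : E n → ℝ) := by
  unfold bracket
  refine ContDiff.rpow_const_of_ne ?_ (fun x => by positivity)
  exact contDiff_const.add (contDiff_norm_sq ℝ)

theorem continuous_bracket (r : ℝ) : Continuous (bracket r : E n → ℝ) :=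
  (contDiff_bracket r).continuous

theorem bracket_add_one (r : ℝ) (x : E n) : bracket (r + 1) x = bracket r x / √(1 + ‖x‖ ^ 2) := by
  unfold bracket
  rw [Real.sqrt_eq_rpow, ← Real.rpow_sub (by positivity)]
  congr 1; ring

theorem hasFDerivAt_bracket (r : ℝ) (x : E n) :
    HasFDerivAt (bracket r) (-(r * (1 + ‖x‖ ^ 2) ^ (-(r / 2) - 1)) • innerSL ℝ x) x := by
  have h1 : HasFDerivAt (fun x : E n => 1 + ‖x‖ ^ 2) (2 • innerSL ℝ x) x :=
    ((hasStrictFDerivAt_norm_sq x).hasFDerivAt).const_add 1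
  have h2 := h1.rpow_const (p := -(r / 2)) (Or.inl (by positivity))
  refine h2.congr_fderiv ?_
  ext v
  simp
  ring

theorem norm_fderiv_bracket_le {r : ℝ} (hr : 0 ≤ r) (x : E n) :
    ‖fderiv ℝ (bracket r) x‖ ≤ r * bracket (r + 1) x := by
  rw [(hasFDerivAt_bracket r x).fderiv, norm_smul, innerSL_apply_norm, norm_neg, Real.norm_eq_abs,
    abs_of_nonneg (by positivity), mul_assoc]
  refine mul_le_mul_of_nonneg_left ?_ hr
  have h : bracket (r + 1) x = (1 + ‖x‖ ^ 2) ^ (-(r / 2) - 1) * √(1 + ‖x‖ ^ 2) := by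
    unfold bracket
    rw [Real.sqrt_eq_rpow, ← Real.rpow_add (by positivity)]
    congr 1; ring
  rw [h]
  gcongr
  exact Real.le_sqrt_of_sq_le (by linarith)

/-! ### An Orlicz–Hardy inequality for test functions -/

theorem normY_sq (k : ℕ) (x : E n) :
    normY k x ^ 2 = ∑ i ∈ Finset.univ.filter (fun i : Fin n => (i : ℕ) < k), x i ^ 2 :=
  Real.sq_sqrt (Finset.sum_nonneg fun _ _ => sq_nonneg _)

theorem normY_nonneg (k : ℕ) (x : E n) : 0 ≤ normY k x := Real.sqrt_nonneg _

theorem normY_sq_add_normZ_sq (k : ℕ) (x : E n) : normY k x ^ 2 + normZ k x ^ 2 = ‖x‖ ^ 2 := by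
  have h2 : normZ k x ^ 2
      = ∑ i ∈ Finset.univ.filter (fun i : Fin n => k ≤ (i : ℕ)), x i ^ 2 :=
    Real.sq_sqrt (Finset.sum_nonneg fun _ _ => sq_nonneg _)
  rw [normY_sq, h2, EuclideanSpace.real_norm_sq_eq]
  rw [← Finset.sum_filter_add_sum_filter_not Finset.univ (fun i : Fin n => (i : ℕ) < k)]
  congr 2
  ext i; simp

/-- The point `(y, 0)`. -/
noncomputable def partY (k : ℕ) (x : E n) : E n :=
  ∑ i ∈ Finset.univ.filter (fun i : Fin n => (i : ℕ) < k), x i • EuclideanSpace.single i (1 : ℝ)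

theorem inner_partY (k : ℕ) (x : E n) : inner ℝ x (partY k x) = normY k x ^ 2 := by
  rw [normY_sq, partY, inner_sum]
  refine Finset.sum_congr rfl fun i _ => ?_
  rw [inner_smul_right, EuclideanSpace.inner_single_right]
  simp [sq]

theorem partY_apply (k : ℕ) (x : E n) (i : Fin n) :
    partY k x i = if (i : ℕ) < k then x i else 0 := by
  rw [partY, WithLp.ofLp_sum, Finset.sum_apply, Finset.sum_filter]
  rw [Finset.sum_eq_single i (fun j _ hj => by split_ifs <;> simp [hj.symm]) (by simp)]
  split_ifs <;> simp

theorem norm_partY (k : ℕ) (x : E n) : ‖partY k x‖ = normY k x := by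
  rw [EuclideanSpace.norm_eq, normY, Finset.sum_filter]
  congr 1
  refine Finset.sum_congr rfl fun i _ => ?_
  rw [partY_apply]
  split_ifs <;> simp

theorem contDiff_normY_sq (k : ℕ) : ContDiff ℝ ∞ (fun x : E n => normY k x ^ 2) := by
  simp_rw [normY_sq]
  fun_prop

theorem continuous_normY (k : ℕ) : Continuous (fun x : E n => normY k x) := by
  unfold normY; fun_prop

theorem continuous_normZ (k : ℕ) : Continuous (fun x : E n => normZ k x) := by
  unfold normZ; fun_prop

theorem hasFDerivAt_normY_sq (k : ℕ) (x : E n) :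
    HasFDerivAt (fun x : E n => normY k x ^ 2) ((2 : ℝ) • innerSL ℝ (partY k x)) x := by
  have h : (fun x : E n => normY k x ^ 2)
      = fun x => ∑ i ∈ Finset.univ.filter (fun i : Fin n => (i : ℕ) < k),
        (EuclideanSpace.proj i x) ^ 2 := by
    ext x; rw [normY_sq]; rfl
  rw [h]
  have := HasFDerivAt.fun_sum (u := Finset.univ.filter (fun i : Fin n => (i : ℕ) < k))
    (fun i _ => ((EuclideanSpace.proj i : E n →L[ℝ] ℝ).hasFDerivAt (x := x)).pow 2)
  refine this.congr_fderiv ?_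
  ext v
  simp only [partY, PiLp.proj_apply, _root_.sum_apply, _root_.smul_apply,
    coe_innerSL_apply, sum_inner, inner_smul_left, EuclideanSpace.inner_single_left, smul_eq_mul,
    Finset.mul_sum]
  refine Finset.sum_congr rfl fun i _ => ?_
  simp
  ring

end

section

variable {n : ℕ} {p γ : ℝ} {g : E n → ℝ}

theorem hasCompactSupport_orlicz (hc : HasCompactSupport g) (s : E n → ℝ) :
    HasCompactSupport (fun x => orlicz p (s x) (g x)) :=
  hc.mono fun x hx h => hx (by simp [h])

theorem continuous_orlicz {α : Type*} [TopologicalSpace α] {s t : α → ℝ} (hs : Continuous s) (hs0 : ∀ x, 0 < s x)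
    (ht : Continuous t) : Continuous (fun x => orlicz p (s x) (t x)) := by
  unfold orlicz
  refine Continuous.mul ?_ (by fun_prop)
  refine Continuous.rpow_const (by fun_prop) fun x => Or.inl ?_
  have := hs0 x
  positivity

theorem contDiff_orlicz {s : E n → ℝ} (hs : ContDiff ℝ ∞ s) (hs0 : ∀ x, 0 < s x)
    (hg : ContDiff ℝ ∞ g) : ContDiff ℝ ∞ (fun x => orlicz p (s x) (g x)) := by
  unfold orlicz
  refine ContDiff.mul ?_ (hg.pow 2)
  refine ContDiff.rpow_const_of_ne ((hs.pow 2).add (hg.pow 2)) fun x => ?_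
  have := hs0 x
  positivity

/-- Since `bracket γ` decreases in `|y|` and `J` decreases in its first argument, only the
derivative of `g` contributes to a decrease of `J(bracket γ, g)` along `(y, 0)`. -/
theorem neg_fderiv_orlicz_partY_le (hp : 1 < p) (hp2 : p < 2) (hγ : 0 ≤ γ)
    (hg : ContDiff ℝ ∞ g) (k : ℕ) (x : E n) :
    -(fderiv ℝ (fun x => orlicz p (bracket γ x) (g x)) x (partY k x))
      ≤ 2 * ((bracket γ x ^ 2 + g x ^ 2) ^ ((p - 2) / 2) * |g x|) *
        (normY k x * ‖fderiv ℝ g x‖) := by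
  have hw0 := bracket_pos γ x
  have hw : HasFDerivAt (bracket γ) (fderiv ℝ (bracket γ : E n → ℝ) x) x :=
    (hasFDerivAt_bracket γ x).differentiableAt.hasFDerivAt
  have hg' : HasFDerivAt g (fderiv ℝ g x) x :=
    ((hg.differentiable (by simp)) x).hasFDerivAt
  have hB : (0 : ℝ) < bracket γ x ^ 2 + g x ^ 2 := by positivity
  have h1 := (((hw.pow 2).add (hg'.pow 2)).rpow_const (p := (p - 2) / 2) (Or.inl hB.ne')).mul
    (hg'.pow 2)
  have h2 : fderiv ℝ (fun x => orlicz p (bracket γ x) (g x)) x = _ := h1.fderiv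
  rw [h2]
  have hDw : fderiv ℝ (bracket γ : E n → ℝ) x (partY k x) ≤ 0 := by
    rw [(hasFDerivAt_bracket γ x).fderiv]
    simp only [_root_.smul_apply, coe_innerSL_apply, inner_partY, smul_eq_mul]
    have : 0 ≤ γ * (1 + ‖x‖ ^ 2) ^ (-(γ / 2) - 1) * normY k x ^ 2 := by positivity
    linarith
  have hDg : |fderiv ℝ g x (partY k x)| ≤ normY k x * ‖fderiv ℝ g x‖ := by
    rw [← norm_partY, mul_comm]; exact (fderiv ℝ g x).le_opNorm _
  have hb : (0 : ℝ) < (bracket γ x ^ 2 + g x ^ 2) ^ ((p - 2) / 2 - 1) := by positivity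
  have hBb : (bracket γ x ^ 2 + g x ^ 2) ^ ((p - 2) / 2)
      = (bracket γ x ^ 2 + g x ^ 2) ^ ((p - 2) / 2 - 1) * (bracket γ x ^ 2 + g x ^ 2) := by
    rw [← Real.rpow_add_one hB.ne']; congr 1; ring
  simp only [Pi.add_apply, _root_.add_apply,
    _root_.smul_apply, smul_eq_mul, nsmul_eq_mul, hBb]
  generalize (bracket γ x ^ 2 + g x ^ 2) ^ ((p - 2) / 2 - 1) = b at *
  generalize fderiv ℝ (bracket γ : E n → ℝ) x (partY k x) = dw at *
  generalize fderiv ℝ g x (partY k x) = dg at *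
  generalize normY k x * ‖fderiv ℝ g x‖ = L at *
  generalize bracket γ x = w at *
  generalize g x = t at *
  have e1 : 0 ≤ (p - 2) * dw * (b * w * t ^ 2) :=
    mul_nonneg (mul_nonneg_of_nonpos_of_nonpos (by linarith) hDw) (by positivity)
  have e2 : -(t * dg) ≤ |t| * L := by
    calc -(t * dg) ≤ |t * dg| := neg_le_abs _
      _ = |t| * |dg| := abs_mul _ _
      _ ≤ _ := by gcongr
  have hL : 0 ≤ |t| * L := mul_nonneg (abs_nonneg _) ((abs_nonneg _).trans hDg)
  have e3 : -(t * dg) * (b * (2 * w ^ 2 + p * t ^ 2)) ≤ |t| * L * (b * (2 * (w ^ 2 + t ^ 2))) := by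
    refine mul_le_mul e2 ?_ (by positivity) hL
    gcongr
    nlinarith [sq_nonneg t]
  norm_num
  nlinarith

/-- The vector field `y (|y|² + η²)^{-p/2}` has divergence at least
`(k - p) (|y|² + η²)^{-p/2}`. -/
theorem integral_hardy_weight_le {k : ℕ} (hkn : k ≤ n) (hp : 0 ≤ p) {η : ℝ} (hη : 0 < η)
    {f : E n → ℝ} (hf : ContDiff ℝ ∞ f) (hfc : HasCompactSupport f) (hf0 : ∀ x, 0 ≤ f x) :
    (k - p) * ∫ x, (normY k x ^ 2 + η ^ 2) ^ (-(p / 2)) * f x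
      ≤ ∫ x, (normY k x ^ 2 + η ^ 2) ^ (-(p / 2)) * -(fderiv ℝ f x (partY k x)) := by
  set θ : E n → ℝ := fun x => (normY k x ^ 2 + η ^ 2) ^ (-(p / 2)) with hθ
  have hpos : ∀ x : E n, 0 < normY k x ^ 2 + η ^ 2 := fun x => by positivity
  have hθs : ContDiff ℝ ∞ θ :=
    ((contDiff_normY_sq k).add contDiff_const).rpow_const_of_ne fun x => (hpos x).ne'
  have hcoord : ∀ i : Fin n, ContDiff ℝ ∞ (fun x : E n => x i) := fun i => by fun_prop
  have hfd : ∀ v : E n, Continuous (fun x => fderiv ℝ f x v) := fun v =>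
    (hf.continuous_fderiv (by simp)).clm_apply continuous_const
  have hfdc : ∀ v : E n, HasCompactSupport (fun x => fderiv ℝ f x v) := fun v => by
    exact hfc.fderiv_apply (𝕜 := ℝ) v
  have hA : ∀ i : Fin n, ContDiff ℝ ∞ (fun x : E n => x i * θ x) := fun i => (hcoord i).mul hθs
  have hAd : ∀ (i : Fin n) (v : E n), Continuous (fun x => fderiv ℝ (fun x : E n => x i * θ x) x v) :=
    fun i v => ((hA i).continuous_fderiv (by simp)).clm_apply continuous_const
  have int1 : ∀ (i : Fin n) (v : E n),
      Integrable (fun x => fderiv ℝ (fun x : E n => x i * θ x) x v * f x) := fun i v =>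
    ((hAd i v).mul hf.continuous).integrable_of_hasCompactSupport hfc.mul_left
  have int2 : ∀ (i : Fin n) (v : E n), Integrable (fun x => (x i * θ x) * fderiv ℝ f x v) :=
    fun i v => ((hA i).continuous.mul (hfd v)).integrable_of_hasCompactSupport (hfdc v).mul_left
  have parts : ∀ i : Fin n,
      ∫ x, (x i * θ x) * fderiv ℝ f x (EuclideanSpace.single i 1)
        = -∫ x, fderiv ℝ (fun x : E n => x i * θ x) x (EuclideanSpace.single i 1) * f x := by
    intro i
    refine integral_mul_fderiv_eq_neg_fderiv_mul_of_integrable (int1 i _) (int2 i _) ?_ ?_ ?_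
    · exact ((hA i).continuous.mul hf.continuous).integrable_of_hasCompactSupport hfc.mul_left
    · exact fun x _ => ((hA i).differentiable (by simp)) x
    · exact fun x _ => (hf.differentiable (by simp)) x
  set I := Finset.univ.filter (fun i : Fin n => (i : ℕ) < k) with hI
  have hcard : I.card = k := by
    rw [hI, Fin.card_filter_val_lt]; omega
  have hdiv : ∀ x : E n, (k - p) * θ x
      ≤ ∑ i ∈ I, fderiv ℝ (fun x : E n => x i * θ x) x (EuclideanSpace.single i 1) := by
    intro x
    have hd : ∀ i ∈ I, fderiv ℝ (fun x : E n => x i * θ x) x (EuclideanSpace.single i 1)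
        = θ x - p * (normY k x ^ 2 + η ^ 2) ^ (-(p / 2) - 1) * x i ^ 2 := by
      intro i hi
      have h1 : HasFDerivAt θ _ x :=
        ((hasFDerivAt_normY_sq k x).add_const (η ^ 2)).rpow_const (p := -(p / 2))
          (Or.inl (hpos x).ne')
      have h2 : HasFDerivAt (fun x : E n => x i) (EuclideanSpace.proj i : E n →L[ℝ] ℝ) x :=
        (EuclideanSpace.proj i : E n →L[ℝ] ℝ).hasFDerivAt
      have hi' : (i : ℕ) < k := by simpa [hI] using hi
      rw [(h2.fun_mul h1).fderiv]
      simp [EuclideanSpace.inner_single_right, partY_apply, hi']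
      ring
    rw [Finset.sum_congr rfl hd, Finset.sum_sub_distrib, Finset.sum_const, hcard, ← Finset.mul_sum,
      ← normY_sq, nsmul_eq_mul, sub_mul]
    have h3 : θ x = (normY k x ^ 2 + η ^ 2) ^ (-(p / 2) - 1) * (normY k x ^ 2 + η ^ 2) := by
      rw [hθ, ← Real.rpow_add_one (hpos x).ne']; simp only; congr 1; ring
    have h4 : (normY k x ^ 2 + η ^ 2) ^ (-(p / 2) - 1) * normY k x ^ 2 ≤ θ x := by
      rw [h3]
      have := hpos x
      gcongr
      nlinarith
    nlinarith
  calc (k - p) * ∫ x, θ x * f x = ∫ x, (k - p) * θ x * f x := by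
        rw [← integral_const_mul]; simp only [mul_assoc]
    _ ≤ ∫ x, ∑ i ∈ I, fderiv ℝ (fun x : E n => x i * θ x) x (EuclideanSpace.single i 1) * f x := by
        refine integral_mono ?_ (integrable_finsetSum _ fun i _ => int1 i _) fun x => ?_
        · exact ((continuous_const.mul hθs.continuous).mul
            hf.continuous).integrable_of_hasCompactSupport hfc.mul_left
        · simp only
          rw [← Finset.sum_mul]
          exact mul_le_mul_of_nonneg_right (hdiv x) (hf0 x)
    _ = ∑ i ∈ I, -∫ x, (x i * θ x) * fderiv ℝ f x (EuclideanSpace.single i 1) := by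
        rw [integral_finsetSum _ fun i _ => int1 i _]
        refine Finset.sum_congr rfl fun i _ => ?_
        rw [parts i, neg_neg]
    _ = ∫ x, θ x * -(fderiv ℝ f x (partY k x)) := by
        rw [Finset.sum_neg_distrib, ← integral_finsetSum _ fun i _ => int2 i _, ← integral_neg]
        congr 1
        ext x
        rw [partY, map_sum, mul_neg, Finset.mul_sum]
        congr 1
        refine Finset.sum_congr rfl fun i _ => ?_
        rw [map_smul, smul_eq_mul]; ring

/-- The Orlicz–Hardy inequality with the singular weight `|y|⁻ᵖ` smoothed at scale `η`. -/
theorem integral_orlicz_hardy {k : ℕ} (hk : 3 ≤ k) (hkn : k ≤ n) (hp : 1 < p) (hp2 : p < 2)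
    (hγ : 0 ≤ γ) {η : ℝ} (hη : 0 < η) (hη1 : η ≤ 1) (hg : ContDiff ℝ ∞ g)
    (hgc : HasCompactSupport g) :
    ∫ x, (normY k x ^ 2 + η ^ 2) ^ (-(p / 2)) * orlicz p (bracket γ x) (g x)
      ≤ 16 * ∫ x, orlicz p (bracket (γ + 1) x) ‖fderiv ℝ g x‖ := by
  set f : E n → ℝ := fun x => orlicz p (bracket γ x) (g x) with hf
  have hfs : ContDiff ℝ ∞ f := contDiff_orlicz (contDiff_bracket γ) (bracket_pos γ) hg
  have hfc : HasCompactSupport f := hasCompactSupport_orlicz hgc _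
  have hpos : ∀ x : E n, 0 < normY k x ^ 2 + η ^ 2 := fun x => by positivity
  have hθc : Continuous fun x : E n => (normY k x ^ 2 + η ^ 2) ^ (-(p / 2)) :=
    (((contDiff_normY_sq k).add contDiff_const).rpow_const_of_ne fun x => (hpos x).ne').continuous
  have hint1 : Integrable fun x => (normY k x ^ 2 + η ^ 2) ^ (-(p / 2)) * f x :=
    (hθc.mul hfs.continuous).integrable_of_hasCompactSupport hfc.mul_left
  have hdc : Continuous fun x => ‖fderiv ℝ g x‖ := (hg.continuous_fderiv (by simp)).norm
  have hint2 : Integrable fun x => orlicz p (bracket (γ + 1) x) ‖fderiv ℝ g x‖ :=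
    (continuous_orlicz (continuous_bracket _) (bracket_pos _) hdc).integrable_of_hasCompactSupport
      (hasCompactSupport_orlicz (hgc.fderiv (𝕜 := ℝ)).norm _)
  have hmain : ∫ x, (normY k x ^ 2 + η ^ 2) ^ (-(p / 2)) * -(fderiv ℝ f x (partY k x))
      ≤ ∫ x, 2 * ((1 / 4 : ℝ) * ((normY k x ^ 2 + η ^ 2) ^ (-(p / 2)) * f x)
        + 4 * orlicz p (bracket (γ + 1) x) ‖fderiv ℝ g x‖) := by
    refine integral_mono ?_ (((hint1.const_mul _).add (hint2.const_mul _)).const_mul _) fun x => ?_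
    · refine (hθc.mul (Continuous.neg ?_)).integrable_of_hasCompactSupport ?_
      · refine (hfs.continuous_fderiv (by simp)).clm_apply ?_
        unfold partY; fun_prop
      · refine (hfc.fderiv (𝕜 := ℝ)).mono fun x hx h => hx ?_
        simp [h]
    · simp only
      have h0 := neg_fderiv_orlicz_partY_le hp hp2 hγ hg k x
      set Y : ℝ := √(normY k x ^ 2 + η ^ 2) with hY
      have hY0 : 0 < Y := Real.sqrt_pos.2 (hpos x)
      have hθY : (normY k x ^ 2 + η ^ 2) ^ (-(p / 2)) = Y ^ (-p) := by
        rw [hY, Real.sqrt_eq_rpow, ← Real.rpow_mul (hpos x).le]; congr 1; ring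
      have hyY : normY k x ≤ Y := Real.le_sqrt_of_sq_le (by nlinarith)
      have hYx : Y ≤ √(1 + ‖x‖ ^ 2) := by
        refine Real.sqrt_le_sqrt ?_
        nlinarith [normY_sq_add_normZ_sq k x, sq_nonneg (normZ k x)]
      rw [hθY]
      have hw := bracket_pos γ x
      have hm := bracket_pos (γ + 1) x
      have hyoung := orlicz_young hp hp2 (s := bracket γ x / Y) (t := |g x| / Y)
        (h := ‖fderiv ℝ g x‖) (δ := 1 / 4) (by positivity) (by positivity) (norm_nonneg _)
        (by norm_num) (by norm_num)
      have e1 : orlicz p (bracket γ x / Y) (|g x| / Y) = Y ^ (-p) * f x := by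
        rw [div_eq_inv_mul, div_eq_inv_mul, orlicz_smul _ _ (by positivity), orlicz_abs,
          Real.inv_rpow hY0.le, Real.rpow_neg hY0.le]
      have e2 : orlicz p (bracket γ x / Y) ‖fderiv ℝ g x‖
          ≤ orlicz p (bracket (γ + 1) x) ‖fderiv ℝ g x‖ := by
        refine orlicz_anti hp2 hm ?_ _
        rw [bracket_add_one]
        gcongr
      have e3 : Y ^ (-p) * (bracket γ x ^ 2 + g x ^ 2) ^ ((p - 2) / 2) * |g x| * Y
          = ((bracket γ x / Y) ^ 2 + (|g x| / Y) ^ 2) ^ ((p - 2) / 2) * (|g x| / Y) := by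
        rw [div_pow, div_pow, ← add_div, sq_abs, Real.div_rpow (by positivity) (by positivity),
          ← Real.rpow_natCast Y 2, ← Real.rpow_mul hY0.le]
        have : Y ^ (-p) = (Y ^ (((2 : ℕ) : ℝ) * ((p - 2) / 2)))⁻¹ * Y ^ (-2 : ℝ) := by
          rw [← Real.rpow_neg hY0.le, ← Real.rpow_add hY0]; congr 1; push_cast; ring
        rw [this, Real.rpow_neg hY0.le, Real.rpow_two]
        field_simp
      rw [e1] at hyoung
      calc Y ^ (-p) * -(fderiv ℝ f x (partY k x))
          ≤ Y ^ (-p) * (2 * ((bracket γ x ^ 2 + g x ^ 2) ^ ((p - 2) / 2) * |g x|) *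
            (Y * ‖fderiv ℝ g x‖)) := by
            refine mul_le_mul_of_nonneg_left (h0.trans ?_) (by positivity)
            gcongr
        _ = 2 * (Y ^ (-p) * (bracket γ x ^ 2 + g x ^ 2) ^ ((p - 2) / 2) * |g x| * Y *
              ‖fderiv ℝ g x‖) := by ring
        _ = 2 * (((bracket γ x / Y) ^ 2 + (|g x| / Y) ^ 2) ^ ((p - 2) / 2) * (|g x| / Y) *
              ‖fderiv ℝ g x‖) := by rw [e3]
        _ ≤ _ := by
          refine mul_le_mul_of_nonneg_left (hyoung.trans ?_) (by norm_num)
          norm_num at e2 ⊢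
          linarith
  have hdiv := integral_hardy_weight_le hkn (by linarith : 0 ≤ p) hη hfs hfc
    (fun x => orlicz_nonneg _ _ _)
  rw [integral_const_mul, integral_add (hint1.const_mul _) (hint2.const_mul _), integral_const_mul,
    integral_const_mul] at hmain
  have h1 : 0 ≤ ∫ x, (normY k x ^ 2 + η ^ 2) ^ (-(p / 2)) * f x :=
    integral_nonneg fun x => mul_nonneg (Real.rpow_nonneg (hpos x).le _) (orlicz_nonneg _ _ _)
  have hk' : (3 : ℝ) ≤ k := by exact_mod_cast hk
  have h2 : 1 * ∫ x, (normY k x ^ 2 + η ^ 2) ^ (-(p / 2)) * f x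
      ≤ (k - p) * ∫ x, (normY k x ^ 2 + η ^ 2) ^ (-(p / 2)) * f x :=
    mul_le_mul_of_nonneg_right (by linarith) h1
  linarith

end


section

variable {n : ℕ} {p γ : ℝ} {g : E n → ℝ}

theorem lintegral_orlicz_hardy {k : ℕ} (hk : 3 ≤ k) (hkn : k ≤ n) (hp : 1 < p) (hp2 : p < 2)
    (hγ : 0 ≤ γ) {η : ℝ} (hη : 0 < η) (hη1 : η ≤ 1) (hg : ContDiff ℝ ∞ g)
    (hgc : HasCompactSupport g) :
    ∫⁻ x, ENNReal.ofReal
        ((normY k x ^ 2 + η ^ 2) ^ (-(p / 2)) * orlicz p (bracket γ x) (g x))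
      ≤ 16 * ∫⁻ x, ENNReal.ofReal (orlicz p (bracket (γ + 1) x) ‖fderiv ℝ g x‖) := by
  have hpos : ∀ x : E n, 0 < normY k x ^ 2 + η ^ 2 := fun x => by positivity
  have hθc : Continuous fun x : E n => (normY k x ^ 2 + η ^ 2) ^ (-(p / 2)) :=
    (((contDiff_normY_sq k).add contDiff_const).rpow_const_of_ne fun x => (hpos x).ne').continuous
  have hJ : Continuous fun x => orlicz p (bracket γ x) (g x) :=
    continuous_orlicz (continuous_bracket _) (bracket_pos _) hg.continuous
  have hint1 : Integrable fun x =>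
      (normY k x ^ 2 + η ^ 2) ^ (-(p / 2)) * orlicz p (bracket γ x) (g x) :=
    (hθc.mul hJ).integrable_of_hasCompactSupport (hasCompactSupport_orlicz hgc _).mul_left
  have hint2 : Integrable fun x => orlicz p (bracket (γ + 1) x) ‖fderiv ℝ g x‖ :=
    (continuous_orlicz (continuous_bracket _) (bracket_pos _)
      (hg.continuous_fderiv (by simp)).norm).integrable_of_hasCompactSupport
      (hasCompactSupport_orlicz (hgc.fderiv (𝕜 := ℝ)).norm _)
  rw [← ofReal_integral_eq_lintegral_ofReal hint1 (ae_of_all _ fun x =>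
      mul_nonneg (Real.rpow_nonneg (hpos x).le _) (orlicz_nonneg _ _ _)),
    ← ofReal_integral_eq_lintegral_ofReal hint2 (ae_of_all _ fun x => orlicz_nonneg _ _ _),
    show (16 : ℝ≥0∞) = ENNReal.ofReal 16 by norm_num, ← ENNReal.ofReal_mul (by norm_num)]
  exact ENNReal.ofReal_le_ofReal (integral_orlicz_hardy hk hkn hp hp2 hγ hη hη1 hg hgc)

theorem eLpNorm_ofReal_eq {α F : Type*} [MeasurableSpace α] [NormedAddCommGroup F]
    {μ : Measure α} {q : ℝ} (hq : 0 < q) (f : α → F) :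
    eLpNorm f (ENNReal.ofReal q) μ = (∫⁻ x, ‖f x‖ₑ ^ q ∂μ) ^ (1 / q) := by
  rw [eLpNorm_eq_lintegral_rpow_enorm_toReal (by simpa using hq) ENNReal.ofReal_ne_top,
    ENNReal.toReal_ofReal hq.le]

/-! ### An Orlicz–Sobolev inequality for test functions -/

/-- The `p`-th root of `J(bracket γ, g)`, a `C¹` function since `2 / p > 1`. -/
noncomputable def orliczRoot (p γ : ℝ) (g : E n → ℝ) (x : E n) : ℝ :=
  (bracket γ x ^ 2 + g x ^ 2) ^ ((p - 2) / (2 * p)) * ‖g x‖ ^ (2 / p)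

theorem orliczRoot_nonneg (x : E n) : 0 ≤ orliczRoot p γ g x := by
  unfold orliczRoot; positivity

theorem orliczRoot_rpow (hp : 1 < p) (x : E n) :
    orliczRoot p γ g x ^ p = orlicz p (bracket γ x) (g x) := by
  have hp0 : p ≠ 0 := by linarith
  have := bracket_pos γ x
  unfold orliczRoot orlicz
  rw [Real.mul_rpow (by positivity) (by positivity), ← Real.rpow_mul (by positivity),
    ← Real.rpow_mul (by positivity), div_mul_cancel₀ _ hp0, Real.rpow_two, Real.norm_eq_abs, sq_abs]
  congr 2
  field_simp

theorem contDiff_orliczRoot (hp : 1 < p) (hp2 : p < 2) (hg : ContDiff ℝ ∞ g) :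
    ContDiff ℝ 1 (orliczRoot p γ g) := by
  unfold orliczRoot
  have hw : ContDiff ℝ 1 (bracket γ : E n → ℝ) := (contDiff_bracket γ).of_le (by simp)
  have hg1 : ContDiff ℝ 1 g := hg.of_le (by simp)
  refine ContDiff.mul ?_ (hg1.norm_rpow ?_)
  · refine ((hw.pow 2).add (hg1.pow 2)).rpow_const_of_ne fun x => ?_
    have := bracket_pos γ x
    positivity
  · rw [lt_div_iff₀ (by linarith)]; linarith

theorem hasCompactSupport_orliczRoot (hp : 1 < p) (hgc : HasCompactSupport g) :
    HasCompactSupport (orliczRoot p γ g) :=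
  hgc.mono fun x hx h => hx (by
    have : 2 / p ≠ 0 := by positivity
    simp [orliczRoot, h, Real.zero_rpow this])

theorem norm_fderiv_orliczRoot_le (hp : 1 < p) (hp2 : p < 2) (hγ : 0 ≤ γ)
    (hg : ContDiff ℝ ∞ g) (x : E n) :
    ‖fderiv ℝ (orliczRoot p γ g) x‖
      ≤ γ * (orliczRoot p γ g x / √(1 + ‖x‖ ^ 2))
        + 3 * (orliczRoot p γ g x * (‖fderiv ℝ g x‖ / |g x|)) := by
  set a : ℝ := (p - 2) / (2 * p) with ha
  have h2p : 1 < 2 / p := by rw [lt_div_iff₀ (by linarith)]; linarith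
  have h2p' : 2 / p ≤ 2 := by rw [div_le_iff₀ (by linarith)]; linarith
  have ha0 : |a| ≤ 1 / 2 := by
    rw [abs_le, ha]
    constructor
    · rw [le_div_iff₀ (by linarith)]; linarith
    · rw [div_le_iff₀ (by linarith)]; linarith
  have hw0 := bracket_pos γ x
  have hB : (0 : ℝ) < bracket γ x ^ 2 + g x ^ 2 := by positivity
  have hw : HasFDerivAt (bracket γ) (fderiv ℝ (bracket γ : E n → ℝ) x) x :=
    (hasFDerivAt_bracket γ x).differentiableAt.hasFDerivAt
  have hgd : Differentiable ℝ g := hg.differentiable (by simp)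
  have hg' : HasFDerivAt g (fderiv ℝ g x) x := (hgd x).hasFDerivAt
  have hA := ((hw.pow 2).add (hg'.pow 2)).rpow_const (p := a) (Or.inl hB.ne')
  have hC : HasFDerivAt (fun x => ‖g x‖ ^ (2 / p)) (fderiv ℝ (fun x => ‖g x‖ ^ (2 / p)) x) x :=
    ((hgd.norm_rpow h2p) x).hasFDerivAt
  have hM : fderiv ℝ (orliczRoot p γ g) x = _ := (hA.mul hC).fderiv
  rw [hM]
  have hCn := norm_fderiv_norm_rpow_le hgd (x := x) h2p
  have hDw := norm_fderiv_bracket_le hγ x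
  rw [bracket_add_one] at hDw
  set X := √(1 + ‖x‖ ^ 2) with hX
  have hX0 : 0 < X := Real.sqrt_pos.2 (by positivity)
  simp only [Pi.add_apply, Real.norm_eq_abs] at hCn ⊢
  generalize fderiv ℝ (fun x => |g x| ^ (2 / p)) x = DC at *
  by_cases h0 : g x = 0
  · have h2 : 2 / p - 1 ≠ 0 := by linarith
    have h3 : 2 / p ≠ 0 := by linarith
    have : DC = 0 := by
      rw [h0, abs_zero, Real.zero_rpow h2] at hCn
      simpa using hCn
    simp [this, h0, Real.zero_rpow h3, orliczRoot]
  have ht : 0 < |g x| := abs_pos.2 h0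
  have e1 : |g x| ^ (2 / p) = |g x| ^ (2 / p - 1) * |g x| := by
    rw [← Real.rpow_add_one ht.ne']; congr 1; ring
  have e2 : (bracket γ x ^ 2 + g x ^ 2) ^ a
      = (bracket γ x ^ 2 + g x ^ 2) ^ (a - 1) * (bracket γ x ^ 2 + g x ^ 2) := by
    rw [← Real.rpow_add_one hB.ne']; congr 1; ring
  have hMdef : orliczRoot p γ g x = (bracket γ x ^ 2 + g x ^ 2) ^ a * |g x| ^ (2 / p) := rfl
  have n1 : ‖(bracket γ x ^ 2 + g x ^ 2) ^ a • DC‖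
      ≤ 2 * (orliczRoot p γ g x * (‖fderiv ℝ g x‖ / |g x|)) := by
    rw [norm_smul, Real.norm_eq_abs, abs_of_pos (by positivity)]
    calc _ ≤ (bracket γ x ^ 2 + g x ^ 2) ^ a * (2 * |g x| ^ (2 / p - 1) * ‖fderiv ℝ g x‖) := by
          refine mul_le_mul_of_nonneg_left (hCn.trans ?_) (by positivity)
          gcongr
      _ = _ := by rw [hMdef, e1]; field_simp
  have n2 : ‖|g x| ^ (2 / p) • (a * (bracket γ x ^ 2 + g x ^ 2) ^ (a - 1)) •
        ((2 * bracket γ x) • fderiv ℝ (bracket γ) x + (2 * g x) • fderiv ℝ g x)‖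
      ≤ γ * (orliczRoot p γ g x / X)
        + (orliczRoot p γ g x * (‖fderiv ℝ g x‖ / |g x|)) := by
    have hL : ‖(2 * bracket γ x) • fderiv ℝ (bracket γ) x + (2 * g x) • fderiv ℝ g x‖
        ≤ 2 * (bracket γ x ^ 2 + g x ^ 2) * (γ / X + ‖fderiv ℝ g x‖ / |g x|) := by
      refine (norm_add_le _ _).trans ?_
      have c1 : ‖2 * bracket γ x‖ = 2 * bracket γ x := by simp [abs_of_pos hw0]
      have c2 : ‖2 * g x‖ = 2 * |g x| := by simp
      rw [norm_smul, norm_smul, c1, c2]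
      calc _ ≤ 2 * bracket γ x * (γ * (bracket γ x / X)) + 2 * |g x| * ‖fderiv ℝ g x‖ := by
            gcongr
        _ = 2 * bracket γ x ^ 2 * (γ / X) + 2 * |g x| ^ 2 * (‖fderiv ℝ g x‖ / |g x|) := by
            field_simp
        _ ≤ _ := by
          rw [sq_abs]
          have d1 : 0 ≤ g x ^ 2 * (γ / X) := by positivity
          have d2 : 0 ≤ bracket γ x ^ 2 * (‖fderiv ℝ g x‖ / |g x|) := by positivity
          nlinarith
    rw [norm_smul, norm_smul, norm_mul, Real.norm_eq_abs, Real.norm_eq_abs, Real.norm_eq_abs,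
      abs_of_pos (by positivity : 0 < |g x| ^ (2 / p)),
      abs_of_pos (by positivity : 0 < (bracket γ x ^ 2 + g x ^ 2) ^ (a - 1))]
    calc _ ≤ |g x| ^ (2 / p) * (1 / 2 * (bracket γ x ^ 2 + g x ^ 2) ^ (a - 1) *
          (2 * (bracket γ x ^ 2 + g x ^ 2) * (γ / X + ‖fderiv ℝ g x‖ / |g x|))) := by
          gcongr
      _ = _ := by rw [hMdef, e2]; ring
  refine (norm_add_le _ _).trans ?_
  simp only [nsmul_eq_mul, Nat.cast_ofNat, Nat.add_one_sub_one, pow_one] at n2 ⊢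
  linarith

theorem add_rpow_le_four_mul (hp : 1 < p) (hp2 : p < 2) {a b : ℝ} (ha : 0 ≤ a) (hb : 0 ≤ b) :
    (a + b) ^ p ≤ 4 * (a ^ p + b ^ p) := by
  have h : ∀ c : ℝ, 0 ≤ c → (2 * c) ^ p ≤ 4 * c ^ p := by
    intro c hc
    rw [Real.mul_rpow (by norm_num) hc]
    have : (2 : ℝ) ^ p ≤ 2 ^ (2 : ℝ) := Real.rpow_le_rpow_of_exponent_le (by norm_num) hp2.le
    norm_num at this
    gcongr
  rcases le_total a b with hab | hab
  · have : (a + b) ^ p ≤ (2 * b) ^ p := by gcongr; linarith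
    linarith [h b hb, Real.rpow_nonneg ha p]
  · have : (a + b) ^ p ≤ (2 * a) ^ p := by gcongr; linarith
    linarith [h a ha, Real.rpow_nonneg hb p]

theorem norm_fderiv_orliczRoot_rpow_le (hp : 1 < p) (hp2 : p < 2) (hγ : 0 ≤ γ)
    (hg : ContDiff ℝ ∞ g) (k : ℕ) (x : E n) :
    ‖fderiv ℝ (orliczRoot p γ g) x‖ ^ p
      ≤ 4 * (γ ^ p + 9) * ((normY k x ^ 2 + 1 ^ 2) ^ (-(p / 2)) * orlicz p (bracket γ x) (g x)
        + orlicz p (bracket (γ + 1) x) ‖fderiv ℝ g x‖) := by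
  have hM0 := orliczRoot_nonneg (p := p) (γ := γ) (g := g) x
  have hX0 : 0 < √(1 + ‖x‖ ^ 2) := Real.sqrt_pos.2 (by positivity)
  set J := orlicz p (bracket γ x) (g x) with hJ
  set J' := orlicz p (bracket (γ + 1) x) ‖fderiv ℝ g x‖ with hJ'
  have hJ0 : 0 ≤ J := orlicz_nonneg _ _ _
  have hJ0' : 0 ≤ J' := orlicz_nonneg _ _ _
  have hX : (√(1 + ‖x‖ ^ 2)) ^ (-p) * J ≤ (normY k x ^ 2 + 1 ^ 2) ^ (-(p / 2)) * J := by
    refine mul_le_mul_of_nonneg_right ?_ hJ0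
    rw [Real.sqrt_eq_rpow, ← Real.rpow_mul (by positivity)]
    rw [show 1 / 2 * -p = -(p / 2) by ring]
    refine Real.rpow_le_rpow_of_nonpos (by positivity) ?_ (by linarith)
    nlinarith [normY_sq_add_normZ_sq k x, sq_nonneg (normZ k x)]
  have t1 : (orliczRoot p γ g x / √(1 + ‖x‖ ^ 2)) ^ p = (√(1 + ‖x‖ ^ 2)) ^ (-p) * J := by
    rw [Real.div_rpow hM0 hX0.le, orliczRoot_rpow hp, Real.rpow_neg hX0.le]
    field_simp
    exact hJ.symm
  have t2 : (orliczRoot p γ g x * (‖fderiv ℝ g x‖ / |g x|)) ^ p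
      ≤ (√(1 + ‖x‖ ^ 2)) ^ (-p) * J + J' := by
    by_cases h0 : g x = 0
    · rw [h0, abs_zero, div_zero, mul_zero, Real.zero_rpow (by linarith)]
      positivity
    have ht : 0 < |g x| := abs_pos.2 h0
    rw [Real.mul_rpow hM0 (by positivity), orliczRoot_rpow hp]
    set X := √(1 + ‖x‖ ^ 2)
    have h1 := orlicz_mul_div_rpow_le hp hp2 (s := bracket (γ + 1) x) (t := |g x| / X)
      (h := ‖fderiv ℝ g x‖) (bracket_pos _ _) (by positivity) (norm_nonneg _)
    have h2 : orlicz p (bracket (γ + 1) x) (|g x| / X) = X ^ (-p) * J := by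
      rw [bracket_add_one, div_eq_inv_mul, div_eq_inv_mul, orlicz_smul _ _ (by positivity),
        orlicz_abs, Real.inv_rpow hX0.le, Real.rpow_neg hX0.le]
    rw [h2] at h1
    refine le_trans (le_of_eq ?_) h1
    rw [Real.div_rpow (norm_nonneg _) ht.le, Real.div_rpow (norm_nonneg _) (by positivity),
      Real.div_rpow ht.le hX0.le, Real.rpow_neg hX0.le, hJ]
    field_simp
  have h3 : (3 : ℝ) ^ p ≤ 9 := by
    have : (3 : ℝ) ^ p ≤ 3 ^ (2 : ℝ) := Real.rpow_le_rpow_of_exponent_le (by norm_num) hp2.le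
    norm_num at this
    exact this
  have hγp : 0 ≤ γ ^ p := Real.rpow_nonneg hγ p
  calc ‖fderiv ℝ (orliczRoot p γ g) x‖ ^ p
      ≤ (γ * (orliczRoot p γ g x / √(1 + ‖x‖ ^ 2))
        + 3 * (orliczRoot p γ g x * (‖fderiv ℝ g x‖ / |g x|))) ^ p := by
        gcongr; exact norm_fderiv_orliczRoot_le hp hp2 hγ hg x
    _ ≤ 4 * ((γ * (orliczRoot p γ g x / √(1 + ‖x‖ ^ 2))) ^ p
        + (3 * (orliczRoot p γ g x * (‖fderiv ℝ g x‖ / |g x|))) ^ p) :=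
        add_rpow_le_four_mul hp hp2 (by positivity) (by positivity)
    _ = 4 * (γ ^ p * ((√(1 + ‖x‖ ^ 2)) ^ (-p) * J)
        + 3 ^ p * (orliczRoot p γ g x * (‖fderiv ℝ g x‖ / |g x|)) ^ p) := by
        rw [Real.mul_rpow hγ (by positivity), t1, Real.mul_rpow (by norm_num) (by positivity)]
    _ ≤ 4 * (γ ^ p * ((normY k x ^ 2 + 1 ^ 2) ^ (-(p / 2)) * J)
        + 9 * ((normY k x ^ 2 + 1 ^ 2) ^ (-(p / 2)) * J + J')) := by
        gcongr
        linarith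
    _ ≤ _ := by nlinarith [mul_nonneg hγp hJ0']

/-- The Orlicz–Sobolev inequality: the Sobolev inequality for `J(bracket γ, g)^{1/p}`, whose
gradient is controlled by the Orlicz–Hardy inequality. -/
theorem exists_lintegral_orlicz_sobolev {k : ℕ} (hk : 3 ≤ k) (hkn : k ≤ n) (hp : 1 < p)
    (hp2 : p < 2) (hγ : 0 ≤ γ) :
    ∃ C : ℝ, 0 ≤ C ∧ ∀ g : E n → ℝ, ContDiff ℝ ∞ g → HasCompactSupport g →
      ∫⁻ x, ENNReal.ofReal (orlicz p (bracket γ x) (g x) ^ ((n : ℝ) / (n - p)))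
        ≤ (ENNReal.ofReal C * ∫⁻ x, ENNReal.ofReal
            (orlicz p (bracket (γ + 1) x) ‖fderiv ℝ g x‖)) ^ ((n : ℝ) / (n - p)) := by
  have hn : (3 : ℝ) ≤ n := by exact_mod_cast hk.trans hkn
  have hp0 : 0 < p := by linarith
  set r : ℝ := (n : ℝ) / (n - p) with hr
  have hr0 : 0 < r := div_pos (by linarith) (by linarith)
  set S : NNReal := SNormLESNormFDerivOfEqConst ℝ (volume : Measure (E n)) p with hS
  refine ⟨(S : ℝ) ^ p * (4 * (γ ^ p + 9) * 17), by positivity, fun g hg hgc => ?_⟩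
  have hsob := eLpNorm_le_eLpNorm_fderiv_of_eq (F := ℝ) (volume : Measure (E n))
    (contDiff_orliczRoot (p := p) (γ := γ) hp hp2 hg)
    (hasCompactSupport_orliczRoot (p := p) (γ := γ) hp hgc)
    (p := p.toNNReal) (p' := (p * r).toNNReal) (by simpa using hp.le)
    (by simp; omega) (by
      rw [NNReal.coe_inv, Real.coe_toNNReal _ hp0.le, Real.coe_toNNReal _ (by positivity), hr,
        finrank_euclideanSpace, Fintype.card_fin]
      have : (n : ℝ) - p ≠ 0 := by linarith
      field_simp)
  rw [Real.coe_toNNReal _ hp0.le] at hsob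
  change eLpNorm _ (ENNReal.ofReal (p * r)) _ ≤ _ * eLpNorm _ (ENNReal.ofReal p) _ at hsob
  rw [eLpNorm_ofReal_eq (by positivity), eLpNorm_ofReal_eq hp0] at hsob
  have e1 : ∀ x, ‖orliczRoot p γ g x‖ₑ ^ (p * r)
      = ENNReal.ofReal (orlicz p (bracket γ x) (g x) ^ r) := by
    intro x
    rw [Real.enorm_eq_ofReal (orliczRoot_nonneg x), ENNReal.ofReal_rpow_of_nonneg
      (orliczRoot_nonneg x) (by positivity), Real.rpow_mul (orliczRoot_nonneg x),
      orliczRoot_rpow hp]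
  have e2 : ∫⁻ x, ‖fderiv ℝ (orliczRoot p γ g) x‖ₑ ^ p
      ≤ ENNReal.ofReal (4 * (γ ^ p + 9) * 17) *
        ∫⁻ x, ENNReal.ofReal (orlicz p (bracket (γ + 1) x) ‖fderiv ℝ g x‖) := by
    have hm : Measurable fun x => ENNReal.ofReal
        ((normY k x ^ 2 + 1 ^ 2) ^ (-(p / 2)) * orlicz p (bracket γ x) (g x)) := by
      have h1 := (continuous_normY (n := n) k).measurable
      have h2 := (continuous_orlicz (p := p) (continuous_bracket γ) (bracket_pos γ)
        hg.continuous).measurable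
      fun_prop
    calc _ ≤ ∫⁻ x, ENNReal.ofReal (4 * (γ ^ p + 9)) *
          (ENNReal.ofReal ((normY k x ^ 2 + 1 ^ 2) ^ (-(p / 2)) * orlicz p (bracket γ x) (g x))
          + ENNReal.ofReal (orlicz p (bracket (γ + 1) x) ‖fderiv ℝ g x‖)) := by
          refine lintegral_mono fun x => ?_
          rw [← ofReal_norm, ENNReal.ofReal_rpow_of_nonneg (norm_nonneg _) hp0.le,
            ← ENNReal.ofReal_add (mul_nonneg (by positivity) (orlicz_nonneg _ _ _))
              (orlicz_nonneg _ _ _), ← ENNReal.ofReal_mul (by positivity)]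
          exact ENNReal.ofReal_le_ofReal (norm_fderiv_orliczRoot_rpow_le hp hp2 hγ hg k x)
      _ = ENNReal.ofReal (4 * (γ ^ p + 9)) *
          ((∫⁻ x, ENNReal.ofReal
            ((normY k x ^ 2 + 1 ^ 2) ^ (-(p / 2)) * orlicz p (bracket γ x) (g x)))
          + ∫⁻ x, ENNReal.ofReal (orlicz p (bracket (γ + 1) x) ‖fderiv ℝ g x‖)) := by
          rw [lintegral_const_mul' _ _ ENNReal.ofReal_ne_top, lintegral_add_left hm]
      _ ≤ ENNReal.ofReal (4 * (γ ^ p + 9)) *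
          (16 * (∫⁻ x, ENNReal.ofReal (orlicz p (bracket (γ + 1) x) ‖fderiv ℝ g x‖))
          + ∫⁻ x, ENNReal.ofReal (orlicz p (bracket (γ + 1) x) ‖fderiv ℝ g x‖)) := by
          gcongr
          exact lintegral_orlicz_hardy hk hkn hp hp2 hγ one_pos le_rfl hg hgc
      _ = _ := by
          rw [ENNReal.ofReal_mul (q := 17) (by positivity),
            show ENNReal.ofReal 17 = 16 + 1 by norm_num]
          ring
  simp only [e1] at hsob
  have h3 : ∫⁻ x, ENNReal.ofReal (orlicz p (bracket γ x) (g x) ^ r)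
      = ((∫⁻ x, ENNReal.ofReal (orlicz p (bracket γ x) (g x) ^ r)) ^ (1 / (p * r))) ^ (p * r) := by
    rw [← ENNReal.rpow_mul, one_div_mul_cancel (by positivity), ENNReal.rpow_one]
  rw [h3]
  calc _ ≤ ((S : ℝ≥0∞) * (∫⁻ x, ‖fderiv ℝ (orliczRoot p γ g) x‖ₑ ^ p) ^ (1 / p)) ^ (p * r) := by
        gcongr
    _ = ((S : ℝ≥0∞) ^ p * (∫⁻ x, ‖fderiv ℝ (orliczRoot p γ g) x‖ₑ ^ p)) ^ r := by
        rw [ENNReal.rpow_mul, ENNReal.mul_rpow_of_nonneg _ _ hp0.le, ← ENNReal.rpow_mul,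
          one_div_mul_cancel hp0.ne', ENNReal.rpow_one]
    _ ≤ _ := by
        rw [ENNReal.ofReal_mul (by positivity), mul_assoc,
          ← ENNReal.ofReal_rpow_of_nonneg S.coe_nonneg hp0.le, ENNReal.ofReal_coe_nnreal]
        gcongr

end


/-! ### Passing from test functions to `D^{1,p}` -/

theorem lintegral_le_of_le_liminf {α : Type*} [MeasurableSpace α] {μ : Measure α}
    {Φ : ℕ → α → ℝ≥0∞} {Φ₀ : α → ℝ≥0∞} {b : ℕ → ℝ≥0∞} {B : ℝ≥0∞}
    (hm : ∀ j, AEMeasurable (Φ j) μ) (h : ∀ᵐ x ∂μ, Φ₀ x ≤ liminf (fun j => Φ j x) atTop)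
    (hb : ∀ j, ∫⁻ x, Φ j x ∂μ ≤ b j) (hB : Tendsto b atTop (𝓝 B)) :
    ∫⁻ x, Φ₀ x ∂μ ≤ B :=
  calc ∫⁻ x, Φ₀ x ∂μ ≤ ∫⁻ x, liminf (fun j => Φ j x) atTop ∂μ := lintegral_mono_ae h
    _ ≤ liminf (fun j => ∫⁻ x, Φ j x ∂μ) atTop := lintegral_liminf_le' hm
    _ ≤ liminf b atTop := liminf_le_liminf (Eventually.of_forall hb)
    _ = B := hB.liminf_eq

theorem norm_gradient {n : ℕ} (f : E n → ℝ) (x : E n) : ‖gradient f x‖ = ‖fderiv ℝ f x‖ := by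
  simp [gradient]

section

variable {n : ℕ} {p : ℝ} {hp : 1 < p} {hpn : p < n}

theorem D1p.measurable_fn (u : D1p n p hp hpn) : Measurable (D1p.fn u) :=
  (Lp.stronglyMeasurable u.1.1).measurable

theorem D1p.measurable_grad (u : D1p n p hp hpn) : Measurable (D1p.grad u) :=
  (Lp.stronglyMeasurable u.1.2).measurable

theorem sobExp_pos (hp : 1 < p) (hpn : p < n) : 0 < sobExp n p := by
  unfold sobExp
  exact div_pos (mul_pos (by linarith) (by linarith)) (by linarith)

theorem D1p.fn_smul (c : ℝ) (u : D1p n p hp hpn) :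
    D1p.fn (c • u) =ᵐ[volume] fun x => c * D1p.fn u x :=
  Lp.coeFn_smul c u.1.1

theorem D1p.grad_smul (c : ℝ) (u : D1p n p hp hpn) :
    D1p.grad (c • u) =ᵐ[volume] fun x => c • D1p.grad u x :=
  Lp.coeFn_smul c u.1.2

theorem D1p.fn_sub (u v : D1p n p hp hpn) :
    D1p.fn (u - v) =ᵐ[volume] fun x => D1p.fn u x - D1p.fn v x :=
  Lp.coeFn_sub u.1.1 v.1.1

/-- Every element of `D^{1,p}` is approximated by test functions, almost everywhere and in the
sense of gradients. -/
theorem D1p.exists_approx (u : D1p n p hp hpn) :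
    ∃ ψ : ℕ → E n → ℝ, (∀ j, ContDiff ℝ ∞ (ψ j)) ∧ (∀ j, HasCompactSupport (ψ j)) ∧
      (∀ᵐ x, Tendsto (fun j => ψ j x) atTop (𝓝 (D1p.fn u x))) ∧
      Tendsto (fun j => eLpNorm (ψ j - D1p.fn u) (ENNReal.ofReal (sobExp n p)) volume)
        atTop (𝓝 0) ∧
      Tendsto (fun j => ∫⁻ x, ‖gradient (ψ j) x - D1p.grad u x‖ₑ ^ p) atTop (𝓝 0) := by
  have := fact_one_le hp
  have := fact_one_le_sobExp hp hpn
  have hp0 : 0 < p := by linarith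
  obtain ⟨w, hw, hlim⟩ := mem_closure_iff_seq_limit.1 (show u.1 ∈ closure (testPairs n p : Set _) from
    u.2)
  choose ψ hs hc h1 h2 using hw
  have l1 : Tendsto (fun j => (w j).1) atTop (𝓝 u.1.1) := (continuous_fst.tendsto _).comp hlim
  have l2 : Tendsto (fun j => (w j).2) atTop (𝓝 u.1.2) := (continuous_snd.tendsto _).comp hlim
  have t1 := (Lp.tendsto_Lp_iff_tendsto_eLpNorm' _ _).1 l1
  have t2 := (Lp.tendsto_Lp_iff_tendsto_eLpNorm' _ _).1 l2
  have t1' : Tendsto (fun j => eLpNorm (ψ j - D1p.fn u) (ENNReal.ofReal (sobExp n p)) volume)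
      atTop (𝓝 0) := by
    refine t1.congr fun j => eLpNorm_congr_ae ?_
    exact (h1 j).sub (EventuallyEq.refl _ _)
  have t2' : Tendsto (fun j => ∫⁻ x, ‖gradient (ψ j) x - D1p.grad u x‖ₑ ^ p) atTop (𝓝 0) := by
    have h3 : ∀ j, ∫⁻ x, ‖gradient (ψ j) x - D1p.grad u x‖ₑ ^ p
        = (eLpNorm (⇑(w j).2 - ⇑u.1.2) (ENNReal.ofReal p) volume) ^ p := by
      intro j
      rw [eLpNorm_congr_ae ((h2 j).sub (EventuallyEq.refl _ _)), eLpNorm_ofReal_eq hp0,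
        ← ENNReal.rpow_mul, one_div_mul_cancel hp0.ne', ENNReal.rpow_one]
      rfl
    simp_rw [h3]
    have := (ENNReal.continuous_rpow_const (y := p)).tendsto 0 |>.comp t2
    rwa [ENNReal.zero_rpow_of_pos hp0] at this
  have hmeas : TendstoInMeasure volume ψ atTop (D1p.fn u) := by
    refine tendstoInMeasure_of_tendsto_eLpNorm (p := ENNReal.ofReal (sobExp n p)) ?_
      (fun j => (hs j).continuous.aestronglyMeasurable)
      (D1p.measurable_fn u).aestronglyMeasurable t1'
    simpa using sobExp_pos hp hpn
  obtain ⟨ns, hns, hae⟩ := hmeas.exists_seq_tendsto_ae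
  exact ⟨fun j => ψ (ns j), fun j => hs _, fun j => hc _, hae, t1'.comp hns.tendsto_atTop,
    t2'.comp hns.tendsto_atTop⟩

/-- The Sobolev inequality on `D^{1,p}`. -/
theorem D1p.exists_sobolev (hp : 1 < p) (hpn : p < n) :
    ∃ C : NNReal, ∀ u : D1p n p hp hpn, ‖u.1.1‖ ≤ C * D1p.gradNorm u := by
  have := fact_one_le hp
  have := fact_one_le_sobExp hp hpn
  have hp0 : 0 < p := by linarith
  refine ⟨SNormLESNormFDerivOfEqConst ℝ (volume : Measure (E n)) p, fun u => ?_⟩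
  set S := SNormLESNormFDerivOfEqConst ℝ (volume : Measure (E n)) p
  have hclosed : IsClosed {w : Pair n p | ‖w.1‖ ≤ S * ‖w.2‖} :=
    isClosed_le (by fun_prop) (by fun_prop)
  refine hclosed.closure_subset_iff.2 ?_ (show u.1 ∈ closure (testPairs n p : Set _) from u.2)
  rintro w ⟨ψ, hs, hc, h1, h2⟩
  have hsob := eLpNorm_le_eLpNorm_fderiv_of_eq (F := ℝ) (volume : Measure (E n))
    (hs.of_le (by simp)) hc (p := p.toNNReal) (p' := (sobExp n p).toNNReal) (by simpa using hp.le)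
    (by
      have : (0 : ℝ) < n := by linarith
      simpa using this)
    (by
      rw [NNReal.coe_inv, Real.coe_toNNReal _ hp0.le, Real.coe_toNNReal _ (sobExp_pos hp hpn).le,
        finrank_euclideanSpace, Fintype.card_fin, sobExp]
      have h1 : (n : ℝ) - p ≠ 0 := by linarith
      have h2 : (n : ℝ) ≠ 0 := by linarith
      field_simp)
  rw [Real.coe_toNNReal _ hp0.le] at hsob
  change eLpNorm _ (ENNReal.ofReal (sobExp n p)) _ ≤ _ * eLpNorm _ (ENNReal.ofReal p) _ at hsob
  have h3 : eLpNorm (fderiv ℝ ψ) (ENNReal.ofReal p) volume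
      = eLpNorm (w.2 : E n → E n) (ENNReal.ofReal p) volume := by
    rw [eLpNorm_congr_ae h2]
    exact eLpNorm_congr_norm_ae (ae_of_all _ fun x => (norm_gradient ψ x).symm)
  rw [h3, ← eLpNorm_congr_ae h1] at hsob
  change ‖w.1‖ ≤ S * ‖w.2‖
  rw [Lp.norm_def, Lp.norm_def]
  refine (ENNReal.toReal_mono (ENNReal.mul_ne_top ENNReal.coe_ne_top (Lp.eLpNorm_ne_top _))
    hsob).trans ?_
  rw [ENNReal.toReal_mul, ENNReal.coe_toReal]

/-- Along approximating test functions, the Orlicz energies are asymptotically at most four times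
the energy of the limit. -/
theorem exists_tendsto_lintegral_orlicz_bound (hp2 : p < 2) (r : ℝ) (u : D1p n p hp hpn)
    {ψ : ℕ → E n → ℝ}
    (hgr : Tendsto (fun j => ∫⁻ x, ‖gradient (ψ j) x - D1p.grad u x‖ₑ ^ p) atTop (𝓝 0)) :
    ∃ b : ℕ → ℝ≥0∞,
      (∀ j, ∫⁻ x, ENNReal.ofReal (orlicz p (bracket r x) ‖fderiv ℝ (ψ j) x‖) ≤ b j) ∧
      Tendsto b atTop
        (𝓝 (4 * ∫⁻ x, ENNReal.ofReal (orlicz p (bracket r x) ‖D1p.grad u x‖))) := by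
  refine ⟨fun j => 4 * ((∫⁻ x, ENNReal.ofReal (orlicz p (bracket r x) ‖D1p.grad u x‖))
    + ∫⁻ x, ‖gradient (ψ j) x - D1p.grad u x‖ₑ ^ p), fun j => ?_, ?_⟩
  · have hm : Measurable fun x => ENNReal.ofReal (orlicz p (bracket r x) ‖D1p.grad u x‖) := by
      have h1 := (continuous_bracket (n := n) r).measurable
      have h2 := D1p.measurable_grad u
      unfold orlicz
      fun_prop
    simp only
    rw [← lintegral_add_left hm, ← lintegral_const_mul' _ _ (by norm_num)]
    refine lintegral_mono fun x => ?_
    rw [← ofReal_norm, ENNReal.ofReal_rpow_of_nonneg (norm_nonneg _) (by linarith),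
      ← ENNReal.ofReal_add (orlicz_nonneg _ _ _) (by positivity),
      show (4 : ℝ≥0∞) = ENNReal.ofReal 4 by norm_num, ← ENNReal.ofReal_mul (by norm_num)]
    refine ENNReal.ofReal_le_ofReal ?_
    rw [← norm_gradient]
    refine (orlicz_le_of_le_add hp hp2 (bracket_pos r x) (norm_nonneg _)
      (norm_nonneg (D1p.grad u x)) (norm_nonneg (gradient (ψ j) x - D1p.grad u x)) ?_).trans ?_
    · calc ‖gradient (ψ j) x‖ = ‖D1p.grad u x + (gradient (ψ j) x - D1p.grad u x)‖ := by
            congr 1; abel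
        _ ≤ _ := norm_add_le _ _
    · gcongr
      exact orlicz_le_rpow hp2 _ (norm_nonneg _)
  · have := (tendsto_const_nhds (x := ∫⁻ x, ENNReal.ofReal
      (orlicz p (bracket r x) ‖D1p.grad u x‖))).add hgr
    rw [add_zero] at this
    exact ENNReal.Tendsto.const_mul this (Or.inr (by norm_num))

theorem continuous_orlicz_right {s : ℝ} (hs : 0 < s) : Continuous (orlicz p s) :=
  continuous_orlicz continuous_const (fun _ => hs) continuous_id

/-- The Orlicz–Hardy inequality on `D^{1,p}`. -/
theorem D1p.lintegral_orlicz_hardy_le {k : ℕ} (hk : 3 ≤ k) (hkn : k ≤ n) (hp2 : p < 2) {γ : ℝ}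
    (hγ : 0 ≤ γ) (u : D1p n p hp hpn) :
    ∫⁻ x, ENNReal.ofReal (normY k x ^ (-p) * orlicz p (bracket γ x) (D1p.fn u x))
      ≤ 64 * ∫⁻ x, ENNReal.ofReal (orlicz p (bracket (γ + 1) x) ‖D1p.grad u x‖) := by
  obtain ⟨ψ, hs, hc, hae, -, hgr⟩ := D1p.exists_approx u
  obtain ⟨b, hb, hblim⟩ := exists_tendsto_lintegral_orlicz_bound hp2 (γ + 1) u hgr
  refine lintegral_le_of_le_liminf (Φ := fun (j : ℕ) x => ENNReal.ofReal
    ((normY k x ^ 2 + (1 / ((j : ℝ) + 1)) ^ 2) ^ (-(p / 2)) * orlicz p (bracket γ x) (ψ j x)))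
    (b := fun j => 16 * b j) (fun j => ?_) ?_ (fun j => ?_) ?_
  · have h1 := (continuous_normY (n := n) k).measurable
    have h2 := (continuous_orlicz (p := p) (continuous_bracket γ) (bracket_pos γ)
      (hs j).continuous).measurable
    fun_prop
  · filter_upwards [hae] with x hx
    by_cases hy : normY k x = 0
    · rw [hy, Real.zero_rpow (by linarith)]
      simp
    have hy0 : 0 < normY k x := lt_of_le_of_ne (normY_nonneg k x) (Ne.symm hy)
    refine (Tendsto.liminf_eq ?_).ge
    refine ENNReal.tendsto_ofReal ?_
    refine Tendsto.mul ?_ (((continuous_orlicz_right (bracket_pos γ x)).tendsto _).comp hx)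
    have h1 : Tendsto (fun j : ℕ => normY k x ^ 2 + (1 / ((j : ℝ) + 1)) ^ 2) atTop
        (𝓝 (normY k x ^ 2 + 0 ^ 2)) :=
      tendsto_const_nhds.add (tendsto_one_div_add_atTop_nhds_zero_nat.pow 2)
    have h2 := h1.rpow_const (p := -(p / 2)) (Or.inl (by positivity))
    convert h2 using 2
    rw [zero_pow two_ne_zero, add_zero, ← Real.rpow_natCast, ← Real.rpow_mul hy0.le]
    congr 1; push_cast; ring
  · refine (lintegral_orlicz_hardy hk hkn hp hp2 hγ (by positivity) ?_ (hs j) (hc j)).trans ?_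
    · rw [div_le_one (by positivity)]
      have : (0 : ℝ) ≤ j := j.cast_nonneg
      linarith
    · gcongr
      exact hb j
  · have := ENNReal.Tendsto.const_mul (a := 16) hblim (Or.inr (by norm_num))
    rw [← mul_assoc] at this
    norm_num at this
    exact this

/-- The Orlicz–Sobolev inequality on `D^{1,p}`. -/
theorem D1p.exists_lintegral_orlicz_sobolev_le {k : ℕ} (hk : 3 ≤ k) (hkn : k ≤ n) (hp : 1 < p)
    (hpn : p < n) (hp2 : p < 2) {γ : ℝ} (hγ : 0 ≤ γ) :
    ∃ C : ℝ, 0 ≤ C ∧ ∀ u : D1p n p hp hpn,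
      ∫⁻ x, ENNReal.ofReal (orlicz p (bracket γ x) (D1p.fn u x) ^ ((n : ℝ) / (n - p)))
        ≤ (ENNReal.ofReal C * ∫⁻ x, ENNReal.ofReal
            (orlicz p (bracket (γ + 1) x) ‖D1p.grad u x‖)) ^ ((n : ℝ) / (n - p)) := by
  obtain ⟨C, hC, h⟩ := exists_lintegral_orlicz_sobolev hk hkn hp hp2 hγ
  have hr0 : 0 < (n : ℝ) / (n - p) := div_pos (by linarith) (by linarith)
  refine ⟨C * 4, by positivity, fun u => ?_⟩
  obtain ⟨ψ, hs, hc, hae, -, hgr⟩ := D1p.exists_approx u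
  obtain ⟨b, hb, hblim⟩ := exists_tendsto_lintegral_orlicz_bound hp2 (γ + 1) u hgr
  refine lintegral_le_of_le_liminf (Φ := fun (j : ℕ) x => ENNReal.ofReal
    (orlicz p (bracket γ x) (ψ j x) ^ ((n : ℝ) / (n - p))))
    (b := fun j => (ENNReal.ofReal C * b j) ^ ((n : ℝ) / (n - p))) (fun j => ?_) ?_ (fun j => ?_) ?_
  · have h2 := (continuous_orlicz (p := p) (continuous_bracket γ) (bracket_pos γ)
      (hs j).continuous).measurable
    exact (h2.pow_const _).ennreal_ofReal.aemeasurable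
  · filter_upwards [hae] with x hx
    refine (Tendsto.liminf_eq ?_).ge
    refine ENNReal.tendsto_ofReal ?_
    exact (((continuous_orlicz_right (bracket_pos γ x)).tendsto _).comp hx).rpow_const
      (Or.inr hr0.le)
  · refine (h (ψ j) (hs j) (hc j)).trans ?_
    gcongr
    exact hb j
  · have := ENNReal.Tendsto.const_mul (a := ENNReal.ofReal C) hblim (Or.inr (by simp))
    rw [← mul_assoc, show (4 : ℝ≥0∞) = ENNReal.ofReal 4 by norm_num,
      ← ENNReal.ofReal_mul hC] at this
    exact ((ENNReal.continuous_rpow_const).tendsto _).comp this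

end


/-! ### Weak compactness -/

/-- Bounded sequences in a separable Hilbert space have weakly convergent subsequences. -/
theorem exists_weakly_convergent_subseq {H : Type*} [NormedAddCommGroup H] [InnerProductSpace ℝ H]
    [CompleteSpace H] [TopologicalSpace.SeparableSpace H] (z : ℕ → H) (R : ℝ)
    (hz : ∀ i, ‖z i‖ ≤ R) :
    ∃ (σ : ℕ → ℕ) (z₀ : H), StrictMono σ ∧
      ∀ l : H →L[ℝ] ℝ, Tendsto (fun i => l (z (σ i))) atTop (𝓝 (l z₀)) := by
  have hc := WeakDual.isSeqCompact_closedBall ℝ H 0 R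
  obtain ⟨f, -, σ, hσ, hlim⟩ := hc
    (x := fun i => StrongDual.toWeakDual (InnerProductSpace.toDual ℝ H (z i)))
    (fun i => by simpa using hz i)
  refine ⟨σ, (InnerProductSpace.toDual ℝ H).symm (WeakDual.toStrongDual f), hσ, fun l => ?_⟩
  have h1 := ((WeakDual.eval_continuous
    ((InnerProductSpace.toDual ℝ H).symm l)).tendsto f).comp hlim
  have h2 : ∀ y : H, l y = inner ℝ y ((InnerProductSpace.toDual ℝ H).symm l) := by
    intro y
    rw [real_inner_comm, InnerProductSpace.toDual_symm_apply]
  simp only [h2, InnerProductSpace.toDual_symm_apply (𝕜 := ℝ) (y := WeakDual.toStrongDual f)]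
  exact h1

theorem exists_continuousLinearMap_eq_zero_of_notMem {V : Type*} [NormedAddCommGroup V]
    [NormedSpace ℝ V] (K : Submodule ℝ V) (hK : IsClosed (K : Set V)) {x : V} (hx : x ∉ K) :
    ∃ l : V →L[ℝ] ℝ, (∀ y ∈ K, l y = 0) ∧ l x ≠ 0 := by
  obtain ⟨l, c, hl, hc⟩ := geometric_hahn_banach_closed_point K.convex hK hx
  have h0 : ∀ y ∈ K, l y = 0 := by
    intro y hy
    by_contra hne
    have := hl (((c + 1) / l y) • y) (K.smul_mem _ hy)
    rw [map_smul, smul_eq_mul, div_mul_cancel₀ _ hne] at this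
    linarith
  refine ⟨l, h0, fun h => ?_⟩
  have := hl 0 K.zero_mem
  rw [map_zero] at this
  linarith

section

variable {n : ℕ} {p : ℝ} {hp : 1 < p} {hpn : p < n}

/-- The weak gradient as a linear map from `D^{1,p}` to `Lᵖ`. -/
noncomputable def D1p.gradₗ (n : ℕ) (p : ℝ) (hp : 1 < p) (hpn : p < n) :
    D1p n p hp hpn →ₗ[ℝ] Lp (E n) (ENNReal.ofReal p) (volume : Measure (E n)) :=
  (LinearMap.snd ℝ _ _).comp (D1p n p hp hpn).subtype

theorem D1p.gradₗ_injective : Function.Injective (D1p.gradₗ n p hp hpn) := by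
  have := fact_one_le hp
  have := fact_one_le_sobExp hp hpn
  obtain ⟨C, hC⟩ := D1p.exists_sobolev hp hpn
  rw [injective_iff_map_eq_zero]
  intro u hu
  have hu' : u.1.2 = 0 := hu
  have h1 := hC u
  rw [D1p.gradNorm, hu', Lp.norm_zero, mul_zero] at h1
  have h2 : u.1.1 = 0 := norm_le_zero_iff.1 h1
  exact Subtype.ext (Prod.ext h2 hu')

theorem D1p.isClosed_range_gradₗ [Fact (1 ≤ ENNReal.ofReal p)] :
    IsClosed (Set.range (D1p.gradₗ n p hp hpn)) := by
  have := fact_one_le_sobExp hp hpn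
  obtain ⟨C, hC⟩ := D1p.exists_sobolev hp hpn
  have hcl : IsClosed ((D1p n p hp hpn : Submodule ℝ (Pair n p)) : Set (Pair n p)) :=
    Submodule.isClosed_topologicalClosure _
  have : CompleteSpace (D1p n p hp hpn) := hcl.completeSpace_coe
  have hanti : AntilipschitzWith (max C 1) (D1p.gradₗ n p hp hpn) := by
    refine AddMonoidHomClass.antilipschitz_of_bound _ fun u => ?_
    have h1 : ‖u‖ = max ‖u.1.1‖ ‖u.1.2‖ := rfl
    have h2 : ‖D1p.gradₗ n p hp hpn u‖ = ‖u.1.2‖ := rfl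
    rw [h1, h2, NNReal.coe_max]
    refine max_le ((hC u).trans ?_) ?_
    · exact mul_le_mul_of_nonneg_right (le_max_left _ _) (norm_nonneg _)
    · exact le_mul_of_one_le_left (norm_nonneg _) (le_max_right _ _)
  have huc : UniformContinuous (D1p.gradₗ n p hp hpn) :=
    uniformContinuous_snd.comp uniformContinuous_subtype_val
  exact hanti.isClosed_range huc

/-- Functionals on `D^{1,p}` that are bounded for the gradient norm extend to `Lᵖ`. -/
theorem D1p.exists_extension (hp : 1 < p) (hpn : p < n) [Fact (1 ≤ ENNReal.ofReal p)]
    (l : D1p n p hp hpn →ₗ[ℝ] ℝ)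
    (hl : ∃ C : ℝ, ∀ w, |l w| ≤ C * D1p.gradNorm w) :
    ∃ L : Lp (E n) (ENNReal.ofReal p) (volume : Measure (E n)) →L[ℝ] ℝ,
      ∀ u, l u = L (D1p.gradₗ n p hp hpn u) := by
  obtain ⟨C, hC⟩ := hl
  set e := LinearEquiv.ofInjective (D1p.gradₗ n p hp hpn) D1p.gradₗ_injective with he
  set f := LinearMap.mkContinuous (l ∘ₗ e.symm.toLinearMap) C (by
    intro y
    obtain ⟨u, rfl⟩ := e.surjective y
    rw [LinearMap.comp_apply, LinearEquiv.coe_coe, LinearEquiv.symm_apply_apply]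
    exact hC u) with hf
  obtain ⟨L, hL, -⟩ := exists_extension_norm_eq _ f
  refine ⟨L, fun u => ?_⟩
  have h1 := hL (e u)
  rw [hf] at h1
  simp only [LinearMap.mkContinuous_apply, LinearMap.comp_apply, LinearEquiv.coe_coe,
    LinearEquiv.symm_apply_apply] at h1
  exact h1.symm

/-- If the gradients of a sequence are asymptotic in `Lᵖ` to the image of a bounded sequence of a
Hilbert space under a bounded operator, a subsequence converges weakly in `D^{1,p}`. -/
theorem D1p.exists_tendstoWeakly [Fact (1 ≤ ENNReal.ofReal p)] {H : Type*} [NormedAddCommGroup H]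
    [InnerProductSpace ℝ H] [CompleteSpace H] [TopologicalSpace.SeparableSpace H]
    (T : H →L[ℝ] Lp (E n) (ENNReal.ofReal p) (volume : Measure (E n))) (z : ℕ → H) {R : ℝ}
    (hz : ∀ i, ‖z i‖ ≤ R) (u : ℕ → D1p n p hp hpn)
    (hu : Tendsto (fun i => ‖(u i).1.2 - T (z i)‖) atTop (𝓝 0)) :
    ∃ (σ : ℕ → ℕ) (u₀ : D1p n p hp hpn), StrictMono σ ∧
      D1p.TendstoWeakly (fun i => u (σ i)) u₀ := by
  obtain ⟨σ, z₀, hσ, hlim⟩ := exists_weakly_convergent_subseq z R hz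
  have hL : ∀ L : Lp (E n) (ENNReal.ofReal p) (volume : Measure (E n)) →L[ℝ] ℝ,
      Tendsto (fun i => L (D1p.gradₗ n p hp hpn (u (σ i)))) atTop (𝓝 (L (T z₀))) := by
    intro L
    have h1 := hlim (L.comp T)
    have h2 : Tendsto (fun i => L ((u (σ i)).1.2 - T (z (σ i)))) atTop (𝓝 0) := by
      have h3 := (tendsto_zero_iff_norm_tendsto_zero.2 (hu.comp hσ.tendsto_atTop))
      have h4 := (L.continuous.tendsto 0).comp
        (tendsto_zero_iff_norm_tendsto_zero.2 (hu.comp hσ.tendsto_atTop))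
      rw [map_zero] at h4
      exact h4
    have h5 := h2.add h1
    rw [zero_add] at h5
    refine h5.congr fun i => ?_
    simp only [ContinuousLinearMap.comp_apply, map_sub, sub_add_cancel]
    rfl
  have hmem : T z₀ ∈ LinearMap.range (D1p.gradₗ n p hp hpn) := by
    by_contra hne
    obtain ⟨L, h0, hne'⟩ := exists_continuousLinearMap_eq_zero_of_notMem _
      (by rw [LinearMap.coe_range]; exact D1p.isClosed_range_gradₗ) hne
    refine hne' (tendsto_nhds_unique (hL L) ?_)
    simp_rw [h0 _ (LinearMap.mem_range_self _ _)]
    exact tendsto_const_nhds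
  obtain ⟨u₀, hu₀⟩ := hmem
  refine ⟨σ, u₀, hσ, fun l hl => ?_⟩
  obtain ⟨L, hLl⟩ := D1p.exists_extension hp hpn l hl
  simp_rw [hLl, hu₀]
  exact hL L

theorem rpow_le_bracket_add_orlicz (hp : 1 < p) (hp2 : p < 2) {m e t : ℝ} (hm : 0 < m) (he : 0 < e)
    (he1 : e ≤ 1) (ht : 0 ≤ t) : t ^ p ≤ m ^ p + 2 * ((e ^ 2)⁻¹ * orlicz p m (e * t)) := by
  have h0 : 0 ≤ (e ^ 2)⁻¹ * orlicz p m (e * t) := mul_nonneg (by positivity) (orlicz_nonneg _ _ _)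
  rcases le_total t m with h | h
  · have : t ^ p ≤ m ^ p := by gcongr
    linarith
  · have h1 := rpow_le_orlicz hp hp2 hm.le (hm.trans_le h) h
    have h2 : orlicz p m t ≤ (e ^ 2)⁻¹ * orlicz p m (e * t) := by
      unfold orlicz
      have h3 : (m ^ 2 + t ^ 2) ^ ((p - 2) / 2) ≤ (m ^ 2 + (e * t) ^ 2) ^ ((p - 2) / 2) := by
        refine Real.rpow_le_rpow_of_nonpos (by positivity) ?_ (by linarith)
        gcongr
        exact mul_le_of_le_one_left ht he1
      calc _ ≤ (m ^ 2 + (e * t) ^ 2) ^ ((p - 2) / 2) * t ^ 2 := by gcongr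
        _ = _ := by field_simp
    have : 0 ≤ m ^ p := by positivity
    linarith

/-- The energy bound controls the gradients in `Lᵖ`. -/
theorem D1p.lintegral_grad_rpow_le (hp2 : p < 2) {r B : ℝ} {e : ℝ} (he : e ∈ Set.Ioo (0 : ℝ) 1)
    (u : D1p n p hp hpn)
    (hB : ∫⁻ x, ENNReal.ofReal (orlicz p (bracket r x) (e * ‖D1p.grad u x‖))
      ≤ ENNReal.ofReal (e ^ 2 * B)) :
    ∫⁻ x, ‖D1p.grad u x‖ₑ ^ p
      ≤ (∫⁻ x : E n, ENNReal.ofReal (bracket r x ^ p)) + ENNReal.ofReal (2 * B) := by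
  have he0 := he.1
  have hm : Measurable fun x : E n => ENNReal.ofReal (bracket r x ^ p) := by
    have h1 := (continuous_bracket (n := n) r).measurable
    fun_prop
  calc _ ≤ ∫⁻ x, (ENNReal.ofReal (bracket r x ^ p)
        + ENNReal.ofReal (2 * (e ^ 2)⁻¹) *
          ENNReal.ofReal (orlicz p (bracket r x) (e * ‖D1p.grad u x‖))) := by
        refine lintegral_mono fun x => ?_
        have := bracket_pos r x
        rw [← ofReal_norm, ENNReal.ofReal_rpow_of_nonneg (norm_nonneg _) (by linarith),
          ← ENNReal.ofReal_mul (by positivity), ← ENNReal.ofReal_add (by positivity)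
            (mul_nonneg (by positivity) (orlicz_nonneg _ _ _)), mul_assoc]
        exact ENNReal.ofReal_le_ofReal
          (rpow_le_bracket_add_orlicz hp hp2 this he0 he.2.le (norm_nonneg _))
    _ ≤ (∫⁻ x : E n, ENNReal.ofReal (bracket r x ^ p))
        + ENNReal.ofReal (2 * (e ^ 2)⁻¹) * ENNReal.ofReal (e ^ 2 * B) := by
        rw [lintegral_add_left hm, lintegral_const_mul' _ _ ENNReal.ofReal_ne_top]
        gcongr
    _ = _ := by
        rw [← ENNReal.ofReal_mul (by positivity)]
        congr 2
        field_simp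

/-- The rescaled field `(m² + e²|D|²)^{(p-2)/4} D`, `m = bracket r`, whose squared length is
`e⁻² J(m, e|D|)`. -/
noncomputable def rescaledField (p r e : ℝ) (D : E n → E n) (x : E n) : E n :=
  (bracket r x ^ 2 + (e * ‖D x‖) ^ 2) ^ ((p - 2) / 4) • D x

theorem measurable_rescaledField {D : E n → E n} (hD : Measurable D) (r e : ℝ) :
    Measurable (rescaledField p r e D) := by
  have hbm := (continuous_bracket (n := n) r).measurable
  unfold rescaledField
  fun_prop

theorem eLpNorm_rescaledField_le {r e B : ℝ} (he : 0 < e) {D : E n → E n}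
    (hD : ∫⁻ x, ENNReal.ofReal (orlicz p (bracket r x) (e * ‖D x‖)) ≤ ENNReal.ofReal (e ^ 2 * B)) :
    eLpNorm (rescaledField p r e D) 2 volume ≤ ENNReal.ofReal B ^ (1 / 2 : ℝ) := by
  have h1 : ∀ x, ‖rescaledField p r e D x‖ₑ ^ (2 : ℝ) = ENNReal.ofReal ((e ^ 2)⁻¹) *
      ENNReal.ofReal (orlicz p (bracket r x) (e * ‖D x‖)) := by
    intro x
    have hb := bracket_pos r x
    have : 0 < bracket r x ^ 2 + (e * ‖D x‖) ^ 2 := by positivity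
    rw [← ofReal_norm, ENNReal.ofReal_rpow_of_nonneg (norm_nonneg _) (by norm_num),
      ← ENNReal.ofReal_mul (by positivity), rescaledField]
    congr 1
    rw [norm_smul, Real.norm_eq_abs, abs_of_pos (by positivity),
      Real.mul_rpow (by positivity) (norm_nonneg _), ← Real.rpow_mul this.le, Real.rpow_two]
    unfold orlicz
    rw [show (p - 2) / 4 * 2 = (p - 2) / 2 by ring]
    field_simp
  have h2 := eLpNorm_ofReal_eq (μ := volume) two_pos (rescaledField p r e D)
  rw [ENNReal.ofReal_ofNat] at h2
  rw [h2]
  gcongr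
  simp_rw [h1]
  rw [lintegral_const_mul' _ _ ENNReal.ofReal_ne_top]
  calc _ ≤ ENNReal.ofReal ((e ^ 2)⁻¹) * ENNReal.ofReal (e ^ 2 * B) := by gcongr
    _ = _ := by
        rw [← ENNReal.ofReal_mul (by positivity)]
        congr 1
        field_simp

theorem norm_sub_smul_rescaledField_le (hp : 1 < p) (hp2 : p < 2) {r e : ℝ} (he : 0 < e)
    (D : E n → E n) (x : E n) :
    ‖D x - bracket r x ^ ((2 - p) / 2) • rescaledField p r e D x‖
      ≤ (e * ‖D x‖) ^ ((2 - p) / 2) * ‖rescaledField p r e D x‖ := by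
  have hb := bracket_pos r x
  set α := (2 - p) / 2 with hα
  set A := bracket r x ^ 2 + (e * ‖D x‖) ^ 2 with hA
  have hpx : 0 < A := by positivity
  have h3 : D x = A ^ (α / 2) • rescaledField p r e D x := by
    rw [rescaledField, smul_smul, ← Real.rpow_add hpx, hα,
      show (2 - p) / 2 / 2 + (p - 2) / 4 = 0 by ring, Real.rpow_zero, one_smul]
  have hsq : ∀ t : ℝ, 0 ≤ t → (t ^ 2) ^ (α / 2) = t ^ α := by
    intro t ht
    rw [← Real.rpow_natCast, ← Real.rpow_mul ht]
    congr 1; push_cast; ring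
  have h4 : A ^ (α / 2) ≤ bracket r x ^ α + (e * ‖D x‖) ^ α := by
    rw [← hsq _ hb.le, ← hsq _ (by positivity)]
    exact Real.rpow_add_le_add_rpow (by positivity) (by positivity) (by linarith) (by linarith)
  have h5 : bracket r x ^ α ≤ A ^ (α / 2) := by
    rw [← hsq _ hb.le]
    refine Real.rpow_le_rpow (by positivity) ?_ (by linarith)
    rw [hA]
    linarith [sq_nonneg (e * ‖D x‖)]
  calc _ = ‖(A ^ (α / 2) - bracket r x ^ α) • rescaledField p r e D x‖ := by
        conv_lhs => rw [h3]
        rw [sub_smul, ← h3]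
    _ ≤ _ := by
        rw [norm_smul, Real.norm_eq_abs, abs_of_nonneg (by linarith)]
        gcongr
        linarith

theorem holderTriple_sobolev_dual (hp : 1 < p) (hp2 : p < 2) :
    ENNReal.HolderTriple (ENNReal.ofReal (2 * p / (2 - p))) 2 (ENNReal.ofReal p) := by
  have hs0 : 0 < 2 * p / (2 - p) := div_pos (by linarith) (by linarith)
  refine ⟨?_⟩
  rw [show (2 : ℝ≥0∞) = ENNReal.ofReal 2 by norm_num, ← ENNReal.ofReal_inv_of_pos hs0,
    ← ENNReal.ofReal_inv_of_pos two_pos, ← ENNReal.ofReal_inv_of_pos (by linarith),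
    ← ENNReal.ofReal_add (by positivity) (by positivity)]
  congr 1
  have : 2 - p ≠ 0 := by linarith
  field_simp
  ring

theorem eLpNorm_sub_smul_rescaledField_le (hp : 1 < p) (hp2 : p < 2) {r e : ℝ} (he : 0 < e)
    {D : E n → E n} (hD : Measurable D) :
    eLpNorm (fun x => D x - bracket r x ^ ((2 - p) / 2) • rescaledField p r e D x)
        (ENNReal.ofReal p) volume
      ≤ ENNReal.ofReal (e ^ ((2 - p) / 2)) * ((∫⁻ x, ‖D x‖ₑ ^ p) ^ (1 / (2 * p / (2 - p))) *
        eLpNorm (rescaledField p r e D) 2 volume) := by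
  have := holderTriple_sobolev_dual hp hp2
  set s : ℝ := 2 * p / (2 - p) with hs
  have hs0 : 0 < s := div_pos (by linarith) (by linarith)
  set α : ℝ := (2 - p) / 2 with hα
  have hα0 : 0 < α := by rw [hα]; linarith
  have hαs : α * s = p := by
    rw [hα, hs]
    have : 2 - p ≠ 0 := by linarith
    field_simp
  have hhm : Measurable fun x => (e * ‖D x‖) ^ α := by fun_prop
  calc _ ≤ eLpNorm ((fun x => (e * ‖D x‖) ^ α) • rescaledField p r e D)
          (ENNReal.ofReal p) volume := by
        refine eLpNorm_mono fun x => ?_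
        have h6 : 0 ≤ (e * ‖D x‖) ^ α := by positivity
        rw [Pi.smul_apply', norm_smul, Real.norm_eq_abs, abs_of_nonneg h6]
        exact norm_sub_smul_rescaledField_le hp hp2 he D x
    _ ≤ eLpNorm (fun x => (e * ‖D x‖) ^ α) (ENNReal.ofReal s) volume *
          eLpNorm (rescaledField p r e D) 2 volume :=
        eLpNorm_smul_le_mul_eLpNorm (measurable_rescaledField hD r e).aestronglyMeasurable
          hhm.aestronglyMeasurable
    _ = _ := by
        rw [← mul_assoc]
        congr 1
        rw [eLpNorm_ofReal_eq hs0]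
        have h1 : ∀ x, ‖(e * ‖D x‖) ^ α‖ₑ ^ s = ENNReal.ofReal (e ^ α) ^ s * ‖D x‖ₑ ^ p := by
          intro x
          rw [Real.mul_rpow he.le (norm_nonneg _), enorm_mul,
            ENNReal.mul_rpow_of_nonneg _ _ hs0.le, Real.enorm_eq_ofReal (by positivity),
            Real.enorm_eq_ofReal (by positivity),
            ← ENNReal.ofReal_rpow_of_nonneg (norm_nonneg _) hα0.le, ← ENNReal.rpow_mul, hαs,
            ofReal_norm]
        simp_rw [h1]
        rw [lintegral_const_mul' _ _ (by finiteness),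
          ENNReal.mul_rpow_of_nonneg _ _ (by positivity), ← ENNReal.rpow_mul,
          mul_one_div_cancel hs0.ne', ENNReal.rpow_one]

theorem memLp_bracket_rpow (hp : 1 < p) (hp2 : p < 2) {r : ℝ}
    (hr : ∫⁻ x : E n, ENNReal.ofReal (bracket r x ^ p) ≠ ⊤) :
    MemLp (fun x : E n => bracket r x ^ ((2 - p) / 2)) (ENNReal.ofReal (2 * p / (2 - p)))
      volume := by
  have hs0 : 0 < 2 * p / (2 - p) := div_pos (by linarith) (by linarith)
  refine ⟨((continuous_bracket (n := n) r).measurable.pow_const _).aestronglyMeasurable, ?_⟩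
  rw [eLpNorm_ofReal_eq hs0]
  refine ENNReal.rpow_lt_top_of_nonneg (by positivity) ?_
  convert hr using 3 with x
  have hb := bracket_pos r x
  have : 2 - p ≠ 0 := by linarith
  rw [Real.enorm_eq_ofReal (by positivity), ENNReal.ofReal_rpow_of_nonneg (by positivity) hs0.le,
    ← Real.rpow_mul hb.le]
  congr 2
  field_simp

/-- A sequence with bounded energies has a weakly convergent subsequence: the rescaled gradients
`Z = (m² + ε²|Dφ|²)^{(p-2)/4} Dφ` are bounded in `L²`, and `Dφ - m^{(2-p)/2} Z` tends to zero
in `Lᵖ`. -/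
theorem D1p.exists_tendstoWeakly_of_energy (hp2 : p < 2) {r B : ℝ}
    (hr : ∫⁻ x : E n, ENNReal.ofReal (bracket r x ^ p) ≠ ⊤) {ε : ℕ → ℝ}
    (hε : ∀ i, ε i ∈ Set.Ioo (0 : ℝ) 1) (hε0 : Tendsto ε atTop (𝓝 0)) (φ : ℕ → D1p n p hp hpn)
    (hφ : ∀ i, ∫⁻ x, ENNReal.ofReal (orlicz p (bracket r x) (ε i * ‖D1p.grad (φ i) x‖))
      ≤ ENNReal.ofReal (ε i ^ 2 * B)) :
    ∃ (σ : ℕ → ℕ) (φ₀ : D1p n p hp hpn), StrictMono σ ∧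
      D1p.TendstoWeakly (fun i => φ (σ i)) φ₀ := by
  have hfact := fact_one_le hp
  have htriple := holderTriple_sobolev_dual hp hp2
  have : Fact (1 ≤ ENNReal.ofReal (2 * p / (2 - p))) :=
    ⟨by rw [ENNReal.one_le_ofReal, le_div_iff₀ (by linarith)]; linarith⟩
  have hBtop : ENNReal.ofReal B ^ (1 / 2 : ℝ) ≠ ⊤ := by finiteness
  have hZe : ∀ i, eLpNorm (rescaledField p r (ε i) (D1p.grad (φ i))) 2 volume
      ≤ ENNReal.ofReal B ^ (1 / 2 : ℝ) := fun i => eLpNorm_rescaledField_le (hε i).1 (hφ i)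
  have hZL : ∀ i, MemLp (rescaledField p r (ε i) (D1p.grad (φ i))) 2 volume := fun i =>
    ⟨(measurable_rescaledField (D1p.measurable_grad _) _ _).aestronglyMeasurable,
      (hZe i).trans_lt hBtop.lt_top⟩
  have hwL := memLp_bracket_rpow hp hp2 hr
  set T : Lp (E n) 2 (volume : Measure (E n)) →L[ℝ]
      Lp (E n) (ENNReal.ofReal p) (volume : Measure (E n)) :=
    (ContinuousLinearMap.lsmul ℝ ℝ).holderL volume (ENNReal.ofReal (2 * p / (2 - p))) 2
      (ENNReal.ofReal p) (hwL.toLp _) with hT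
  have hTc : ∀ i, T ((hZL i).toLp _) =ᵐ[volume] fun x =>
      bracket r x ^ ((2 - p) / 2) • rescaledField p r (ε i) (D1p.grad (φ i)) x := by
    intro i
    have h1 := (ContinuousLinearMap.lsmul ℝ ℝ).coeFn_holder (r := ENNReal.ofReal p)
      (hwL.toLp (fun x : E n => bracket r x ^ ((2 - p) / 2))) ((hZL i).toLp _)
    filter_upwards [h1, hwL.coeFn_toLp, (hZL i).coeFn_toLp] with x h1 h2 h3
    rw [h2, h3] at h1
    exact h1
  clear_value T
  have : Fact ((2 : ℝ≥0∞) ≠ ⊤) := ⟨by norm_num⟩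
  refine D1p.exists_tendstoWeakly T (fun i => (hZL i).toLp _)
    (R := (ENNReal.ofReal B ^ (1 / 2 : ℝ)).toReal) (fun i => ?_) φ ?_
  · rw [Lp.norm_toLp]
    exact ENNReal.toReal_mono hBtop (hZe i)
  set G : ℝ≥0∞ := ((∫⁻ x : E n, ENNReal.ofReal (bracket r x ^ p)) + ENNReal.ofReal (2 * B)) ^
    (1 / (2 * p / (2 - p))) * ENNReal.ofReal B ^ (1 / 2 : ℝ) with hG
  have hGtop : G ≠ ⊤ := by
    have : 0 ≤ 1 / (2 * p / (2 - p)) :=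
      div_nonneg zero_le_one (div_nonneg (by linarith) (by linarith))
    finiteness
  have hnorm : ∀ i, ‖(φ i).1.2 - T ((hZL i).toLp _)‖
      = (eLpNorm (fun x => D1p.grad (φ i) x - bracket r x ^ ((2 - p) / 2) •
          rescaledField p r (ε i) (D1p.grad (φ i)) x) (ENNReal.ofReal p) volume).toReal := by
    intro i
    rw [Lp.norm_def]
    congr 1
    refine eLpNorm_congr_ae ?_
    filter_upwards [Lp.coeFn_sub (φ i).1.2 (T ((hZL i).toLp _)), hTc i] with x h1 h2
    rw [h1, Pi.sub_apply, h2]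
    rfl
  simp_rw [hnorm]
  refine (ENNReal.tendsto_toReal ENNReal.zero_ne_top).comp ?_
  have hlim : Tendsto (fun i => ENNReal.ofReal (ε i ^ ((2 - p) / 2)) * G) atTop (𝓝 0) := by
    have h1 : Tendsto (fun i => ENNReal.ofReal (ε i ^ ((2 - p) / 2))) atTop (𝓝 0) := by
      have h2 := hε0.rpow_const (p := (2 - p) / 2) (Or.inr (by linarith))
      rw [Real.zero_rpow (by linarith)] at h2
      simpa using ENNReal.tendsto_ofReal h2
    have h3 := ENNReal.Tendsto.mul_const (b := G) h1 (Or.inr hGtop)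
    rwa [zero_mul] at h3
  refine tendsto_of_tendsto_of_tendsto_of_le_of_le tendsto_const_nhds hlim
    (fun _ => zero_le) fun i => ?_
  refine (eLpNorm_sub_smul_rescaledField_le hp hp2 (hε i).1 (D1p.measurable_grad _)).trans ?_
  have : 0 ≤ 1 / (2 * p / (2 - p)) :=
    div_nonneg zero_le_one (div_nonneg (by linarith) (by linarith))
  simp only [hG]
  gcongr
  · exact D1p.lintegral_grad_rpow_le hp2 (hε i) (φ i) (hφ i)
  · exact hZe i

end


/-! ### Almost everywhere convergence -/

theorem lintegral_rpow_le_lintegral_rpow {α : Type*} [MeasurableSpace α] {ν : Measure α}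
    [IsProbabilityMeasure ν] {f : α → ℝ≥0∞} (hf : AEMeasurable f ν) {p : ℝ} (hp : 1 < p) :
    (∫⁻ x, f x ∂ν) ^ p ≤ ∫⁻ x, f x ^ p ∂ν := by
  have h := ENNReal.lintegral_mul_le_Lp_mul_Lq ν (Real.HolderConjugate.conjExponent hp) hf
    (aemeasurable_const (b := (1 : ℝ≥0∞)))
  simp only [Pi.mul_apply, mul_one, ENNReal.one_rpow, lintegral_const, measure_univ] at h
  calc _ ≤ ((∫⁻ x, f x ^ p ∂ν) ^ (1 / p)) ^ p := by gcongr
    _ = _ := by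
      rw [← ENNReal.rpow_mul, one_div_mul_cancel (by linarith), ENNReal.rpow_one]

section

variable {n : ℕ} {p : ℝ}

theorem lintegral_enorm_translate_sub_rpow_le (hp : 1 < p) {ψ : E n → ℝ} (hs : ContDiff ℝ ∞ ψ)
    (h : E n) :
    ∫⁻ x, ‖ψ (x + h) - ψ x‖ₑ ^ p ≤ ‖h‖ₑ ^ p * ∫⁻ x, ‖gradient ψ x‖ₑ ^ p := by
  have hprob : IsProbabilityMeasure (volume.restrict (Set.Ioc (0 : ℝ) 1)) :=
    ⟨by simp⟩
  have hdc : Continuous (fderiv ℝ ψ) := hs.continuous_fderiv (by simp)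
  have hgc : Continuous (gradient ψ) := by
    unfold gradient
    exact (LinearIsometryEquiv.continuous _).comp hdc
  have hpt : ∀ x, ‖ψ (x + h) - ψ x‖ₑ ^ p
      ≤ ∫⁻ t in Set.Ioc (0 : ℝ) 1, ‖h‖ₑ ^ p * ‖gradient ψ (x + t • h)‖ₑ ^ p := by
    intro x
    have h1 : ∀ t : ℝ, HasDerivAt (fun t : ℝ => ψ (x + t • h)) (fderiv ℝ ψ (x + t • h) h) t := by
      intro t
      have h2 : HasDerivAt (fun t : ℝ => x + t • h) h t := by
        simpa using ((hasDerivAt_id t).smul_const h).const_add x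
      exact ((hs.differentiable (by simp) (x + t • h)).hasFDerivAt).comp_hasDerivAt t h2
    have h3 : Continuous fun t : ℝ => fderiv ℝ ψ (x + t • h) h :=
      (hdc.comp (by fun_prop)).clm_apply continuous_const
    have h4 : ∫ t in (0 : ℝ)..1, fderiv ℝ ψ (x + t • h) h = ψ (x + h) - ψ x := by
      rw [intervalIntegral.integral_eq_sub_of_hasDerivAt (fun t _ => h1 t)
        (h3.intervalIntegrable _ _)]
      simp
    rw [← h4, intervalIntegral.integral_of_le zero_le_one]
    have h5 : ‖∫ t in Set.Ioc (0 : ℝ) 1, fderiv ℝ ψ (x + t • h) h‖ₑ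
        ≤ ∫⁻ t in Set.Ioc (0 : ℝ) 1, ‖h‖ₑ * ‖gradient ψ (x + t • h)‖ₑ := by
      refine (enorm_integral_le_lintegral_enorm _).trans (lintegral_mono fun t => ?_)
      rw [mul_comm, ← ofReal_norm, ← ofReal_norm, ← ofReal_norm, ← ENNReal.ofReal_mul
        (norm_nonneg _), norm_gradient]
      exact ENNReal.ofReal_le_ofReal ((fderiv ℝ ψ (x + t • h)).le_opNorm h)
    calc _ ≤ (∫⁻ t in Set.Ioc (0 : ℝ) 1, ‖h‖ₑ * ‖gradient ψ (x + t • h)‖ₑ) ^ p := by gcongr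
      _ ≤ ∫⁻ t in Set.Ioc (0 : ℝ) 1, (‖h‖ₑ * ‖gradient ψ (x + t • h)‖ₑ) ^ p := by
        refine lintegral_rpow_le_lintegral_rpow ?_ hp
        have : Measurable fun t : ℝ => gradient ψ (x + t • h) :=
          (hgc.comp (by fun_prop)).measurable
        fun_prop
      _ = _ := by
        refine lintegral_congr fun t => ?_
        rw [ENNReal.mul_rpow_of_nonneg _ _ (by linarith)]
  calc _ ≤ ∫⁻ x, ∫⁻ t in Set.Ioc (0 : ℝ) 1, ‖h‖ₑ ^ p * ‖gradient ψ (x + t • h)‖ₑ ^ p :=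
        lintegral_mono hpt
    _ = ∫⁻ t in Set.Ioc (0 : ℝ) 1, ∫⁻ x, ‖h‖ₑ ^ p * ‖gradient ψ (x + t • h)‖ₑ ^ p := by
        refine lintegral_lintegral_swap ?_
        have : Measurable fun q : E n × ℝ => gradient ψ (q.1 + q.2 • h) :=
          (hgc.comp (by fun_prop)).measurable
        have h2 : Measurable fun q : E n × ℝ => ‖h‖ₑ ^ p * ‖gradient ψ (q.1 + q.2 • h)‖ₑ ^ p := by
          fun_prop
        exact h2.aemeasurable
    _ = ∫⁻ t in Set.Ioc (0 : ℝ) 1, ‖h‖ₑ ^ p * ∫⁻ x, ‖gradient ψ x‖ₑ ^ p := by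
        refine lintegral_congr fun t => ?_
        rw [lintegral_const_mul' _ _ (by
          have : 0 ≤ p := by linarith
          finiteness)]
        congr 1
        exact lintegral_add_right_eq_self (fun x => ‖gradient ψ x‖ₑ ^ p) (t • h)
    _ = _ := by simp

variable {hp : 1 < p} {hpn : p < n}

/-- The `Lᵖ` modulus of continuity of an element of `D^{1,p}`. -/
theorem D1p.lintegral_enorm_translate_sub_rpow_le (u : D1p n p hp hpn) (h : E n) :
    ∫⁻ x, ‖D1p.fn u (x + h) - D1p.fn u x‖ₑ ^ p
      ≤ ‖h‖ₑ ^ p * (2 ^ p * ∫⁻ x, ‖D1p.grad u x‖ₑ ^ p) := by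
  have hp0 : 0 ≤ p := by linarith
  obtain ⟨ψ, hs, hc, hae, -, hgr⟩ := D1p.exists_approx u
  refine lintegral_le_of_le_liminf (Φ := fun j x => ‖ψ j (x + h) - ψ j x‖ₑ ^ p)
    (b := fun j => ‖h‖ₑ ^ p * (2 ^ p * ((∫⁻ x, ‖D1p.grad u x‖ₑ ^ p)
      + ∫⁻ x, ‖gradient (ψ j) x - D1p.grad u x‖ₑ ^ p)))
    (fun j => ?_) ?_ (fun j => ?_) ?_
  · have h1 := (hs j).continuous.measurable
    fun_prop
  · have hae' := (measurePreserving_add_right volume h).quasiMeasurePreserving.ae hae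
    filter_upwards [hae, hae'] with x h1 h2
    refine (Tendsto.liminf_eq ?_).ge
    exact (ENNReal.continuous_rpow_const.tendsto _).comp
      ((continuous_enorm.tendsto _).comp (h2.sub h1))
  · refine (HSM.lintegral_enorm_translate_sub_rpow_le hp (hs j) h).trans ?_
    gcongr
    have hm : Measurable fun x => ‖D1p.grad u x‖ₑ ^ p := by
      have := D1p.measurable_grad u
      fun_prop
    rw [← lintegral_add_left hm, ← lintegral_const_mul' _ _ (by finiteness)]
    refine lintegral_mono fun x => ?_
    refine le_trans ?_ (ENNReal.add_rpow_le_two_rpow_mul_rpow_add_rpow _ _ hp0)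
    gcongr
    calc ‖gradient (ψ j) x‖ₑ = ‖D1p.grad u x + (gradient (ψ j) x - D1p.grad u x)‖ₑ := by
          congr 1; abel
      _ ≤ _ := enorm_add_le _ _
  · have h1 := (tendsto_const_nhds (x := ∫⁻ x, ‖D1p.grad u x‖ₑ ^ p)).add hgr
    rw [add_zero] at h1
    exact ENNReal.Tendsto.const_mul (ENNReal.Tendsto.const_mul h1 (Or.inr (by finiteness)))
      (Or.inr (by finiteness))

/-- The mean of `u` over the ball of radius `δ` about `x`. -/
noncomputable def ballMean (δ : ℝ) (u : E n → ℝ) (x : E n) : ℝ :=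
  ∫ h, u (x + h) ∂(ProbabilityTheory.cond volume (Metric.ball (0 : E n) δ))

theorem isProbabilityMeasure_cond_ball {δ : ℝ} (hδ : 0 < δ) :
    IsProbabilityMeasure (ProbabilityTheory.cond volume (Metric.ball (0 : E n) δ)) :=
  ProbabilityTheory.cond_isProbabilityMeasure_of_finite
    (Metric.measure_ball_pos volume _ hδ).ne' measure_ball_lt_top.ne

theorem D1p.exists_eLpNorm_translate_le (hp : 1 < p) (hpn : p < n) {δ : ℝ} (hδ : 0 < δ) :
    ∃ C : NNReal, ∀ (u : D1p n p hp hpn) (x : E n),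
      eLpNorm (fun h => D1p.fn u (x + h)) 1
        (ProbabilityTheory.cond volume (Metric.ball (0 : E n) δ))
        ≤ ENNReal.ofReal (C * D1p.gradNorm u) := by
  have hprob := isProbabilityMeasure_cond_ball (n := n) hδ
  obtain ⟨S, hS⟩ := D1p.exists_sobolev hp hpn
  set c : ℝ≥0∞ := (volume (Metric.ball (0 : E n) δ))⁻¹ with hc
  have hctop : c ≠ ⊤ := by
    rw [hc, Ne, ENNReal.inv_eq_top]
    exact (Metric.measure_ball_pos volume _ hδ).ne'
  set q := ENNReal.ofReal (sobExp n p) with hq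
  have hq1 := (fact_one_le_sobExp hp hpn).out
  have hc'top : c ^ (1 / q).toReal ≠ ⊤ := by finiteness
  refine ⟨(c ^ (1 / q).toReal).toNNReal * S, fun u x => ?_⟩
  have hmeas : Measurable fun h => D1p.fn u (x + h) :=
    (D1p.measurable_fn u).comp (measurable_const_add x)
  calc _ ≤ eLpNorm (fun h => D1p.fn u (x + h)) q
          (ProbabilityTheory.cond volume (Metric.ball (0 : E n) δ)) :=
        eLpNorm_le_eLpNorm_of_exponent_le hq1 hmeas.aestronglyMeasurable
    _ ≤ c ^ (1 / q).toReal * eLpNorm (fun h => D1p.fn u (x + h)) q volume := by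
        rw [ProbabilityTheory.cond, eLpNorm_smul_measure_of_ne_top ENNReal.ofReal_ne_top,
          smul_eq_mul]
        gcongr
        exact Measure.restrict_le_self
    _ = c ^ (1 / q).toReal * eLpNorm (D1p.fn u) q volume := by
        congr 1
        exact eLpNorm_comp_measurePreserving (D1p.measurable_fn u).aestronglyMeasurable
          (measurePreserving_add_left volume x)
    _ ≤ c ^ (1 / q).toReal * ENNReal.ofReal (S * D1p.gradNorm u) := by
        gcongr
        refine le_trans (le_of_eq ?_) (ENNReal.ofReal_le_ofReal (hS u))
        rw [Lp.norm_def, ENNReal.ofReal_toReal (Lp.eLpNorm_ne_top _)]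
        rfl
    _ = _ := by
        simp only [NNReal.coe_mul, mul_assoc, ENNReal.ofReal_mul (NNReal.coe_nonneg _),
          ENNReal.ofReal_coe_nnreal, ENNReal.coe_toNNReal hc'top]

theorem D1p.integrable_translate {δ : ℝ} (hδ : 0 < δ) (u : D1p n p hp hpn) (x : E n) :
    Integrable (fun h => D1p.fn u (x + h))
      (ProbabilityTheory.cond volume (Metric.ball (0 : E n) δ)) := by
  obtain ⟨C, hC⟩ := D1p.exists_eLpNorm_translate_le hp hpn hδ
  exact memLp_one_iff_integrable.1 ⟨((D1p.measurable_fn u).comp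
    (measurable_const_add x)).aestronglyMeasurable, (hC u x).trans_lt ENNReal.ofReal_lt_top⟩

theorem ballMean_congr_ae {δ : ℝ} {u v : E n → ℝ} (h : u =ᵐ[volume] v) (x : E n) :
    ballMean δ u x = ballMean δ v x := by
  unfold ballMean
  refine integral_congr_ae ?_
  have h1 : ∀ᵐ y ∂(volume : Measure (E n)), u (x + y) = v (x + y) :=
    (measurePreserving_add_left volume x).quasiMeasurePreserving.ae h
  exact ProbabilityTheory.cond_absolutelyContinuous h1

theorem D1p.exists_ballMean_bound (hp : 1 < p) (hpn : p < n) {δ : ℝ} (hδ : 0 < δ) :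
    ∃ C : NNReal, ∀ (u : D1p n p hp hpn) (x : E n),
      |ballMean δ (D1p.fn u) x| ≤ C * D1p.gradNorm u := by
  obtain ⟨C, hC⟩ := D1p.exists_eLpNorm_translate_le hp hpn hδ
  refine ⟨C, fun u x => ?_⟩
  have h0 : 0 ≤ C * D1p.gradNorm u := by
    unfold D1p.gradNorm
    rw [Lp.norm_def]
    positivity
  rw [← Real.norm_eq_abs, ← toReal_enorm]
  refine ENNReal.toReal_le_of_le_ofReal h0 (le_trans ?_ (hC u x))
  rw [eLpNorm_one_eq_lintegral_enorm]
  exact enorm_integral_le_lintegral_enorm _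

/-- Ball means are bounded linear functionals on `D^{1,p}`. -/
noncomputable def D1p.ballMeanₗ (hp : 1 < p) (hpn : p < n) {δ : ℝ} (hδ : 0 < δ) (x : E n) :
    D1p n p hp hpn →ₗ[ℝ] ℝ where
  toFun u := ballMean δ (D1p.fn u) x
  map_add' u v := by
    rw [ballMean_congr_ae (show D1p.fn (u + v) =ᵐ[volume] fun x => D1p.fn u x + D1p.fn v x from
      Lp.coeFn_add u.1.1 v.1.1) x]
    exact integral_add (D1p.integrable_translate hδ u x) (D1p.integrable_translate hδ v x)
  map_smul' c u := by
    rw [ballMean_congr_ae (D1p.fn_smul c u) x]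
    exact integral_const_mul c _

theorem D1p.lintegral_enorm_ballMean_sub_rpow_le (u : D1p n p hp hpn) {δ : ℝ} (hδ : 0 < δ) :
    ∫⁻ x, ‖ballMean δ (D1p.fn u) x - D1p.fn u x‖ₑ ^ p
      ≤ ENNReal.ofReal δ ^ p * (2 ^ p * ∫⁻ x, ‖D1p.grad u x‖ₑ ^ p) := by
  have hp0 : 0 ≤ p := by linarith
  have hprob := isProbabilityMeasure_cond_ball (n := n) hδ
  have hmu := D1p.measurable_fn u
  set ν := ProbabilityTheory.cond volume (Metric.ball (0 : E n) δ) with hν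
  have hpt : ∀ x, ‖ballMean δ (D1p.fn u) x - D1p.fn u x‖ₑ ^ p
      ≤ ∫⁻ h, ‖D1p.fn u (x + h) - D1p.fn u x‖ₑ ^ p ∂ν := by
    intro x
    have h1 : ballMean δ (D1p.fn u) x - D1p.fn u x
        = ∫ h, (D1p.fn u (x + h) - D1p.fn u x) ∂ν := by
      rw [integral_sub (D1p.integrable_translate hδ u x) (integrable_const _), integral_const]
      simp [ballMean]
    rw [h1]
    refine le_trans ?_ (lintegral_rpow_le_lintegral_rpow ?_ hp)
    · gcongr
      exact enorm_integral_le_lintegral_enorm _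
    · fun_prop
  calc _ ≤ ∫⁻ x, ∫⁻ h, ‖D1p.fn u (x + h) - D1p.fn u x‖ₑ ^ p ∂ν := lintegral_mono hpt
    _ = ∫⁻ h, (∫⁻ x, ‖D1p.fn u (x + h) - D1p.fn u x‖ₑ ^ p) ∂ν := by
        refine lintegral_lintegral_swap ?_
        have h2 : Measurable fun q : E n × E n =>
            ‖D1p.fn u (q.1 + q.2) - D1p.fn u q.1‖ₑ ^ p := by fun_prop
        exact h2.aemeasurable
    _ ≤ ∫⁻ h, ENNReal.ofReal δ ^ p * (2 ^ p * ∫⁻ x, ‖D1p.grad u x‖ₑ ^ p) ∂ν := by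
        refine lintegral_mono_ae ?_
        have hmem : ∀ᵐ h ∂ν, h ∈ Metric.ball (0 : E n) δ :=
          ProbabilityTheory.ae_cond_mem measurableSet_ball
        filter_upwards [hmem] with h hh
        refine (D1p.lintegral_enorm_translate_sub_rpow_le u h).trans ?_
        gcongr
        rw [← ofReal_norm]
        exact ENNReal.ofReal_le_ofReal (by simpa using (mem_ball_zero_iff.1 hh).le)
    _ = _ := by simp

/-- Weakly convergent sequences of `D^{1,p}` with bounded gradients have subsequences converging
almost everywhere: ball means converge pointwise, and they approximate the functions in `Lᵖ`,
uniformly in the sequence. -/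
theorem D1p.exists_subseq_tendsto_ae_zero (u : ℕ → D1p n p hp hpn)
    (hweak : ∀ l : D1p n p hp hpn →ₗ[ℝ] ℝ, (∃ C : ℝ, ∀ w, |l w| ≤ C * D1p.gradNorm w) →
      Tendsto (fun i => l (u i)) atTop (𝓝 0))
    {N : ℝ≥0∞} (hN : N ≠ ⊤) (hu : ∀ i, ∫⁻ x, ‖D1p.grad (u i) x‖ₑ ^ p ≤ N) :
    ∃ σ : ℕ → ℕ, StrictMono σ ∧
      ∀ᵐ x, Tendsto (fun i => D1p.fn (u (σ i)) x) atTop (𝓝 0) := by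
  have hp0 : 0 < p := by linarith
  have hfact := fact_one_le hp
  set μ : Measure (E n) := volume.withDensity fun x => ENNReal.ofReal (bracket (n + 1) x) with hμ
  have hbm : Measurable fun x : E n => ENNReal.ofReal (bracket (n + 1) x) :=
    (continuous_bracket _).measurable.ennreal_ofReal
  have hμle : μ ≤ volume := by
    have h1 : μ ≤ volume.withDensity 1 := by
      refine withDensity_mono (ae_of_all _ fun x => ?_)
      rw [Pi.one_apply, ENNReal.ofReal_le_one, bracket]
      have : (0 : ℝ) ≤ n := n.cast_nonneg
      exact Real.rpow_le_one_of_one_le_of_nonpos (by nlinarith [sq_nonneg ‖x‖]) (by linarith)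
    rwa [withDensity_one] at h1
  have hac : volume ≪ μ := withDensity_absolutelyContinuous' hbm.aemeasurable
    (ae_of_all _ fun x => by
      rw [Ne, ENNReal.ofReal_eq_zero, not_le]; exact bracket_pos _ x)
  have hfin : IsFiniteMeasure μ := by
    refine isFiniteMeasure_withDensity_ofReal ?_
    have := integrable_rpow_neg_one_add_norm_sq (E := E n) (μ := volume) (r := (n : ℝ) + 1)
      (by simp)
    have h2 : (bracket (n + 1) : E n → ℝ) = fun x => (1 + ‖x‖ ^ 2) ^ (-((n : ℝ) + 1) / 2) := by
      ext x
      rw [bracket]; congr 1; ring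
    rw [← h2] at this
    exact this.2
  have hmeas : ∀ i, Measurable (D1p.fn (u i)) := fun i => D1p.measurable_fn _
  obtain ⟨R, hR⟩ : ∃ R : ℝ, ∀ i, D1p.gradNorm (u i) ≤ R := by
    refine ⟨(N ^ (1 / p)).toReal, fun i => ?_⟩
    rw [D1p.gradNorm, Lp.norm_def]
    refine ENNReal.toReal_mono (by finiteness) ?_
    rw [eLpNorm_ofReal_eq hp0]
    gcongr
    exact hu i
  have hsplit : ∀ (i : ℕ) {δ : ℝ}, 0 < δ → ∫⁻ x, ‖D1p.fn (u i) x‖ₑ ^ p ∂μ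
      ≤ 2 ^ p * ((∫⁻ x, ‖ballMean δ (D1p.fn (u i)) x‖ₑ ^ p ∂μ)
        + ENNReal.ofReal δ ^ p * (2 ^ p * N)) := by
    intro i δ hδ
    have hprob := isProbabilityMeasure_cond_ball (n := n) hδ
    have hsm : StronglyMeasurable (ballMean δ (D1p.fn (u i))) := by
      unfold ballMean
      refine StronglyMeasurable.integral_prod_right (f := fun x h => D1p.fn (u i) (x + h)) ?_
      exact ((hmeas i).comp measurable_add).stronglyMeasurable
    have hbmm : Measurable (ballMean δ (D1p.fn (u i))) := hsm.measurable
    calc _ ≤ ∫⁻ x, 2 ^ p * (‖ballMean δ (D1p.fn (u i)) x‖ₑ ^ p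
          + ‖ballMean δ (D1p.fn (u i)) x - D1p.fn (u i) x‖ₑ ^ p) ∂μ := by
          refine lintegral_mono fun x => ?_
          refine le_trans ?_ (ENNReal.add_rpow_le_two_rpow_mul_rpow_add_rpow _ _ hp0.le)
          gcongr
          calc ‖D1p.fn (u i) x‖ₑ = ‖ballMean δ (D1p.fn (u i)) x
                - (ballMean δ (D1p.fn (u i)) x - D1p.fn (u i) x)‖ₑ := by congr 1; abel
            _ ≤ _ := enorm_sub_le
      _ = 2 ^ p * ((∫⁻ x, ‖ballMean δ (D1p.fn (u i)) x‖ₑ ^ p ∂μ)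
          + ∫⁻ x, ‖ballMean δ (D1p.fn (u i)) x - D1p.fn (u i) x‖ₑ ^ p ∂μ) := by
          rw [lintegral_const_mul' _ _ (by finiteness), lintegral_add_left (by fun_prop)]
      _ ≤ _ := by
          gcongr
          refine (lintegral_mono' hμle le_rfl).trans
            ((D1p.lintegral_enorm_ballMean_sub_rpow_le (u i) hδ).trans ?_)
          gcongr
          exact hu i
  have hmean : ∀ {δ : ℝ}, 0 < δ →
      Tendsto (fun i => ∫⁻ x, ‖ballMean δ (D1p.fn (u i)) x‖ₑ ^ p ∂μ) atTop (𝓝 0) := by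
    intro δ hδ
    have hprob := isProbabilityMeasure_cond_ball (n := n) hδ
    obtain ⟨C, hC⟩ := D1p.exists_ballMean_bound hp hpn hδ
    have h0 : ∫⁻ _x : E n, (0 : ℝ≥0∞) ∂μ = 0 := by simp
    rw [← h0]
    refine tendsto_lintegral_of_dominated_convergence
      (fun _ => ENNReal.ofReal (C * R) ^ p) (fun i => ?_) (fun i => ae_of_all _ fun x => ?_) ?_
      (ae_of_all _ fun x => ?_)
    · have hsm : StronglyMeasurable (ballMean δ (D1p.fn (u i))) := by
        unfold ballMean
        refine StronglyMeasurable.integral_prod_right (f := fun x h => D1p.fn (u i) (x + h)) ?_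
        exact ((hmeas i).comp measurable_add).stronglyMeasurable
      have := hsm.measurable
      fun_prop
    · simp only
      gcongr
      rw [← ofReal_norm, Real.norm_eq_abs]
      refine ENNReal.ofReal_le_ofReal ((hC (u i) x).trans ?_)
      gcongr
      exact hR i
    · rw [lintegral_const]
      finiteness
    · have h1 := hweak (D1p.ballMeanₗ hp hpn hδ x) ⟨C, fun w => hC w x⟩
      have h2 := (ENNReal.continuous_rpow_const (y := p)).tendsto 0 |>.comp
        (tendsto_zero_iff_enorm_tendsto_zero.1 h1)
      rwa [ENNReal.zero_rpow_of_pos hp0] at h2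
  have hlim : Tendsto (fun i => ∫⁻ x, ‖D1p.fn (u i) x‖ₑ ^ p ∂μ) atTop (𝓝 0) := by
    rw [ENNReal.tendsto_nhds_zero]
    intro η hη
    -- the ball radius is chosen first, so that the error term is below `η / 2`
    have hδlim : Tendsto (fun j : ℕ => 2 ^ p * (ENNReal.ofReal (1 / ((j : ℝ) + 1)) ^ p *
        (2 ^ p * N))) atTop (𝓝 0) := by
      have h1 : Tendsto (fun j : ℕ => ENNReal.ofReal (1 / ((j : ℝ) + 1)) ^ p) atTop (𝓝 0) := by
        have h2 := (ENNReal.continuous_rpow_const (y := p)).tendsto _ |>.comp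
          (ENNReal.tendsto_ofReal tendsto_one_div_add_atTop_nhds_zero_nat)
        rwa [ENNReal.ofReal_zero, ENNReal.zero_rpow_of_pos hp0] at h2
      have h3 := ENNReal.Tendsto.const_mul (a := 2 ^ p)
        (ENNReal.Tendsto.mul_const (b := 2 ^ p * N) h1 (Or.inr (by finiteness)))
        (Or.inr (by finiteness))
      rwa [zero_mul, mul_zero] at h3
    obtain ⟨j, hj⟩ := ((ENNReal.tendsto_nhds_zero.1 hδlim) (η / 2)
      (ENNReal.half_pos hη.ne')).exists
    have hδ : 0 < 1 / ((j : ℝ) + 1) := by positivity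
    have h4 := ENNReal.Tendsto.const_mul (a := 2 ^ p) (hmean hδ) (Or.inr (by finiteness))
    rw [mul_zero] at h4
    filter_upwards [(ENNReal.tendsto_nhds_zero.1 h4) (η / 2) (ENNReal.half_pos hη.ne')] with i hi
    calc _ ≤ _ := hsplit i hδ
      _ ≤ η / 2 + η / 2 := by rw [mul_add]; exact add_le_add hi hj
      _ = η := ENNReal.add_halves η
  have htm : TendstoInMeasure μ (fun i => D1p.fn (u i)) atTop 0 := by
    refine tendstoInMeasure_of_tendsto_eLpNorm (p := ENNReal.ofReal p) (by simpa using hp0)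
      (fun i => (hmeas i).aestronglyMeasurable) aestronglyMeasurable_const ?_
    simp_rw [eLpNorm_ofReal_eq hp0]
    have h1 := (ENNReal.continuous_rpow_const (y := 1 / p)).tendsto _ |>.comp hlim
    rw [ENNReal.zero_rpow_of_pos (by positivity)] at h1
    simpa [Function.comp_def] using h1
  obtain ⟨σ, hσ, hae⟩ := htm.exists_seq_tendsto_ae
  exact ⟨σ, hσ, hac.ae_le hae⟩

end


/-! ### Comparison of the extremal function with smooth weights -/

section

variable {n k : ℕ} {p a : ℝ}

theorem bracket_rpow (r s : ℝ) (x : E n) : bracket r x ^ s = bracket (r * s) x := by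
  unfold bracket
  rw [← Real.rpow_mul (by positivity)]
  congr 1; ring

theorem lintegral_bracket_rpow_ne_top (hp : 1 < p) (hpn : p < n) :
    ∫⁻ x : E n, ENNReal.ofReal (bracket (((n : ℝ) - p) / (p - 1) + 1) x ^ p) ≠ ⊤ := by
  have h1 : (n : ℝ) < (((n : ℝ) - p) / (p - 1) + 1) * p := by
    have : 0 < p - 1 := by linarith
    rw [div_add_one this.ne', div_mul_eq_mul_div, lt_div_iff₀ this]
    nlinarith
  have h2 := integrable_rpow_neg_one_add_norm_sq (E := E n) (μ := volume)
    (r := (((n : ℝ) - p) / (p - 1) + 1) * p) (by simpa using h1)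
  have h3 : (fun x : E n => bracket (((n : ℝ) - p) / (p - 1) + 1) x ^ p)
      = fun x => (1 + ‖x‖ ^ 2) ^ (-((((n : ℝ) - p) / (p - 1) + 1) * p) / 2) := by
    ext x
    rw [bracket_rpow, bracket]
    congr 1; ring
  rw [← h3] at h2
  rw [← ofReal_integral_eq_lintegral_ofReal h2 (ae_of_all _ fun x =>
    Real.rpow_nonneg (bracket_pos _ _).le _)]
  exact ENNReal.ofReal_ne_top

theorem one_add_norm_sq_le (k : ℕ) (x : E n) :
    1 + ‖x‖ ^ 2 ≤ (1 + normY k x) ^ 2 + normZ k x ^ 2 := by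
  nlinarith [normY_sq_add_normZ_sq k x, normY_nonneg k x]

theorem le_two_mul_one_add_norm_sq (k : ℕ) (x : E n) :
    (1 + normY k x) ^ 2 + normZ k x ^ 2 ≤ 2 * (1 + ‖x‖ ^ 2) := by
  nlinarith [normY_sq_add_normZ_sq k x, sq_nonneg (1 - normY k x), sq_nonneg (normZ k x)]

theorem extremal_eq (x : E n) : extremal n k p a x
    = a * ((1 + normY k x) ^ 2 + normZ k x ^ 2) ^ (-((((n : ℝ) - p) / (p - 1)) / 2)) := by
  unfold extremal
  congr 3
  rw [div_div, mul_comm 2]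

theorem extremal_pos (ha : 0 < a) (x : E n) : 0 < extremal n k p a x := by
  have := one_add_norm_sq_le k x
  have : 0 < (1 + normY k x) ^ 2 + normZ k x ^ 2 := by nlinarith [sq_nonneg ‖x‖]
  unfold extremal
  positivity

theorem continuous_extremal : Continuous (extremal n k p a) := by
  have h1 := continuous_normY (n := n) k
  have h2 := continuous_normZ (n := n) k
  unfold extremal
  refine continuous_const.mul (Continuous.rpow_const (by fun_prop) fun x => Or.inl ?_)
  have := one_add_norm_sq_le k x
  nlinarith [sq_nonneg ‖x‖]

theorem extremal_le (hp : 1 < p) (hpn : p < n) (ha : 0 < a) (x : E n) :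
    extremal n k p a x ≤ a * bracket (((n : ℝ) - p) / (p - 1)) x := by
  have hγ : 0 < ((n : ℝ) - p) / (p - 1) := div_pos (by linarith) (by linarith)
  rw [extremal_eq]
  unfold bracket
  refine mul_le_mul_of_nonneg_left ?_ ha.le
  exact Real.rpow_le_rpow_of_nonpos (by positivity) (one_add_norm_sq_le k x) (by linarith)

theorem le_extremal (hp : 1 < p) (hpn : p < n) (ha : 0 < a) (x : E n) :
    a * 2 ^ (-((((n : ℝ) - p) / (p - 1)) / 2)) * bracket (((n : ℝ) - p) / (p - 1)) x
      ≤ extremal n k p a x := by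
  have hγ : 0 < ((n : ℝ) - p) / (p - 1) := div_pos (by linarith) (by linarith)
  have h1 := one_add_norm_sq_le k x
  have : 0 < (1 + normY k x) ^ 2 + normZ k x ^ 2 := by nlinarith [sq_nonneg ‖x‖]
  rw [extremal_eq, mul_assoc]
  unfold bracket
  rw [← Real.mul_rpow (by norm_num) (by positivity)]
  refine mul_le_mul_of_nonneg_left ?_ ha.le
  exact Real.rpow_le_rpow_of_nonpos this (le_two_mul_one_add_norm_sq k x) (by linarith)

theorem partY_sub (k : ℕ) (x x' : E n) : partY k (x - x') = partY k x - partY k x' := by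
  ext i
  simp only [partY_apply, PiLp.sub_apply]
  split_ifs <;> simp

theorem normZ_eq_norm (k : ℕ) (x : E n) : normZ k x = ‖x - partY k x‖ := by
  rw [EuclideanSpace.norm_eq, normZ, Finset.sum_filter]
  congr 1
  refine Finset.sum_congr rfl fun i _ => ?_
  rw [PiLp.sub_apply, partY_apply]
  by_cases h : (i : ℕ) < k
  · simp [h]
  · simp [h, not_lt.1 h]

/-- The function `√((1 + |y|)² + |z|²)` is `1`-Lipschitz. -/
theorem abs_sqrt_sub_sqrt_le (k : ℕ) (x x' : E n) :
    |√((1 + normY k x) ^ 2 + normZ k x ^ 2) - √((1 + normY k x') ^ 2 + normZ k x' ^ 2)|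
      ≤ ‖x - x'‖ := by
  have key : ∀ s t : ℝ, √(s ^ 2 + t ^ 2) = ‖(⟨s, t⟩ : ℂ)‖ := by
    intro s t
    rw [Complex.norm_def, Complex.normSq_mk]
    congr 1; ring
  rw [key, key]
  refine (abs_norm_sub_norm_le _ _).trans ?_
  have e1 : |normY k x - normY k x'| ≤ normY k (x - x') := by
    rw [← norm_partY, ← norm_partY, ← norm_partY, partY_sub]
    exact abs_norm_sub_norm_le _ _
  have e2 : |normZ k x - normZ k x'| ≤ normZ k (x - x') := by
    rw [normZ_eq_norm, normZ_eq_norm, normZ_eq_norm, partY_sub,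
      show x - x' - (partY k x - partY k x') = (x - partY k x) - (x' - partY k x') by abel]
    exact abs_norm_sub_norm_le _ _
  have e3 : (⟨1 + normY k x, normZ k x⟩ - ⟨1 + normY k x', normZ k x'⟩ : ℂ)
      = ⟨normY k x - normY k x', normZ k x - normZ k x'⟩ := by
    apply Complex.ext <;> simp
  rw [e3, ← key]
  refine Real.sqrt_le_iff.2 ⟨norm_nonneg _, ?_⟩
  rw [← normY_sq_add_normZ_sq k]
  exact add_le_add (sq_le_sq' (by linarith [abs_le.1 e1]) (by linarith [abs_le.1 e1]))
    (sq_le_sq' (by linarith [abs_le.1 e2]) (by linarith [abs_le.1 e2]))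

/-- The bound `|Dv| ≤ C (1 + |x|²)^{-(γ+1)/2}`. It holds also at points of `{y = 0}`, where `v` is
not differentiable, since it follows from a local Lipschitz bound. -/
theorem norm_gradient_extremal_le (hp : 1 < p) (hpn : p < n) (ha : 0 < a) (x : E n) :
    ‖gradient (extremal n k p a) x‖
      ≤ a * (((n : ℝ) - p) / (p - 1) + 1) * bracket (((n : ℝ) - p) / (p - 1) + 1) x := by
  set γ := ((n : ℝ) - p) / (p - 1) with hγ
  have hγ0 : 0 < γ := div_pos (by linarith) (by linarith)
  have hQ : ∀ x : E n, 0 < (1 + normY k x) ^ 2 + normZ k x ^ 2 := fun x => by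
    nlinarith [sq_nonneg ‖x‖, one_add_norm_sq_le k x]
  set ρ : E n → ℝ := fun x => √((1 + normY k x) ^ 2 + normZ k x ^ 2) with hρ
  have hρ0 : ∀ x, 0 < ρ x := fun x => Real.sqrt_pos.2 (hQ x)
  have hv : ∀ x, extremal n k p a x = a * ρ x ^ (-γ) := by
    intro x
    rw [extremal_eq, hρ, ← hγ]
    simp only
    rw [Real.sqrt_eq_rpow, ← Real.rpow_mul (hQ x).le]
    congr 2; ring
  have hρb : ρ x ^ (-γ - 1) ≤ bracket (γ + 1) x := by
    rw [hρ, bracket]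
    simp only
    rw [Real.sqrt_eq_rpow, ← Real.rpow_mul (hQ x).le,
      show 1 / 2 * (-γ - 1) = -((γ + 1) / 2) by ring]
    exact Real.rpow_le_rpow_of_nonpos (by positivity) (one_add_norm_sq_le k x) (by linarith)
  have hd := Real.hasStrictDerivAt_rpow_const (x := ρ x) (p := -γ) (Or.inl (hρ0 x).ne')
  have hb := bracket_pos (γ + 1) x
  have hρp : 0 < ρ x ^ (-γ - 1) := Real.rpow_pos_of_pos (hρ0 x) _
  obtain ⟨s, hs, hlip⟩ := hd.hasStrictFDerivAt.exists_lipschitzOnWith_of_nnnorm_lt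
    (Real.toNNReal ((γ + 1) * ρ x ^ (-γ - 1))) (by
      rw [← NNReal.coe_lt_coe, Real.coe_toNNReal _ (by positivity), coe_nnnorm,
        ContinuousLinearMap.norm_toSpanSingleton, Real.norm_eq_abs, abs_mul, abs_neg,
        abs_of_pos hγ0, abs_of_pos hρp]
      nlinarith)
  have hρc : Continuous ρ := by
    have h1 := continuous_normY (n := n) k
    have h2 := continuous_normZ (n := n) k
    fun_prop
  rw [norm_gradient]
  refine norm_fderiv_le_of_lip' ℝ (by positivity) ?_
  filter_upwards [hρc.continuousAt.preimage_mem_nhds hs] with x' hx'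
  have h1 := hlip.dist_le_mul _ hx' _ (mem_of_mem_nhds hs)
  rw [Real.dist_eq, Real.dist_eq, Real.coe_toNNReal _ (by positivity)] at h1
  rw [hv, hv, Real.norm_eq_abs, ← mul_sub, abs_mul, abs_of_pos ha, mul_assoc, mul_assoc]
  refine mul_le_mul_of_nonneg_left (h1.trans ?_) ha.le
  rw [← mul_assoc]
  gcongr
  exact abs_sqrt_sub_sqrt_le k x' x

/-- The energy of the statement controls the Orlicz energy with a smooth weight. -/
theorem exists_orlicz_energy_le (k : ℕ) (hp : 1 < p) (hp2 : p < 2) (hpn : p < n) (ha : 0 < a) :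
    ∃ B : ℝ, 0 ≤ B ∧ ∀ (x : E n) (e t : ℝ), 0 < e → 0 ≤ t →
      orlicz p (bracket (((n : ℝ) - p) / (p - 1) + 1) x) (e * t)
        ≤ e ^ 2 * B * ((‖gradient (extremal n k p a) x‖ + e * t) ^ (p - 2) * t ^ 2) := by
  set γ := ((n : ℝ) - p) / (p - 1) with hγ
  have hγ0 : 0 < γ := div_pos (by linarith) (by linarith)
  set c := max (a * (γ + 1)) 1 with hc
  have hc0 : 0 < c := lt_of_lt_of_le one_pos (le_max_right _ _)
  refine ⟨(2 * c ^ 2) ^ ((2 - p) / 2), by positivity, fun x e t he ht => ?_⟩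
  rcases ht.eq_or_lt with rfl | ht
  · simp
  set m := bracket (γ + 1) x
  have hm : 0 < m := bracket_pos _ _
  have hg := norm_gradient_extremal_le (k := k) hp hpn ha x
  set S := ‖gradient (extremal n k p a) x‖ + e * t with hS
  have het : 0 < e * t := mul_pos he ht
  have hS0 : 0 < S := add_pos_of_nonneg_of_pos (norm_nonneg _) het
  have h1 : S ≤ c * (m + e * t) := by
    have h2 : a * (γ + 1) * m ≤ c * m := mul_le_mul_of_nonneg_right (le_max_left _ _) hm.le
    have h3 : 1 * (e * t) ≤ c * (e * t) := mul_le_mul_of_nonneg_right (le_max_right _ _) het.le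
    have h4 : ‖gradient (extremal n k p a) x‖ ≤ a * (γ + 1) * m := hg
    rw [hS]; linarith
  have h2 : S ^ 2 / (2 * c ^ 2) ≤ m ^ 2 + (e * t) ^ 2 := by
    rw [div_le_iff₀ (by positivity)]
    calc S ^ 2 ≤ (c * (m + e * t)) ^ 2 := by gcongr
      _ = c ^ 2 * (m + e * t) ^ 2 := by ring
      _ ≤ c ^ 2 * (2 * (m ^ 2 + (e * t) ^ 2)) := by
        gcongr
        nlinarith [sq_nonneg (m - e * t)]
      _ = _ := by ring
  have h3 : (m ^ 2 + (e * t) ^ 2) ^ ((p - 2) / 2)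
      ≤ (2 * c ^ 2) ^ ((2 - p) / 2) * S ^ (p - 2) := by
    refine (Real.rpow_le_rpow_of_nonpos (by positivity) h2 (by linarith)).trans (le_of_eq ?_)
    rw [Real.div_rpow (by positivity) (by positivity), ← Real.rpow_natCast S 2,
      ← Real.rpow_mul hS0.le, show (2 - p) / 2 = -((p - 2) / 2) by ring,
      Real.rpow_neg (by positivity), div_eq_inv_mul]
    congr 2; push_cast; ring
  unfold orlicz
  calc _ ≤ ((2 * c ^ 2) ^ ((2 - p) / 2) * S ^ (p - 2)) * (e * t) ^ 2 := by gcongr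
    _ = _ := by ring

end

/-! ### Tightness of the weighted densities -/

/-- Dominated convergence up to small remainders. -/
theorem tendsto_lintegral_of_dominated_add_small {α : Type*} [MeasurableSpace α] {μ : Measure α}
    {F : ℕ → α → ℝ≥0∞} {F₀ : α → ℝ≥0∞} (hF : ∀ i, AEMeasurable (F i) μ)
    (hlim : ∀ᵐ x ∂μ, Tendsto (fun i => F i x) atTop (𝓝 (F₀ x)))
    (h : ∀ η : ℝ≥0∞, 0 < η → ∃ (D : α → ℝ≥0∞) (R : ℕ → α → ℝ≥0∞), AEMeasurable D μ ∧
      ∫⁻ x, D x ∂μ ≠ ⊤ ∧ (∀ i, ∀ᵐ x ∂μ, F i x ≤ R i x + D x) ∧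
      ∀ᶠ i in atTop, ∫⁻ x, R i x ∂μ ≤ η) :
    Tendsto (fun i => ∫⁻ x, F i x ∂μ) atTop (𝓝 (∫⁻ x, F₀ x ∂μ)) ∧ ∫⁻ x, F₀ x ∂μ ≠ ⊤ := by
  have hfatou : ∫⁻ x, F₀ x ∂μ ≤ liminf (fun i => ∫⁻ x, F i x ∂μ) atTop :=
    calc _ ≤ ∫⁻ x, liminf (fun i => F i x) atTop ∂μ :=
          lintegral_mono_ae (hlim.mono fun x hx => hx.liminf_eq.ge)
      _ ≤ _ := lintegral_liminf_le' hF
  have hmin : ∀ η : ℝ≥0∞, 0 < η →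
      ∃ b : ℕ → ℝ≥0∞, ∃ L : ℝ≥0∞, L ≠ ⊤ ∧ L ≤ ∫⁻ x, F₀ x ∂μ ∧ Tendsto b atTop (𝓝 L) ∧
        ∀ᶠ i in atTop, ∫⁻ x, F i x ∂μ ≤ η + b i := by
    intro η hη
    obtain ⟨D, R, hD, hDtop, hle, hR⟩ := h η hη
    refine ⟨fun i => ∫⁻ x, min (F i x) (D x) ∂μ, ∫⁻ x, min (F₀ x) (D x) ∂μ,
      ((lintegral_mono fun x => min_le_right _ _).trans_lt hDtop.lt_top).ne,
      lintegral_mono fun x => min_le_left _ _, ?_, ?_⟩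
    · refine tendsto_lintegral_of_dominated_convergence' D (fun i => (hF i).min hD)
        (fun i => ae_of_all _ fun x => min_le_right _ _) hDtop ?_
      filter_upwards [hlim] with x hx
      exact hx.min tendsto_const_nhds
    · filter_upwards [hR] with i hi
      calc ∫⁻ x, F i x ∂μ ≤ ∫⁻ x, (R i x + min (F i x) (D x)) ∂μ := by
            refine lintegral_mono_ae ?_
            filter_upwards [hle i] with x hx
            rcases le_total (F i x) (D x) with h1 | h1
            · rw [min_eq_left h1]; exact le_add_self
            · rw [min_eq_right h1]; exact hx
        _ = ∫⁻ x, R i x ∂μ + ∫⁻ x, min (F i x) (D x) ∂μ := lintegral_add_right' _ ((hF i).min hD)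
        _ ≤ _ := by gcongr
  have hlimsup : ∀ η : ℝ≥0∞, 0 < η → ∃ L : ℝ≥0∞, L ≠ ⊤ ∧ L ≤ ∫⁻ x, F₀ x ∂μ ∧
      limsup (fun i => ∫⁻ x, F i x ∂μ) atTop ≤ η + L := by
    intro η hη
    obtain ⟨b, L, hL, hLF, hb, hFb⟩ := hmin η hη
    refine ⟨L, hL, hLF, ?_⟩
    calc _ ≤ limsup (fun i => η + b i) atTop := limsup_le_limsup hFb
      _ = η + L := (hb.const_add η).limsup_eq
  have hls : liminf (fun i => ∫⁻ x, F i x ∂μ) atTop ≤ limsup (fun i => ∫⁻ x, F i x ∂μ) atTop :=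
    liminf_le_limsup
  have hfin : ∫⁻ x, F₀ x ∂μ ≠ ⊤ := by
    obtain ⟨L, hL, -, hle⟩ := hlimsup 1 one_pos
    exact ((hfatou.trans (hls.trans hle)).trans_lt (by finiteness)).ne
  refine ⟨tendsto_of_le_liminf_of_limsup_le hfatou ?_, hfin⟩
  refine ENNReal.le_of_forall_pos_le_add fun η hη _ => ?_
  obtain ⟨L, -, hL, hle⟩ := hlimsup η (by simpa using hη)
  exact (hle.trans (add_le_add_right hL _)).trans (add_comm _ _).le

section

variable {n k : ℕ} {p : ℝ}

theorem inv_le_rpow_of_one_le {Y c s : ℝ} (hY : 0 < Y) (hs : 0 < s) (h : 1 ≤ c * Y ^ s) :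
    Y⁻¹ ≤ c ^ (1 / s) := by
  have hYs : 0 < Y ^ s := Real.rpow_pos_of_pos hY s
  have h1 : (Y⁻¹) ^ s ≤ c := by
    rw [Real.inv_rpow hY.le, inv_le_iff_one_le_mul₀ hYs]
    exact h
  calc Y⁻¹ = ((Y⁻¹) ^ s) ^ (1 / s) := by
        rw [← Real.rpow_mul (by positivity), mul_one_div_cancel hs.ne', Real.rpow_one]
    _ ≤ _ := by gcongr

theorem inv_mul_le_of_mul_rpow_le {Y b η K : ℝ} (hY : 0 < Y) (hK : 0 ≤ K)
    (hb : b * Y ^ (p - 1) ≤ η) : Y⁻¹ * b * K ≤ η * (Y ^ (-p) * K) := by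
  have h1 : Y⁻¹ = Y ^ (-p) * Y ^ (p - 1) := by
    rw [← Real.rpow_add hY, ← Real.rpow_neg_one]; congr 1; ring
  calc Y⁻¹ * b * K = (b * Y ^ (p - 1)) * (Y ^ (-p) * K) := by rw [h1]; ring
    _ ≤ _ := by gcongr

/-- Where the weight `Y⁻¹ T`, with `T ≤ c X⁻ᵖ` and `Y ≤ X`, is not small compared with `Y⁻ᵖ`, both
`X` and `Y⁻¹` are bounded, and Young's inequality applies. -/
theorem inv_mul_le_or_of_le_rpow (hp : 1 < p) {X Y T K c r η : ℝ} (hη : 0 < η) (hX : 1 ≤ X)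
    (hY : 0 < Y) (hYX : Y ≤ X) (hK : 0 ≤ K) (hc : 0 < c) (hT : T ≤ c * X ^ (-p)) (hr : 1 < r) :
    Y⁻¹ * T * K ≤ η * (Y ^ (-p) * K) ∨ X < c / η ∧
      Y⁻¹ * T * K ≤ η * K ^ r + c * (c / η) ^ (1 / (p - 1)) *
        (c * (c / η) ^ (1 / (p - 1)) / η) ^ (1 / (r - 1)) := by
  have hp1 : 0 < p - 1 := by linarith
  have hr1 : 0 < r - 1 := by linarith
  have hX0 : 0 < X := by linarith
  by_cases hs : c * X ^ (-p) * Y ^ (p - 1) ≤ η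
  · refine Or.inl (le_trans ?_ (inv_mul_le_of_mul_rpow_le hY hK hs))
    gcongr
  push Not at hs
  refine Or.inr ⟨?_, ?_⟩
  · rw [lt_div_iff₀ hη, mul_comm, ← lt_div_iff₀ hX0, div_eq_mul_inv]
    calc η < c * X ^ (-p) * Y ^ (p - 1) := hs
      _ ≤ c * X ^ (-p) * X ^ (p - 1) := by gcongr
      _ = c * X⁻¹ := by
        rw [mul_assoc, ← Real.rpow_add hX0, ← Real.rpow_neg_one]; congr 2; ring
  have hXp : X ^ (-p) ≤ 1 := Real.rpow_le_one_of_one_le_of_nonpos hX (by linarith)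
  have hYinv : Y⁻¹ ≤ (c / η) ^ (1 / (p - 1)) := by
    refine inv_le_rpow_of_one_le hY hp1 ?_
    rw [div_mul_eq_mul_div, one_le_div hη]
    calc η ≤ c * X ^ (-p) * Y ^ (p - 1) := hs.le
      _ ≤ c * 1 * Y ^ (p - 1) := by gcongr
      _ = _ := by ring
  set A : ℝ := (c / η) ^ (1 / (p - 1))
  have hA : 0 < A := by positivity
  set L : ℝ := (c * A / η) ^ (1 / (r - 1)) with hL
  have hL0 : 0 < L := by positivity
  have h5 : Y⁻¹ * T * K ≤ c * A * K := by
    calc _ ≤ Y⁻¹ * (c * X ^ (-p)) * K := by gcongr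
      _ ≤ A * (c * 1) * K := by gcongr
      _ = _ := by ring
  refine h5.trans ?_
  rcases le_total K L with h | h
  · have h6 : c * A * K ≤ c * A * L := by gcongr
    have h7 : 0 ≤ η * K ^ r := by positivity
    linarith
  · have hKpos : 0 < K := hL0.trans_le h
    have h7 : c * A / η ≤ K ^ (r - 1) := by
      calc c * A / η = L ^ (r - 1) := by
            rw [hL, ← Real.rpow_mul (by positivity), one_div_mul_cancel hr1.ne', Real.rpow_one]
        _ ≤ _ := by gcongr
    rw [div_le_iff₀ hη] at h7
    have h8 : K ^ r = K ^ (r - 1) * K := by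
      rw [← Real.rpow_add_one hKpos.ne']; congr 1; ring
    have h9 : c * A * K ≤ K ^ (r - 1) * η * K := by gcongr
    have h10 : 0 ≤ c * A * L := by positivity
    rw [h8]
    linarith

/-- Where `|t| > w` and the weight `Y⁻¹ (w² + t²)^{βp/2}` is not small compared with `Y⁻ᵖ`, it is
bounded by a power of the Orlicz function. -/
theorem inv_mul_le_of_lt_abs (hp : 1 < p) (hp2 : p < 2) {Y w t β m η : ℝ} (hη : 0 < η)
    (hβ : 0 < β) (hY : 0 < Y) (hw : 0 < w) (hm : 0 ≤ m) (ht : w < |t|) :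
    Y⁻¹ * (w ^ 2 + t ^ 2) ^ (β * p / 2) * (m * orlicz p w t) ≤
      η * (Y ^ (-p) * (m * orlicz p w t)) + 2 ^ (β * p / 2) * 2 ^ β *
        (2 ^ (β * p / 2) * 2 ^ β / η) ^ (1 / (p - 1)) *
          (m * orlicz p w t ^ (β * (1 / (p - 1)) + β + 1)) := by
  have hp1 : 0 < p - 1 := by linarith
  have ht0 : 0 < |t| := hw.trans ht
  have hJt : |t| ^ p ≤ 2 * orlicz p w t := by
    have := rpow_le_orlicz hp hp2 hw.le ht0 ht.le
    rwa [orlicz_abs] at this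
  have hJ : 0 < orlicz p w t := by
    have : 0 < |t| ^ p := Real.rpow_pos_of_pos ht0 p
    linarith
  have hpow : (w ^ 2 + t ^ 2) ^ (β * p / 2) ≤ 2 ^ (β * p / 2) * 2 ^ β * orlicz p w t ^ β := by
    calc _ ≤ (2 * |t| ^ 2) ^ (β * p / 2) := by
          gcongr
          have h1 : w ^ 2 ≤ |t| ^ 2 := by gcongr
          have h2 := sq_abs t
          linarith
      _ = 2 ^ (β * p / 2) * (|t| ^ p) ^ β := by
          rw [Real.mul_rpow (by norm_num) (by positivity), ← Real.rpow_natCast |t| 2,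
            ← Real.rpow_mul ht0.le, ← Real.rpow_mul ht0.le]
          congr 2; push_cast; ring
      _ ≤ 2 ^ (β * p / 2) * (2 * orlicz p w t) ^ β := by gcongr
      _ = _ := by rw [Real.mul_rpow (by norm_num) hJ.le, mul_assoc]
  generalize orlicz p w t = J at *
  generalize (w ^ 2 + t ^ 2) ^ (β * p / 2) = T at *
  have hc : (0 : ℝ) < 2 ^ (β * p / 2) * 2 ^ β := by positivity
  generalize (2 : ℝ) ^ (β * p / 2) * 2 ^ β = c at *
  have n1 : 0 ≤ η * (Y ^ (-p) * (m * J)) := by positivity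
  have n2 : 0 ≤ c * (c / η) ^ (1 / (p - 1)) * (m * J ^ (β * (1 / (p - 1)) + β + 1)) := by
    positivity
  have hT : Y⁻¹ * T * (m * J) ≤ Y⁻¹ * (c * J ^ β) * (m * J) := by gcongr
  by_cases hs : c * J ^ β * Y ^ (p - 1) ≤ η
  · have h1 := inv_mul_le_of_mul_rpow_le (K := m * J) hY (by positivity) hs
    linarith
  push Not at hs
  have hYinv : Y⁻¹ ≤ (c * J ^ β / η) ^ (1 / (p - 1)) := by
    refine inv_le_rpow_of_one_le hY hp1 ?_
    rw [div_mul_eq_mul_div, one_le_div hη]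
    exact hs.le
  have h3 : (c * J ^ β / η) ^ (1 / (p - 1)) = (c / η) ^ (1 / (p - 1)) * J ^ (β * (1 / (p - 1))) := by
    rw [mul_div_right_comm, Real.mul_rpow (by positivity) (by positivity), ← Real.rpow_mul hJ.le]
  have h4 : Y⁻¹ * (c * J ^ β) * (m * J)
      ≤ c * (c / η) ^ (1 / (p - 1)) * (m * J ^ (β * (1 / (p - 1)) + β + 1)) := by
    calc _ ≤ ((c / η) ^ (1 / (p - 1)) * J ^ (β * (1 / (p - 1)))) * (c * J ^ β) * (m * J) := by
          rw [← h3]; gcongr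
      _ = c * (c / η) ^ (1 / (p - 1)) * (m * (J ^ (β * (1 / (p - 1))) * J ^ β * J)) := by ring
      _ = _ := by rw [← Real.rpow_add hJ, ← Real.rpow_add_one hJ.ne']
  linarith

/-- The weighted density `|y|⁻¹ (w² + e²t²)^{(q-2)/2} t²` is a small multiple of the densities of
the Orlicz–Hardy and Orlicz–Sobolev inequalities, up to a term that is small with `e` and a bounded
term supported in a ball. Here `|y|^{p-1} (1+|x|²)^{-p/2}` is small near `{y = 0}` and at infinity,
which gives the ball, and `(q - 1)/(p - 1) = n/(n - p)` gives the exponent of the term in `e`. -/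
theorem exists_weighted_density_bound (k : ℕ) (hp : 1 < p) (hp2 : p < 2) (hpn : p < n) {η : ℝ}
    (hη : 0 < η) :
    ∃ A D R : ℝ, 0 ≤ A ∧ 0 ≤ D ∧ ∀ (x : E n) (e t : ℝ), 0 < e →
      (normY k x)⁻¹ * (bracket (((n : ℝ) - p) / (p - 1)) x ^ 2 + (e * t) ^ 2) ^
          ((weightExp n p - 2) / 2) * t ^ 2
        ≤ η * (normY k x ^ (-p) * ((e ^ 2)⁻¹ *
            orlicz p (bracket (((n : ℝ) - p) / (p - 1)) x) (e * t)))
          + A * ((e ^ 2)⁻¹ *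
            orlicz p (bracket (((n : ℝ) - p) / (p - 1)) x) (e * t) ^ ((n : ℝ) / (n - p)))
          + η * ((e ^ 2)⁻¹ *
            orlicz p (bracket (((n : ℝ) - p) / (p - 1)) x) (e * t)) ^ ((n : ℝ) / (n - p))
          + (Metric.ball (0 : E n) R).indicator (fun _ => D) x := by
  have hnp : 0 < (n : ℝ) - p := by linarith
  have hp1 : 0 < p - 1 := by linarith
  have hp0 : 0 < p := by linarith
  obtain ⟨β, hβ⟩ : ∃ β, β = (weightExp n p - p) / p := ⟨_, rfl⟩
  have hβ' : β = (p - 1) / (n - p) := by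
    rw [hβ, weightExp]; field_simp; ring
  have hβ0 : 0 < β := by rw [hβ']; positivity
  have hγβ : ((n : ℝ) - p) / (p - 1) * (β * p) = p := by rw [hβ']; field_simp
  have hβr : β * (1 / (p - 1)) + β + 1 = n / (n - p) := by
    rw [hβ']; field_simp; ring
  have hr1 : 1 < (n : ℝ) / (n - p) := by rw [lt_div_iff₀ hnp]; linarith
  have hexp : (weightExp n p - 2) / 2 = β * p / 2 + (p - 2) / 2 := by
    rw [hβ]; field_simp; ring
  obtain ⟨c, hc⟩ : ∃ c : ℝ, c = 2 ^ (β * p / 2) := ⟨_, rfl⟩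
  have hc0 : 0 < c := by rw [hc]; positivity
  obtain ⟨D, hD⟩ : ∃ D : ℝ, D = c * (c / η) ^ (1 / (p - 1)) *
        (c * (c / η) ^ (1 / (p - 1)) / η) ^ (1 / ((n : ℝ) / (n - p) - 1)) := ⟨_, rfl⟩
  have hD0 : 0 ≤ D := by rw [hD]; positivity
  obtain ⟨A, hA⟩ : ∃ A : ℝ, A = 2 ^ (β * p / 2) * 2 ^ β *
        (2 ^ (β * p / 2) * 2 ^ β / η) ^ (1 / (p - 1)) := ⟨_, rfl⟩
  have hA0 : 0 ≤ A := by rw [hA]; positivity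
  refine ⟨A, D, c / η, hA0, hD0, fun x e t he => ?_⟩
  have hind : 0 ≤ (Metric.ball (0 : E n) (c / η)).indicator (fun _ => D) x :=
    Set.indicator_nonneg (fun _ _ => hD0) _
  have hw : 0 < bracket (((n : ℝ) - p) / (p - 1)) x := bracket_pos _ x
  have hX0 : (0 : ℝ) < 1 + ‖x‖ ^ 2 := by positivity
  have hwX : (bracket (((n : ℝ) - p) / (p - 1)) x ^ 2) ^ (β * p / 2) = √(1 + ‖x‖ ^ 2) ^ (-p) := by
    rw [← Real.rpow_natCast _ 2, ← Real.rpow_mul hw.le, bracket_rpow,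
      show ((n : ℝ) - p) / (p - 1) * ((2 : ℕ) * (β * p / 2)) = p by
        push_cast; linear_combination hγβ, bracket, Real.sqrt_eq_rpow, ← Real.rpow_mul hX0.le]
    congr 1; ring
  generalize bracket (((n : ℝ) - p) / (p - 1)) x = w at *
  have hJ : 0 ≤ orlicz p w (e * t) := orlicz_nonneg _ _ _
  have hE : 0 ≤ (e ^ 2)⁻¹ := by positivity
  rcases (normY_nonneg k x).eq_or_lt with hY | hY
  -- on `{y = 0}` the left side is zero, since `0⁻¹ = 0`
  · rw [← hY, inv_zero, zero_mul, zero_mul]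
    positivity
  have hT : (normY k x)⁻¹ * (w ^ 2 + (e * t) ^ 2) ^ ((weightExp n p - 2) / 2) * t ^ 2
      = (normY k x)⁻¹ * (w ^ 2 + (e * t) ^ 2) ^ (β * p / 2) * ((e ^ 2)⁻¹ * orlicz p w (e * t)) := by
    rw [orlicz, hexp, Real.rpow_add (by positivity)]
    field_simp
  rw [hT]
  have n1 : 0 ≤ η * (normY k x ^ (-p) * ((e ^ 2)⁻¹ * orlicz p w (e * t))) := by positivity
  have n2 : 0 ≤ A * ((e ^ 2)⁻¹ * orlicz p w (e * t) ^ ((n : ℝ) / (n - p))) := by positivity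
  have n3 : 0 ≤ η * ((e ^ 2)⁻¹ * orlicz p w (e * t)) ^ ((n : ℝ) / (n - p)) := by positivity
  rcases le_or_gt |e * t| w with hcase | hcase
  · have hpow : (w ^ 2 + (e * t) ^ 2) ^ (β * p / 2) ≤ c * √(1 + ‖x‖ ^ 2) ^ (-p) := by
      calc _ ≤ (2 * w ^ 2) ^ (β * p / 2) := by
            gcongr
            have : (e * t) ^ 2 ≤ w ^ 2 := by rw [← sq_abs]; gcongr
            linarith
        _ = _ := by rw [Real.mul_rpow (by norm_num) (by positivity), hwX, hc]
    have hYX : normY k x ≤ √(1 + ‖x‖ ^ 2) := Real.le_sqrt_of_sq_le (by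
      nlinarith [normY_sq_add_normZ_sq k x, sq_nonneg (normZ k x)])
    have hX1 : 1 ≤ √(1 + ‖x‖ ^ 2) := Real.one_le_sqrt.2 (by nlinarith [sq_nonneg ‖x‖])
    rcases inv_mul_le_or_of_le_rpow hp hη hX1 hY hYX (mul_nonneg hE hJ) hc0 hpow hr1 with h | ⟨h, h'⟩
    · linarith
    · have hball : x ∈ Metric.ball (0 : E n) (c / η) := by
        rw [mem_ball_zero_iff]
        exact (Real.le_sqrt_of_sq_le (by linarith)).trans_lt h
      rw [Set.indicator_of_mem hball]
      rw [← hD] at h'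
      linarith
  · have h := inv_mul_le_of_lt_abs hp hp2 hη hβ0 hY hw hE hcase
    rw [hβr, ← hA] at h
    linarith

end


/-! ### Convergence of the weighted integrals -/

theorem lintegral_ofReal_const_mul {α : Type*} [MeasurableSpace α] {μ : Measure α} {c : ℝ}
    (hc : 0 ≤ c) (f : α → ℝ) :
    ∫⁻ x, ENNReal.ofReal (c * f x) ∂μ = ENNReal.ofReal c * ∫⁻ x, ENNReal.ofReal (f x) ∂μ := by
  simp_rw [ENNReal.ofReal_mul hc]
  exact lintegral_const_mul' _ _ ENNReal.ofReal_ne_top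

theorem add_mul_abs_rpow_div_le {v w s a b c q : ℝ} (hw : 0 < w) (hb : 0 < b) (hv : b * w ≤ v)
    (hv' : v ≤ a * w) (hc : 0 ≤ c) (hq : 0 ≤ q) :
    (v + c * |s|) ^ q / (v ^ 2 + s ^ 2)
      ≤ (2 * (a ^ 2 + c ^ 2)) ^ (q / 2) / min (b ^ 2) 1 * (w ^ 2 + s ^ 2) ^ ((q - 2) / 2) := by
  have hv0 : 0 < v := lt_of_lt_of_le (by positivity) hv
  have hQ : 0 < w ^ 2 + s ^ 2 := by positivity
  have hm : 0 < min (b ^ 2) 1 := lt_min (by positivity) one_pos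
  have hvs : 0 ≤ v + c * |s| := by positivity
  have h1 : (v + c * |s|) ^ 2 ≤ 2 * (a ^ 2 + c ^ 2) * (w ^ 2 + s ^ 2) := by
    have e1 : v ^ 2 ≤ a ^ 2 * w ^ 2 := by rw [← mul_pow]; gcongr
    have e2 : 0 ≤ a ^ 2 * s ^ 2 + c ^ 2 * w ^ 2 := by positivity
    have e3 := sq_abs s
    nlinarith [sq_nonneg (v - c * |s|)]
  have h2 : (v + c * |s|) ^ q
      ≤ (2 * (a ^ 2 + c ^ 2)) ^ (q / 2) * (w ^ 2 + s ^ 2) ^ (q / 2) := by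
    rw [← Real.mul_rpow (by positivity) hQ.le]
    calc (v + c * |s|) ^ q = ((v + c * |s|) ^ 2) ^ (q / 2) := by
          rw [← Real.rpow_natCast _ 2, ← Real.rpow_mul hvs]; congr 1; push_cast; ring
      _ ≤ _ := by gcongr
  have h3 : min (b ^ 2) 1 * (w ^ 2 + s ^ 2) ≤ v ^ 2 + s ^ 2 := by
    have e1 : min (b ^ 2) 1 * w ^ 2 ≤ b ^ 2 * w ^ 2 := by gcongr; exact min_le_left _ _
    have e2 : min (b ^ 2) 1 * s ^ 2 ≤ 1 * s ^ 2 := by gcongr; exact min_le_right _ _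
    have e3 : b ^ 2 * w ^ 2 ≤ v ^ 2 := by rw [← mul_pow]; gcongr
    linarith
  calc _ ≤ (2 * (a ^ 2 + c ^ 2)) ^ (q / 2) * (w ^ 2 + s ^ 2) ^ (q / 2)
        / (min (b ^ 2) 1 * (w ^ 2 + s ^ 2)) := by gcongr
    _ = _ := by
      rw [show (q - 2) / 2 = q / 2 - 1 by ring, Real.rpow_sub_one hQ.ne']
      field_simp

section

variable {n k : ℕ} {p : ℝ} {hp : 1 < p} {hpn : p < n}

theorem D1p.measurable_orlicz (γ e : ℝ) (u : D1p n p hp hpn) :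
    Measurable fun x => orlicz p (bracket γ x) (e * D1p.fn u x) := by
  have h1 := D1p.measurable_fn u
  have h2 := (continuous_bracket (n := n) γ).measurable
  unfold orlicz
  fun_prop

theorem D1p.lintegral_orlicz_grad_smul (r : ℝ) {e : ℝ} (he : 0 ≤ e) (u : D1p n p hp hpn) :
    ∫⁻ x, ENNReal.ofReal (orlicz p (bracket r x) ‖D1p.grad (e • u) x‖)
      = ∫⁻ x, ENNReal.ofReal (orlicz p (bracket r x) (e * ‖D1p.grad u x‖)) := by
  refine lintegral_congr_ae ?_
  filter_upwards [D1p.grad_smul e u] with x hx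
  rw [hx, norm_smul, Real.norm_of_nonneg he]

theorem D1p.lintegral_hardy_of_energy (hk : 3 ≤ k) (hkn : k ≤ n) (hp2 : p < 2) {γ : ℝ}
    (hγ : 0 ≤ γ) {e B : ℝ} (he : 0 < e) (u : D1p n p hp hpn)
    (hu : ∫⁻ x, ENNReal.ofReal (orlicz p (bracket (γ + 1) x) (e * ‖D1p.grad u x‖))
      ≤ ENNReal.ofReal (e ^ 2 * B)) :
    ∫⁻ x, ENNReal.ofReal (normY k x ^ (-p) *
        ((e ^ 2)⁻¹ * orlicz p (bracket γ x) (e * D1p.fn u x)))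
      ≤ ENNReal.ofReal (64 * B) := by
  have h := D1p.lintegral_orlicz_hardy_le hk hkn hp2 hγ (e • u)
  rw [D1p.lintegral_orlicz_grad_smul _ he.le] at h
  calc _ = ∫⁻ x, ENNReal.ofReal ((e ^ 2)⁻¹ *
        (normY k x ^ (-p) * orlicz p (bracket γ x) (D1p.fn (e • u) x))) := by
        refine lintegral_congr_ae ?_
        filter_upwards [D1p.fn_smul e u] with x hx
        rw [hx]; congr 1; ring
    _ ≤ ENNReal.ofReal (e ^ 2)⁻¹ * (64 * ENNReal.ofReal (e ^ 2 * B)) := by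
        rw [lintegral_ofReal_const_mul (by positivity)]
        gcongr
        exact h.trans (by gcongr)
    _ = _ := by
        rw [← ENNReal.ofReal_ofNat 64, ← ENNReal.ofReal_mul (by norm_num),
          ← ENNReal.ofReal_mul (by positivity)]
        congr 1; field_simp

theorem D1p.exists_lintegral_sobolev_of_energy (hk : 3 ≤ k) (hkn : k ≤ n) (hp : 1 < p)
    (hpn : p < n) (hp2 : p < 2) {γ : ℝ} (hγ : 0 ≤ γ) {B : ℝ} (hB : 0 ≤ B) :
    ∃ S : ℝ, 0 ≤ S ∧ ∀ (e : ℝ) (u : D1p n p hp hpn), 0 < e →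
      ∫⁻ x, ENNReal.ofReal (orlicz p (bracket (γ + 1) x) (e * ‖D1p.grad u x‖))
        ≤ ENNReal.ofReal (e ^ 2 * B) →
      ∫⁻ x, ENNReal.ofReal (((e ^ 2)⁻¹ * orlicz p (bracket γ x) (e * D1p.fn u x))
        ^ ((n : ℝ) / (n - p))) ≤ ENNReal.ofReal S := by
  obtain ⟨C, hC, h⟩ := D1p.exists_lintegral_orlicz_sobolev_le hk hkn hp hpn hp2 hγ
  have hr0 : 0 < (n : ℝ) / (n - p) := div_pos (by linarith) (by linarith)
  refine ⟨(C * B) ^ ((n : ℝ) / (n - p)), by positivity, fun e u he hu => ?_⟩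
  have h := h (e • u)
  rw [D1p.lintegral_orlicz_grad_smul _ he.le] at h
  calc _ = ∫⁻ x, ENNReal.ofReal (((e ^ 2)⁻¹) ^ ((n : ℝ) / (n - p)) *
        orlicz p (bracket γ x) (D1p.fn (e • u) x) ^ ((n : ℝ) / (n - p))) := by
        refine lintegral_congr_ae ?_
        filter_upwards [D1p.fn_smul e u] with x hx
        rw [hx, Real.mul_rpow (by positivity) (orlicz_nonneg _ _ _)]
    _ ≤ ENNReal.ofReal (((e ^ 2)⁻¹) ^ ((n : ℝ) / (n - p))) *
          (ENNReal.ofReal C * ENNReal.ofReal (e ^ 2 * B)) ^ ((n : ℝ) / (n - p)) := by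
        rw [lintegral_ofReal_const_mul (by positivity)]
        gcongr
        exact h.trans (by gcongr)
    _ = _ := by
        rw [← ENNReal.ofReal_mul hC, ENNReal.ofReal_rpow_of_nonneg (by positivity) hr0.le,
          ← ENNReal.ofReal_mul (by positivity), ← Real.mul_rpow (by positivity) (by positivity)]
        congr 2; field_simp

/-- The weighted densities are tight: they are dominated by a fixed integrable function up to
remainders whose integrals are eventually small. -/
theorem D1p.exists_dominating_add_small (hk : 3 ≤ k) (hkn : k ≤ n) (hp : 1 < p) (hpn : p < n)
    (hp2 : p < 2) {ε : ℕ → ℝ} (hε : ∀ i, 0 < ε i) (hε0 : Tendsto ε atTop (𝓝 0))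
    (φ : ℕ → D1p n p hp hpn) {B : ℝ} (hB : 0 ≤ B)
    (hφ : ∀ i, ∫⁻ x, ENNReal.ofReal (orlicz p (bracket (((n : ℝ) - p) / (p - 1) + 1) x)
      (ε i * ‖D1p.grad (φ i) x‖)) ≤ ENNReal.ofReal (ε i ^ 2 * B)) {η : ℝ≥0∞} (hη : 0 < η) :
    ∃ (D : E n → ℝ≥0∞) (R : ℕ → E n → ℝ≥0∞), Measurable D ∧ ∫⁻ x, D x ≠ ⊤ ∧
      (∀ i x, ENNReal.ofReal ((normY k x)⁻¹ *
        (bracket (((n : ℝ) - p) / (p - 1)) x ^ 2 + (ε i * D1p.fn (φ i) x) ^ 2) ^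
          ((weightExp n p - 2) / 2) * D1p.fn (φ i) x ^ 2) ≤ R i x + D x) ∧
      ∀ᶠ i in atTop, ∫⁻ x, R i x ≤ η := by
  set γ := ((n : ℝ) - p) / (p - 1) with hγ
  have hγ0 : 0 ≤ γ := div_nonneg (by linarith) (by linarith)
  set r := (n : ℝ) / (n - p) with hr
  have hr1 : 1 < r := by rw [hr, lt_div_iff₀ (by linarith)]; linarith
  obtain ⟨S, hS, hSob⟩ := D1p.exists_lintegral_sobolev_of_energy hk hkn hp hpn hp2 hγ0 hB
  obtain ⟨δ, hδ, hδη⟩ : ∃ δ : ℝ, 0 < δ ∧ ENNReal.ofReal δ ≤ η := by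
    refine ⟨(min η 1).toReal, ENNReal.toReal_pos (lt_min hη one_pos).ne' (by simp), ?_⟩
    rw [ENNReal.ofReal_toReal (by simp)]
    exact min_le_left _ _
  set κ : ℝ := δ / (2 * (64 * B + S + 1)) with hκ
  have hκ0 : 0 < κ := by positivity
  obtain ⟨A, D, ρ, hA, hD, hbound⟩ := exists_weighted_density_bound (n := n) k hp hp2 hpn hκ0
  set J : ℕ → E n → ℝ := fun i x => orlicz p (bracket γ x) (ε i * D1p.fn (φ i) x) with hJdef
  have hJ0 : ∀ i x, 0 ≤ J i x := fun i x => orlicz_nonneg _ _ _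
  have hJm : ∀ i, Measurable (J i) := fun i => D1p.measurable_orlicz γ (ε i) (φ i)
  have hYm : Measurable fun x : E n => normY k x := (continuous_normY k).measurable
  -- the middle term carries a positive power of `ε`, because `r > 1`
  have hpowε : ∀ i x, (ε i ^ 2)⁻¹ * J i x ^ r
      = (ε i ^ 2) ^ (r - 1) * ((ε i ^ 2)⁻¹ * J i x) ^ r := by
    intro i x
    have h0 : 0 < ε i ^ 2 := pow_pos (hε i) 2
    rw [Real.mul_rpow (by positivity) (hJ0 i x), Real.inv_rpow h0.le, Real.rpow_sub_one h0.ne']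
    have : 0 < (ε i ^ 2) ^ r := Real.rpow_pos_of_pos h0 r
    field_simp
  refine ⟨(Metric.ball (0 : E n) ρ).indicator fun _ => ENNReal.ofReal D,
    fun i x => ENNReal.ofReal (κ * (normY k x ^ (-p) * ((ε i ^ 2)⁻¹ * J i x)))
      + ENNReal.ofReal ((A * (ε i ^ 2) ^ (r - 1) + κ) * ((ε i ^ 2)⁻¹ * J i x) ^ r),
    measurable_const.indicator measurableSet_ball, ?_, ?_, ?_⟩
  · rw [lintegral_indicator measurableSet_ball, setLIntegral_const]
    exact ENNReal.mul_ne_top ENNReal.ofReal_ne_top measure_ball_lt_top.ne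
  · intro i x
    have h0 : 0 < ε i ^ 2 := pow_pos (hε i) 2
    have hJ := hJ0 i x
    have hY := normY_nonneg k x
    have h1 := hbound x (ε i) (D1p.fn (φ i) x) (hε i)
    have h2 : (Metric.ball (0 : E n) ρ).indicator (fun _ => ENNReal.ofReal D) x
        = ENNReal.ofReal ((Metric.ball (0 : E n) ρ).indicator (fun _ => D) x) := by
      by_cases hx : x ∈ Metric.ball (0 : E n) ρ <;> simp [Set.indicator, hx]
    beta_reduce
    rw [h2, ← ENNReal.ofReal_add (by positivity) (by positivity), ← ENNReal.ofReal_add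
      (by positivity) (Set.indicator_nonneg (fun _ _ => hD) _)]
    refine ENNReal.ofReal_le_ofReal (h1.trans (le_of_eq ?_))
    have h3 := hpowε i x
    simp only [hJdef] at h3 ⊢
    rw [h3]
    ring
  · have hlim : Tendsto (fun i => A * (ε i ^ 2) ^ (r - 1) * S) atTop (𝓝 0) := by
      have h1 : Tendsto (fun i => (ε i ^ 2) ^ (r - 1)) atTop (𝓝 ((0 ^ 2) ^ (r - 1))) :=
        ((hε0.pow 2).rpow_const (Or.inr (by linarith)))
      rw [zero_pow two_ne_zero, Real.zero_rpow (by linarith)] at h1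
      simpa using (h1.const_mul A).mul_const S
    filter_upwards [hlim.eventually_le_const (half_pos hδ)] with i hi
    have h0 : 0 < ε i ^ 2 := pow_pos (hε i) 2
    have hc : 0 ≤ A * (ε i ^ 2) ^ (r - 1) + κ := by positivity
    rw [lintegral_add_left (by have := hJm i; fun_prop), lintegral_ofReal_const_mul hκ0.le,
      lintegral_ofReal_const_mul hc]
    have hH := D1p.lintegral_hardy_of_energy hk hkn hp2 hγ0 (hε i) (φ i) (hφ i)
    have hS' := hSob (ε i) (φ i) (hε i) (hφ i)
    calc _ ≤ ENNReal.ofReal κ * ENNReal.ofReal (64 * B)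
          + ENNReal.ofReal (A * (ε i ^ 2) ^ (r - 1) + κ) * ENNReal.ofReal S := by gcongr
      _ = ENNReal.ofReal (κ * (64 * B + S) + A * (ε i ^ 2) ^ (r - 1) * S) := by
        rw [← ENNReal.ofReal_mul hκ0.le, ← ENNReal.ofReal_mul hc,
          ← ENNReal.ofReal_add (by positivity) (by positivity)]
        congr 1; ring
      _ ≤ ENNReal.ofReal δ := by
        refine ENNReal.ofReal_le_ofReal ?_
        have h1 : κ * (64 * B + S) ≤ δ / 2 := by
          rw [hκ, div_mul_eq_mul_div, div_le_div_iff₀ (by positivity) two_pos]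
          nlinarith
        linarith
      _ ≤ η := hδη

/-- Convergence of `∫ |y|⁻¹ N_i / (v² + (ε_i φ_i)²) φ_i²` for any numerators `N_i → v^q` with
`N_i ≤ (v + C ε_i |φ_i|)^q`. -/
theorem D1p.tendsto_lintegral_weighted (hk : 3 ≤ k) (hkn : k ≤ n) (hp : 1 < p) (hpn : p < n)
    (hp2 : p < 2) {a : ℝ} (ha : 0 < a) {ε : ℕ → ℝ} (hε : ∀ i, 0 < ε i)
    (hε0 : Tendsto ε atTop (𝓝 0)) (φ : ℕ → D1p n p hp hpn) {B : ℝ} (hB : 0 ≤ B)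
    (hφ : ∀ i, ∫⁻ x, ENNReal.ofReal (orlicz p (bracket (((n : ℝ) - p) / (p - 1) + 1) x)
      (ε i * ‖D1p.grad (φ i) x‖)) ≤ ENNReal.ofReal (ε i ^ 2 * B)) {φ₀ : D1p n p hp hpn}
    (hae : ∀ᵐ x, Tendsto (fun i => D1p.fn (φ i) x) atTop (𝓝 (D1p.fn φ₀ x))) {c : ℝ} (hc : 0 ≤ c)
    {N : ℕ → E n → ℝ} (hNm : ∀ i, Measurable (N i))
    (hNle : ∀ i x, N i x ≤ (extremal n k p a x + c * |ε i * D1p.fn (φ i) x|) ^ weightExp n p)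
    (hNlim : ∀ x, Tendsto (fun i => ε i * D1p.fn (φ i) x) atTop (𝓝 0) →
      Tendsto (fun i => N i x) atTop (𝓝 (extremal n k p a x ^ weightExp n p))) :
    Tendsto (fun i => ∫⁻ x, ENNReal.ofReal ((normY k x)⁻¹ *
        (N i x / (extremal n k p a x ^ 2 + (ε i * D1p.fn (φ i) x) ^ 2)) * D1p.fn (φ i) x ^ 2))
      atTop (𝓝 (∫⁻ x, ENNReal.ofReal ((normY k x)⁻¹ *
        extremal n k p a x ^ (weightExp n p - 2) * D1p.fn φ₀ x ^ 2))) ∧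
    ∫⁻ x, ENNReal.ofReal ((normY k x)⁻¹ *
        extremal n k p a x ^ (weightExp n p - 2) * D1p.fn φ₀ x ^ 2) ≠ ⊤ := by
  have hYm : Measurable fun x : E n => normY k x := (continuous_normY k).measurable
  have hvm : Measurable (extremal n k p a) := continuous_extremal.measurable
  have hq0 : 0 ≤ weightExp n p := by
    unfold weightExp
    have : 0 < (n : ℝ) - p := by linarith
    have : 0 < (n : ℝ) - 1 := by linarith
    positivity
  refine tendsto_lintegral_of_dominated_add_small (fun i => ?_) ?_ fun η hη => ?_
  · have h1 := hNm i
    have h2 := D1p.measurable_fn (φ i)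
    exact Measurable.aemeasurable (by fun_prop)
  · filter_upwards [hae] with x hx
    have hv := extremal_pos (n := n) (k := k) (p := p) ha x
    have h1 : Tendsto (fun i => ε i * D1p.fn (φ i) x) atTop (𝓝 0) := by
      simpa using hε0.mul hx
    have h2 : Tendsto (fun i => extremal n k p a x ^ 2 + (ε i * D1p.fn (φ i) x) ^ 2) atTop
        (𝓝 (extremal n k p a x ^ 2)) := by
      simpa using (h1.pow 2).const_add (extremal n k p a x ^ 2)
    have h3 := ((hNlim x h1).div h2 (by positivity)).const_mul (normY k x)⁻¹
    have h4 : extremal n k p a x ^ (weightExp n p - 2)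
        = extremal n k p a x ^ weightExp n p / extremal n k p a x ^ 2 := by
      rw [Real.rpow_sub hv, Real.rpow_two]
    rw [h4]
    exact (ENNReal.continuous_ofReal.tendsto _).comp (h3.mul (hx.pow 2))
  set M : ℝ := (2 * (a ^ 2 + c ^ 2)) ^ (weightExp n p / 2) /
    min ((a * 2 ^ (-((((n : ℝ) - p) / (p - 1)) / 2))) ^ 2) 1 with hM
  have hb0 : 0 < a * 2 ^ (-((((n : ℝ) - p) / (p - 1)) / 2)) := by positivity
  have hM0 : 0 < M := by positivity
  have hMη : 0 < η / ENNReal.ofReal M := ENNReal.div_pos hη.ne' ENNReal.ofReal_ne_top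
  obtain ⟨D, R, hDm, hD, hle, hR⟩ :=
    D1p.exists_dominating_add_small hk hkn hp hpn hp2 hε hε0 φ hB hφ hMη
  refine ⟨fun x => ENNReal.ofReal M * D x, fun i x => ENNReal.ofReal M * R i x,
    (hDm.const_mul _).aemeasurable, ?_, fun i => ae_of_all _ fun x => ?_, ?_⟩
  · rw [lintegral_const_mul' _ _ ENNReal.ofReal_ne_top]
    exact ENNReal.mul_ne_top ENNReal.ofReal_ne_top hD
  · have h1 := hle i x
    have h2 := add_mul_abs_rpow_div_le (s := ε i * D1p.fn (φ i) x) (bracket_pos _ x) hb0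
      (le_extremal (k := k) hp hpn ha x) (extremal_le hp hpn ha x) hc hq0
    have hv := extremal_pos (n := n) (k := k) (p := p) ha x
    have hY := normY_nonneg k x
    rw [← mul_add]
    refine le_trans ?_ (mul_le_mul_right h1 (ENNReal.ofReal M))
    rw [← ENNReal.ofReal_mul hM0.le]
    refine ENNReal.ofReal_le_ofReal ?_
    calc _ ≤ (normY k x)⁻¹ * (M * (bracket (((n : ℝ) - p) / (p - 1)) x ^ 2 +
          (ε i * D1p.fn (φ i) x) ^ 2) ^ ((weightExp n p - 2) / 2)) * D1p.fn (φ i) x ^ 2 := by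
          gcongr
          refine le_trans ?_ h2
          gcongr
          exact hNle i x
      _ = _ := by ring
  · filter_upwards [hR] with i hi
    rw [lintegral_const_mul' _ _ ENNReal.ofReal_ne_top]
    calc _ ≤ ENNReal.ofReal M * (η / ENNReal.ofReal M) := by gcongr
      _ ≤ η := ENNReal.mul_div_le

/-- Weakly convergent sequences with bounded energies converge almost everywhere along a
subsequence. -/
theorem D1p.exists_subseq_tendsto_ae (hp2 : p < 2) {r B : ℝ}
    (hr : ∫⁻ x : E n, ENNReal.ofReal (bracket r x ^ p) ≠ ⊤) {ε : ℕ → ℝ}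
    (hε : ∀ i, ε i ∈ Set.Ioo (0 : ℝ) 1) {φ : ℕ → D1p n p hp hpn} {φ₀ : D1p n p hp hpn}
    (hφ : ∀ i, ∫⁻ x, ENNReal.ofReal (orlicz p (bracket r x) (ε i * ‖D1p.grad (φ i) x‖))
      ≤ ENNReal.ofReal (ε i ^ 2 * B)) (hweak : D1p.TendstoWeakly φ φ₀) :
    ∃ σ : ℕ → ℕ, StrictMono σ ∧
      ∀ᵐ x, Tendsto (fun i => D1p.fn (φ (σ i)) x) atTop (𝓝 (D1p.fn φ₀ x)) := by
  have hp0 : 0 < p := by linarith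
  have hfin : ∫⁻ x, ‖D1p.grad φ₀ x‖ₑ ^ p ≠ ⊤ := by
    have h := lintegral_rpow_enorm_lt_top_of_eLpNorm_lt_top (μ := volume) (f := D1p.grad φ₀)
      (p := ENNReal.ofReal p) (by simpa using hp0) ENNReal.ofReal_ne_top (Lp.memLp φ₀.1.2).2
    rw [ENNReal.toReal_ofReal hp0.le] at h
    exact h.ne
  obtain ⟨σ, hσ, hae⟩ := D1p.exists_subseq_tendsto_ae_zero (fun i => φ i - φ₀)
    (N := 2 ^ (p - 1) * ((∫⁻ x : E n, ENNReal.ofReal (bracket r x ^ p)) + ENNReal.ofReal (2 * B)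
      + ∫⁻ x, ‖D1p.grad φ₀ x‖ₑ ^ p))
    (fun l hl => by simpa using (hweak l hl).sub_const (l φ₀))
    (ENNReal.mul_ne_top (ENNReal.rpow_ne_top_of_nonneg (by linarith) (by simp))
      (by finiteness)) fun i => by
      have hm := (D1p.measurable_grad φ₀).enorm.pow_const p
      calc ∫⁻ x, ‖D1p.grad (φ i - φ₀) x‖ₑ ^ p
          ≤ ∫⁻ x, 2 ^ (p - 1) * (‖D1p.grad (φ i) x‖ₑ ^ p + ‖D1p.grad φ₀ x‖ₑ ^ p) := by
            refine lintegral_mono_ae ?_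
            filter_upwards [Lp.coeFn_sub (φ i).1.2 φ₀.1.2] with x hx
            have hx' : D1p.grad (φ i - φ₀) x = D1p.grad (φ i) x - D1p.grad φ₀ x := hx
            rw [hx']
            refine le_trans ?_ (ENNReal.rpow_add_le_mul_rpow_add_rpow _ _ hp.le)
            gcongr
            exact enorm_sub_le
        _ ≤ _ := by
            rw [lintegral_const_mul' _ _ (ENNReal.rpow_ne_top_of_nonneg (by linarith) (by simp)),
              lintegral_add_right _ hm]
            gcongr
            exact D1p.lintegral_grad_rpow_le hp2 (hε i) (φ i) (hφ i)
  refine ⟨σ, hσ, ?_⟩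
  filter_upwards [hae, ae_all_iff.2 fun i => D1p.fn_sub (φ (σ i)) φ₀] with x hx hsub
  simpa [hsub] using hx.add_const (D1p.fn φ₀ x)

end

end HSM

theorem lemma2p3 (n k : ℕ) (hn : 4 ≤ n) (hk : 3 ≤ k) (hkn : k ≤ n)
    (p : ℝ) (hp : 1 < p) (hpn : p < n) (hp' : p ≤ 2 * n / (n + 1))
    (a : ℝ) (ha : 0 < a)
    (ε : ℕ → ℝ) (hε : ∀ i, ε i ∈ Set.Ioo (0 : ℝ) 1) (hε0 : Tendsto ε atTop (𝓝 0))
    (φ : ℕ → HSM.D1p n p hp hpn)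
    (hφ : ∀ i, ∫⁻ x, ENNReal.ofReal
      ((‖gradient (HSM.extremal n k p a) x‖ + ε i * ‖HSM.D1p.grad (φ i) x‖) ^ (p - 2)
        * ‖HSM.D1p.grad (φ i) x‖ ^ 2) ≤ 1) :
    ∃ (σ : ℕ → ℕ) (φ₀ : HSM.D1p n p hp hpn), StrictMono σ ∧
      HSM.D1p.TendstoWeakly (fun i => φ (σ i)) φ₀ ∧
      MemLp (HSM.D1p.fn φ₀) 2 (HSM.weightMeasure n k p a) ∧
      ∀ C₁ : ℝ, 0 ≤ C₁ →
        Tendsto (fun i => ∫⁻ x, ENNReal.ofReal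
            ((HSM.normY k x)⁻¹
              * ((HSM.extremal n k p a x + C₁ * ε (σ i) * |HSM.D1p.fn (φ (σ i)) x|) ^ HSM.weightExp n p
                / (HSM.extremal n k p a x ^ 2 + (ε (σ i) * HSM.D1p.fn (φ (σ i)) x) ^ 2))
              * HSM.D1p.fn (φ (σ i)) x ^ 2)) atTop
          (𝓝 (∫⁻ x, ENNReal.ofReal
            ((HSM.normY k x)⁻¹ * HSM.extremal n k p a x ^ (HSM.weightExp n p - 2)
              * HSM.D1p.fn φ₀ x ^ 2))) ∧
        Tendsto (fun i => ∫⁻ x, ENNReal.ofReal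
            ((HSM.normY k x)⁻¹
              * (|HSM.extremal n k p a x + C₁ * ε (σ i) * HSM.D1p.fn (φ (σ i)) x| ^ HSM.weightExp n p
                / (HSM.extremal n k p a x ^ 2 + (ε (σ i) * HSM.D1p.fn (φ (σ i)) x) ^ 2))
              * HSM.D1p.fn (φ (σ i)) x ^ 2)) atTop
          (𝓝 (∫⁻ x, ENNReal.ofReal
            ((HSM.normY k x)⁻¹ * HSM.extremal n k p a x ^ (HSM.weightExp n p - 2)
              * HSM.D1p.fn φ₀ x ^ 2))) := by
  have hn0 : (4 : ℝ) ≤ n := by exact_mod_cast hn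
  have hp2 : p < 2 := hp'.trans_lt (by rw [div_lt_iff₀ (by linarith)]; linarith)
  have hq0 : 0 ≤ HSM.weightExp n p := by
    unfold HSM.weightExp
    exact div_nonneg (mul_nonneg (by linarith) (by linarith)) (by linarith)
  obtain ⟨B, hB, henergy⟩ := HSM.exists_orlicz_energy_le k hp hp2 hpn ha
  have hφB : ∀ i, ∫⁻ x, ENNReal.ofReal (HSM.orlicz p
      (HSM.bracket (((n : ℝ) - p) / (p - 1) + 1) x) (ε i * ‖HSM.D1p.grad (φ i) x‖))
        ≤ ENNReal.ofReal (ε i ^ 2 * B) := by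
    intro i
    have h0 : 0 ≤ ε i ^ 2 * B := by positivity
    calc _ ≤ ∫⁻ x, ENNReal.ofReal (ε i ^ 2 * B *
          ((‖gradient (HSM.extremal n k p a) x‖ + ε i * ‖HSM.D1p.grad (φ i) x‖) ^ (p - 2)
            * ‖HSM.D1p.grad (φ i) x‖ ^ 2)) :=
          lintegral_mono fun x => ENNReal.ofReal_le_ofReal
            (henergy x _ _ (hε i).1 (norm_nonneg _))
      _ ≤ ENNReal.ofReal (ε i ^ 2 * B) * 1 := by
          rw [HSM.lintegral_ofReal_const_mul h0]
          gcongr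
          exact hφ i
      _ = _ := mul_one _
  have hw := HSM.lintegral_bracket_rpow_ne_top (n := n) hp hpn
  obtain ⟨σ₁, φ₀, hσ₁, hweak⟩ := HSM.D1p.exists_tendstoWeakly_of_energy hp2 hw hε hε0 φ hφB
  obtain ⟨σ₂, hσ₂, hae⟩ := HSM.D1p.exists_subseq_tendsto_ae hp2 hw (fun i => hε (σ₁ i))
    (fun i => hφB (σ₁ i)) hweak
  have hσ : StrictMono fun i => σ₁ (σ₂ i) := hσ₁.comp hσ₂
  have hm : ∀ i, Measurable fun x => HSM.D1p.fn (φ (σ₁ (σ₂ i))) x :=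
    fun i => HSM.D1p.measurable_fn _
  have hvm : Measurable (HSM.extremal n k p a) := HSM.continuous_extremal.measurable
  have hv : ∀ x, 0 < HSM.extremal n k p a x := HSM.extremal_pos ha
  have hlim := fun (C₁ : ℝ) (hC₁ : 0 ≤ C₁) =>
    HSM.D1p.tendsto_lintegral_weighted hk hkn hp hpn hp2 ha (fun i => (hε (σ₁ (σ₂ i))).1)
      (hε0.comp hσ.tendsto_atTop) (fun i => φ (σ₁ (σ₂ i))) hB (fun i => hφB (σ₁ (σ₂ i))) hae hC₁
      (N := fun i x => (HSM.extremal n k p a x +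
        C₁ * ε (σ₁ (σ₂ i)) * |HSM.D1p.fn (φ (σ₁ (σ₂ i))) x|) ^ HSM.weightExp n p)
      (fun i => by have := hm i; fun_prop)
      (fun i x => by
        rw [abs_mul, abs_of_pos (hε _).1, mul_assoc])
      (fun x hx => by
        have h1 := ((hx.abs.const_mul C₁).const_add (HSM.extremal n k p a x)).rpow_const
          (p := HSM.weightExp n p) (Or.inr hq0)
        simp only [abs_mul, abs_of_pos (hε _).1, ← mul_assoc] at h1
        simpa using h1)
  refine ⟨fun i => σ₁ (σ₂ i), φ₀, hσ, fun l hl => (hweak l hl).comp hσ₂.tendsto_atTop, ?_,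
    fun C₁ hC₁ => ⟨(hlim C₁ hC₁).1, ?_⟩⟩
  -- the finiteness of the limit of the integrals with `C₁ = 0`
  · have hYm : Measurable fun x : HSM.E n => HSM.normY k x := (HSM.continuous_normY k).measurable
    refine ⟨(HSM.D1p.measurable_fn φ₀).aestronglyMeasurable, ?_⟩
    rw [eLpNorm_lt_top_iff_lintegral_rpow_enorm_lt_top two_ne_zero ENNReal.ofNat_ne_top,
      HSM.weightMeasure, lintegral_withDensity_eq_lintegral_mul _ (by fun_prop)
        (by have := HSM.D1p.measurable_fn φ₀; fun_prop)]
    refine lt_of_le_of_lt (le_of_eq (lintegral_congr fun x => ?_)) (hlim 0 le_rfl).2.lt_top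
    have h0 : 0 ≤ (HSM.normY k x)⁻¹ * HSM.extremal n k p a x ^ (HSM.weightExp n p - 2) := by
      have h1 := HSM.normY_nonneg k x
      have h2 := hv x
      positivity
    rw [Pi.mul_apply, ENNReal.ofReal_mul h0, ENNReal.toReal_ofNat, ENNReal.rpow_ofNat,
      ← sq_abs (HSM.D1p.fn φ₀ x), ENNReal.ofReal_pow (abs_nonneg _), Real.enorm_eq_ofReal_abs]
  · refine (HSM.D1p.tendsto_lintegral_weighted hk hkn hp hpn hp2 ha
      (fun i => (hε (σ₁ (σ₂ i))).1) (hε0.comp hσ.tendsto_atTop) (fun i => φ (σ₁ (σ₂ i))) hB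
      (fun i => hφB (σ₁ (σ₂ i))) hae hC₁
      (N := fun i x => |HSM.extremal n k p a x +
        C₁ * ε (σ₁ (σ₂ i)) * HSM.D1p.fn (φ (σ₁ (σ₂ i))) x| ^ HSM.weightExp n p)
      (fun i => ?_) (fun i x => ?_) (fun x hx => ?_)).1
    · have := hm i
      have h1 : Measurable fun x => HSM.extremal n k p a x +
        C₁ * ε (σ₁ (σ₂ i)) * HSM.D1p.fn (φ (σ₁ (σ₂ i))) x := by fun_prop
      exact h1.norm.pow_const _
    · refine Real.rpow_le_rpow (abs_nonneg _) ((abs_add_le _ _).trans (le_of_eq ?_)) hq0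
      rw [abs_of_pos (hv x), mul_assoc, abs_mul, abs_of_nonneg hC₁]
    · have h1 := ((hx.const_mul C₁).const_add (HSM.extremal n k p a x)).abs.rpow_const
        (p := HSM.weightExp n p) (Or.inr hq0)
      simp only [← mul_assoc] at h1
      simpa [abs_of_pos (hv x)] using h1
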